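/- Let $n\ge 0$ be the number of tangential variables (so $d=n+1$; the cases $d=2,3$ are $n=1,2$), and write points of $\{t\ge0,\ x'\in\mathbb{R}^{n},\ y\ge 0\}$ as $(t,x',y)$; $\nabla_h$ and $\nabla_h\cdot$ denote gradient and divergence in $x'$. Let $U_h:[0,\infty)\to\mathbb{R}^n$, $u_{h0}:\mathbb{R}^n\times[0,\infty)\to\mathbb{R}^n$ and $\theta_0:\mathbb{R}^n\times[0,\infty)\to\mathbb{R}$ be smooth ($C^\infty$ up to $y=0$). Consider the linearization at the shear flow $(U_h(y),0,1)$ of the thermal layer equations, $$\begin{cases}\partial_t u_h+U_h(y)\cdot\nabla_h u_h+U_h'(y)\,u_d=0,\\ \partial_t\theta+U_h(y)\cdot\nabla_h\theta=\partial_y^2\theta,\\ \nabla_h\cdot u_h+\partial_y u_d=\partial_y^2\theta,\\ (u_d,\theta)|_{y=0}=0,\qquad (u_h,\theta)|_{t=0}=(u_{h0},\theta_0),\end{cases}\tag{1}$$ and assume the compatibility conditions up to order one: for all $x'$, $\theta_0(x',0)=0$ and $\partial_y^2\theta_0(x',0)-U_h(0)\cdot\nabla_h\theta_0(x',0)=0$.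 A classical solution of (1) is a triple with $u_h\in C^1$, $\theta\in C^1$, $u_d$ continuous, and $\partial_yu_d$, $\partial_y^2\theta$ existing and continuous, all on the closed domain $\{t\ge0,\,y\ge0\}$ (one-sided derivatives at the boundary), which satisfies (1). Classical solutions of $$\partial_t\theta+U_h(y)\cdot\nabla_h\theta=\partial_y^2\theta,\qquad \theta|_{y=0}=0,\qquad \theta|_{t=0}=\theta_0\tag{2}$$ are understood with the same regularity of $\theta$. Then problem (2) has a global classical solution $\theta$, and for every classical solution $\theta$ of (2) there are $u_h,u_d$ such that $(u_h,u_d,\theta)$ is a global classical solution of (1) and, for all $t\ge0$, $x'\in\mathbb{R}^n$, $y\ge0$, $$\begin{aligned}u_h(t,x',y)={}&u_{h0}(x'-tU_h(y),y)+tU_h'(y)\int_0^y(\nabla_h\cdot u_{h0})(x'-tU_h(z),z)\,dz\\&+U_h'(y)\int_0^y\theta_0(x'-tU_h(z),z)\,dz-U_h'(y)\int_0^y\theta(t,x',z)\,dz,\\ u_d(t,x',y)={}&\partial_y\theta(t,x',y)-\partial_y\theta(t,x',0)-\int_0^y(\nabla_h\cdot u_{h0})(x'-tU_h(z),z)\,dz\\&-t\int_0^y[U_h(y)-U_h(z)]\cdot\nabla_h(\nabla_h\cdot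 u_{h0})(x'-tU_h(z),z)\,dz\\&-\int_0^y[U_h(y)-U_h(z)]\cdot\nabla_h\theta_0(x'-tU_h(z),z)\,dz+\int_0^y[U_h(y)-U_h(z)]\cdot\nabla_h\theta(t,x',z)\,dz.\end{aligned}$$ In particular, (1) has a classical solution. -/

import Mathlib

open Set
open scoped ContDiff

noncomputable section

namespace ThermalLayer

/-- The space of tangential variables `x'`, with `n` coordinates. -/
abbrev Tan (n : ℕ) : Type := EuclideanSpace ℝ (Fin n)

/-- The closed half space of points `(x', y)` with `y ≥ 0`. -/
def halfSpace (n : ℕ) : Set (Tan n × ℝ) := univ ×ˢ Ici 0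

/-- The closed space-time domain of points `(t, x', y)` with `t ≥ 0` and `y ≥ 0`. -/
def domain (n : ℕ) : Set (ℝ × Tan n × ℝ) := Ici 0 ×ˢ univ ×ˢ Ici 0

/-- Derivative of a function of one variable on `[0, ∞)`, one-sided at `0`. -/
def dHalf {F : Type*} [NormedAddCommGroup F] [NormedSpace ℝ F] (g : ℝ → F) (y : ℝ) : F :=
  derivWithin g (Ici 0) y

/-- Tangential directional derivative `(v · ∇_h) g` at `x'`. -/
def dirDeriv {n : ℕ} {F : Type*} [NormedAddCommGroup F] [NormedSpace ℝ F]
    (v : Tan n) (g : Tan n → F) (x : Tan n) : F :=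
  fderiv ℝ g x v

/-- Tangential divergence `∇_h · w` at `x'`. -/
def divH {n : ℕ} (w : Tan n → Tan n) (x : Tan n) : ℝ :=
  ∑ i : Fin n, (fderiv ℝ w x (EuclideanSpace.single i 1)) i

/-- Time derivative `∂_t f`. -/
def dt {n : ℕ} {F : Type*} [NormedAddCommGroup F] [NormedSpace ℝ F]
    (f : ℝ → Tan n → ℝ → F) (t : ℝ) (x : Tan n) (y : ℝ) : F :=
  dHalf (fun s => f s x y) t

/-- Normal derivative `∂_y f`. -/
def dy {n : ℕ} {F : Type*} [NormedAddCommGroup F] [NormedSpace ℝ F]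
    (f : ℝ → Tan n → ℝ → F) (t : ℝ) (x : Tan n) (y : ℝ) : F :=
  dHalf (fun z => f t x z) y

/-- The compatibility conditions up to order one of the linearized problem at the corner
`t = 0`, `y = 0`: the initial values of `θ` and of `∂_t θ`, the latter computed from the equation
`∂_t θ = ∂_y² θ - U_h · ∇_h θ`, vanish for `y = 0`. (The condition `u_d = 0` at `y = 0` imposes
nothing on the data, since `u_d` is recovered by integration from `y = 0`.) -/
def Compatible {n : ℕ} (U : ℝ → Tan n) (θ₀ : Tan n → ℝ → ℝ) : Prop :=
  (∀ x, θ₀ x 0 = 0) ∧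
  (∀ x, dHalf (dHalf (θ₀ x)) 0 - dirDeriv (U 0) (fun x' => θ₀ x' 0) x = 0)

/-- `θ` is a global classical solution, with all derivatives that occur continuous up to the
boundary, of `∂_t θ + U_h · ∇_h θ = ∂_y² θ`, `θ = 0` for `y = 0`, `θ = θ₀` for `t = 0`. -/
structure IsTemperatureSolution {n : ℕ} (U : ℝ → Tan n) (θ₀ : Tan n → ℝ → ℝ)
    (θ : ℝ → Tan n → ℝ → ℝ) : Prop where
  contDiffOn : ContDiffOn ℝ 1 (fun p : ℝ × Tan n × ℝ => θ p.1 p.2.1 p.2.2) (domain n)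
  differentiable_dy : ∀ t x, 0 ≤ t → DifferentiableOn ℝ (fun z => dy θ t x z) (Ici 0)
  continuousOn_dyy :
    ContinuousOn (fun p : ℝ × Tan n × ℝ => dy (dy θ) p.1 p.2.1 p.2.2) (domain n)
  equation : ∀ t x y, 0 ≤ t → 0 ≤ y →
    dt θ t x y + dirDeriv (U y) (fun x' => θ t x' y) x = dy (dy θ) t x y
  boundary : ∀ t x, 0 ≤ t → θ t x 0 = 0
  initial : ∀ x y, 0 ≤ y → θ 0 x y = θ₀ x y

/-- `(u_h, u_d, θ)` is a global classical solution, with all derivatives that occur continuous up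
to the boundary, of the linearization at the shear flow `(U_h(y), 0, 1)`. -/
structure IsLinearizedSolution {n : ℕ} (U : ℝ → Tan n) (u₀ : Tan n → ℝ → Tan n)
    (θ₀ : Tan n → ℝ → ℝ) (uh : ℝ → Tan n → ℝ → Tan n) (ud θ : ℝ → Tan n → ℝ → ℝ) : Prop where
  contDiffOn_uh : ContDiffOn ℝ 1 (fun p : ℝ × Tan n × ℝ => uh p.1 p.2.1 p.2.2) (domain n)
  continuousOn_ud : ContinuousOn (fun p : ℝ × Tan n × ℝ => ud p.1 p.2.1 p.2.2) (domain n)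
  differentiable_ud : ∀ t x, 0 ≤ t → DifferentiableOn ℝ (fun z => ud t x z) (Ici 0)
  continuousOn_dy_ud :
    ContinuousOn (fun p : ℝ × Tan n × ℝ => dy ud p.1 p.2.1 p.2.2) (domain n)
  contDiffOn_theta : ContDiffOn ℝ 1 (fun p : ℝ × Tan n × ℝ => θ p.1 p.2.1 p.2.2) (domain n)
  differentiable_dy_theta : ∀ t x, 0 ≤ t → DifferentiableOn ℝ (fun z => dy θ t x z) (Ici 0)
  continuousOn_dyy_theta :
    ContinuousOn (fun p : ℝ × Tan n × ℝ => dy (dy θ) p.1 p.2.1 p.2.2) (domain n)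
  velocity : ∀ t x y, 0 ≤ t → 0 ≤ y →
    dt uh t x y + dirDeriv (U y) (fun x' => uh t x' y) x + ud t x y • dHalf U y = 0
  temperature : ∀ t x y, 0 ≤ t → 0 ≤ y →
    dt θ t x y + dirDeriv (U y) (fun x' => θ t x' y) x = dy (dy θ) t x y
  divergence : ∀ t x y, 0 ≤ t → 0 ≤ y →
    divH (fun x' => uh t x' y) x + dy ud t x y = dy (dy θ) t x y
  boundary_ud : ∀ t x, 0 ≤ t → ud t x 0 = 0
  boundary_theta : ∀ t x, 0 ≤ t → θ t x 0 = 0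
  initial_uh : ∀ x y, 0 ≤ y → uh 0 x y = u₀ x y
  initial_theta : ∀ x y, 0 ≤ y → θ 0 x y = θ₀ x y

end ThermalLayer

end

/-! The velocity is determined by the temperature. Integrating the divergence equation in `y` and
inserting it into the velocity equation gives the stated formulas, and conversely the formulas are
checked by differentiation. A transported function `g(x' - t U(y), y)` is annihilated by `∂_t + U ·
∇_h`, and integrating the temperature equation over `(0, y)` supplies the time derivative of `∫ θ`.
This is `isLinearizedSolution_of_temperature`.

The real work is the existence of `θ`. Neither `U` nor `θ₀` is restricted at infinity, so no global
energy space is available, and without growth conditions solutions on different bounded boxes need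
not agree. The construction is therefore of Mittag-Leffler type (`exists_global_jetSol`). Solutions
on larger and larger boxes are corrected by global solutions with zero initial data, so that
consecutive ones differ by at most `2⁻ᵐ` together with all derivatives involved, and the limit is a
global solution. Two ingredients are needed.

Local solvability (`exists_local_jetSol`): the data are cut off to compact support and `y` is
restricted to `[0, L]` with a second Dirichlet condition at `L`. The Fourier transform in `x'` turns
the equation into `∂_t f = f'' - b f` with `b = 2πi⟨ξ, U(y)⟩` purely imaginary. The maximum
principle makes the resolvents contractions in the sup norm uniformly in `ξ`, and the implicit Euler
scheme converges for data in the domain of the operator. The compatibility conditions of order one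
say that both the data and their image under `∂_y² - U · ∇_h` vanish at `y = 0`, which puts the data
into the domain of the square of the operator.

Runge approximation (`exists_global_approx`): a solution with zero initial data on a box extends by
zero to `t < 0`. It is mollified in `(t, x')` by a kernel of Gevrey order `3/2` supported in `t ≥
0`. The equation is then read sideways, as `∂_y² v = (∂_t + U · ∇_h) v` with Cauchy data `v = 0`,
`∂_y v = g` at `y = 0`. Each pair of `y`-integrations costs one derivative of `g`, so the terms of
the series in the derivatives of `g` are of size `(j!)^{3/2} / (2j)!` up to geometric factors, and
the series converges for all `y`. As `g` is a convolution over a compact set, it is defined for all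
`(t, x')`, and the sum is a global solution. Uniqueness for the sideways problem identifies it with
the mollified solution on the smaller box. One-sidedness of the kernel keeps the initial data zero.
-/

noncomputable section

namespace ThermalLayer

open Filter Topology MeasureTheory Asymptotics

/-! ### Differentiation within convex sets: partial derivatives, limits, integrals. -/

section Calculus

variable {E F G : Type*} [NormedAddCommGroup E] [NormedSpace ℝ E] [NormedAddCommGroup F]
  [NormedSpace ℝ F] [NormedAddCommGroup G] [NormedSpace ℝ G]

/-- A function on a product of convex sets whose partial derivatives exist, the first one being
continuous, is differentiable within the product. -/
theorem hasFDerivWithinAt_prod_of_partial {s : Set E} {t : Set F} (hs : Convex ℝ s)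
    {f : E × F → G} {f₁ : E × F → E →L[ℝ] G} {f₂ : E × F → F →L[ℝ] G}
    (h₁ : ∀ p ∈ s ×ˢ t, HasFDerivWithinAt (fun x => f (x, p.2)) (f₁ p) s p.1)
    (h₂ : ∀ p ∈ s ×ˢ t, HasFDerivWithinAt (fun y => f (p.1, y)) (f₂ p) t p.2)
    (c₁ : ContinuousOn f₁ (s ×ˢ t)) {p : E × F} (hp : p ∈ s ×ˢ t) :
    HasFDerivWithinAt f ((f₁ p).coprod (f₂ p)) (s ×ˢ t) p := by
  rw [hasFDerivWithinAt_iff_isLittleO, isLittleO_iff]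
  intro ε hε
  have hε2 : 0 < ε / 2 := by positivity
  have hA := (hasFDerivWithinAt_iff_isLittleO.1 (h₂ p hp))
  rw [isLittleO_iff] at hA
  have hA := hA hε2
  have hsnd : Tendsto (fun q : E × F => q.2) (𝓝[s ×ˢ t] p) (𝓝[t] p.2) :=
    tendsto_nhdsWithin_of_tendsto_nhds_of_eventually_within _
      (continuous_snd.continuousAt.tendsto.mono_left nhdsWithin_le_nhds)
      (eventually_nhdsWithin_of_forall fun q hq => hq.2)
  have hA := hsnd.eventually hA
  have hB := Metric.continuousOn_iff.1 c₁ p hp (ε / 2) hε2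
  obtain ⟨δ, hδ, hB⟩ := hB
  have hC : ∀ᶠ q in 𝓝[s ×ˢ t] p, dist q p < δ :=
    mem_nhdsWithin_of_mem_nhds (Metric.ball_mem_nhds p hδ)
  filter_upwards [hA, hC, self_mem_nhdsWithin] with q hq hqδ hqs
  -- The horizontal increment is taken at the height `q.2`, where the mean value inequality on the
  -- segment needs `f₁` to be within `ε / 2` of `f₁ p`. The vertical increment is taken at `p.1`, so
  -- differentiability at `p` alone suffices there.
  have key : ‖(fun x => f (x, q.2)) q.1 - (fun x => f (x, q.2)) p.1 - f₁ p (q.1 - p.1)‖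
      ≤ ε / 2 * ‖q.1 - p.1‖ := by
    have hseg : segment ℝ p.1 q.1 ⊆ s := hs.segment_subset hp.1 hqs.1
    refine Convex.norm_image_sub_le_of_norm_hasFDerivWithin_le' (s := segment ℝ p.1 q.1)
      (f := fun x => f (x, q.2)) (φ := f₁ p) (C := ε / 2) (f' := fun x => f₁ (x, q.2)) ?_ ?_ (convex_segment _ _) (left_mem_segment ℝ _ _)
      (right_mem_segment ℝ _ _)
    · intro x hx
      exact (h₁ (x, q.2) ⟨hseg hx, hqs.2⟩).mono hseg
    · intro x hx
      have : dist (x, q.2) p < δ := by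
        refine lt_of_le_of_lt ?_ hqδ
        rw [Prod.dist_eq, Prod.dist_eq]
        refine max_le_max ?_ le_rfl
        have := segment_subset_closedBall_left p.1 q.1 hx
        rw [Metric.mem_closedBall, dist_comm p.1] at this
        exact this
      have := hB (x, q.2) ⟨hseg hx, hqs.2⟩ this
      rw [dist_eq_norm] at this
      exact this.le
  have e : f q - f p - ((f₁ p).coprod (f₂ p)) (q - p) =
      (f (q.1, q.2) - f (p.1, q.2) - f₁ p (q.1 - p.1)) +
        (f (p.1, q.2) - f (p.1, p.2) - f₂ p (q.2 - p.2)) := by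
    simp only [ContinuousLinearMap.coprod_apply, Prod.fst_sub, Prod.snd_sub, Prod.mk.eta]
    abel
  rw [e]
  have n1 : ‖q.1 - p.1‖ ≤ ‖q - p‖ := norm_fst_le (q - p)
  have n2 : ‖q.2 - p.2‖ ≤ ‖q - p‖ := norm_snd_le (q - p)
  calc _ ≤ _ := norm_add_le _ _
    _ ≤ ε / 2 * ‖q.1 - p.1‖ + ε / 2 * ‖q.2 - p.2‖ := add_le_add key hq
    _ ≤ ε / 2 * ‖q - p‖ + ε / 2 * ‖q - p‖ := by gcongr
    _ = ε * ‖q - p‖ := by ring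

/-- Differentiation of a limit within a convex set, when the derivatives converge uniformly. -/
theorem hasFDerivWithinAt_of_tendstoUniformlyOn {s : Set E} (hs : Convex ℝ s)
    {f : ℕ → E → G} {f' : ℕ → E → E →L[ℝ] G} {g : E → G} {g' : E → E →L[ℝ] G}
    (hf : ∀ m, ∀ x ∈ s, HasFDerivWithinAt (f m) (f' m x) s x)
    (hlim : ∀ x ∈ s, Tendsto (fun m => f m x) atTop (𝓝 (g x)))
    (hunif : TendstoUniformlyOn f' g' atTop s) {x : E} (hx : x ∈ s) :
    HasFDerivWithinAt g (g' x) s x := by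
  rw [hasFDerivWithinAt_iff_isLittleO, isLittleO_iff]
  intro ε hε
  have h4 : 0 < ε / 4 := by positivity
  obtain ⟨m, hm⟩ := eventually_atTop.1 (Metric.tendstoUniformlyOn_iff.1 hunif (ε / 4) h4)
  have hA := hasFDerivWithinAt_iff_isLittleO.1 (hf m x hx)
  rw [isLittleO_iff] at hA
  filter_upwards [hA h4, self_mem_nhdsWithin] with y hy hys
  -- This bound is uniform in `k`, so it survives the limit `k → ∞` with `m` fixed; only the single
  -- function `f m` is then expanded at `x`.
  have hk : ∀ k, m ≤ k → ‖(f k y - f m y) - (f k x - f m x)‖ ≤ (ε / 4 + ε / 4) * ‖y - x‖ := by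
    intro k hk
    refine Convex.norm_image_sub_le_of_norm_hasFDerivWithin_le (s := s)
      (f := fun z => f k z - f m z) (f' := fun z => f' k z - f' m z)
      (fun z hz => (hf k z hz).sub (hf m z hz)) ?_ hs hx hys
    intro z hz
    have e1 := hm k hk z hz
    have e2 := hm m le_rfl z hz
    rw [← dist_eq_norm]
    calc dist (f' k z) (f' m z) ≤ dist (f' k z) (g' z) + dist (g' z) (f' m z) :=
          dist_triangle _ _ _
      _ ≤ ε / 4 + ε / 4 := by rw [dist_comm (f' k z)]; linarith
  have hlim' : ‖(g y - f m y) - (g x - f m x)‖ ≤ (ε / 4 + ε / 4) * ‖y - x‖ := by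
    have : Tendsto (fun k => ‖(f k y - f m y) - (f k x - f m x)‖) atTop
        (𝓝 ‖(g y - f m y) - (g x - f m x)‖) :=
      (((hlim y hys).sub_const _).sub ((hlim x hx).sub_const _)).norm
    exact le_of_tendsto this (eventually_atTop.2 ⟨m, hk⟩)
  have h5 : ‖(f' m x - g' x) (y - x)‖ ≤ ε / 4 * ‖y - x‖ := by
    refine (ContinuousLinearMap.le_opNorm _ _).trans ?_
    gcongr
    rw [← dist_eq_norm, dist_comm]
    exact (hm m le_rfl x hx).le
  have e : g y - g x - g' x (y - x) = (f m y - f m x - f' m x (y - x)) +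
      ((g y - f m y) - (g x - f m x)) + (f' m x - g' x) (y - x) := by
    rw [sub_apply]; abel
  rw [e]
  calc _ ≤ _ := norm_add₃_le
    _ ≤ ε / 4 * ‖y - x‖ + (ε / 4 + ε / 4) * ‖y - x‖ + ε / 4 * ‖y - x‖ := by gcongr
    _ = ε * ‖y - x‖ := by ring

/-- Differentiation under the integral sign within a convex set. -/
theorem hasFDerivWithinAt_integral_of_dominated [CompleteSpace G] {α : Type*} [MeasurableSpace α] {μ : Measure α}
    {s : Set E} (hs : Convex ℝ s) {f : E → α → G} {f' : E → α → E →L[ℝ] G} {bound : α → ℝ}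
    {x₀ : E} (hx₀ : x₀ ∈ s) (hmeas : ∀ x ∈ s, AEStronglyMeasurable (f x) μ)
    (hint : Integrable (f x₀) μ) (hmeas' : AEStronglyMeasurable (f' x₀) μ)
    (hbound : ∀ᵐ a ∂μ, ∀ x ∈ s, ‖f' x a‖ ≤ bound a) (hbi : Integrable bound μ)
    (hderiv : ∀ᵐ a ∂μ, ∀ x ∈ s, HasFDerivWithinAt (fun x => f x a) (f' x a) s x) :
    HasFDerivWithinAt (fun x => ∫ a, f x a ∂μ) (∫ a, f' x₀ a ∂μ) s x₀ := by
  have hint' : Integrable (f' x₀) μ := hbi.mono' hmeas' (hbound.mono fun a ha => ha x₀ hx₀)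
  have hlip : ∀ᵐ a ∂μ, ∀ x ∈ s, ‖f x a - f x₀ a‖ ≤ bound a * ‖x - x₀‖ := by
    filter_upwards [hbound, hderiv] with a ha hd x hx
    exact Convex.norm_image_sub_le_of_norm_hasFDerivWithin_le (f := fun x => f x a)
      hd (fun z hz => ha z hz) hs hx₀ hx
  have hintx : ∀ x ∈ s, Integrable (f x) μ := by
    intro x hx
    have : Integrable (fun a => f x a - f x₀ a) μ :=
      (hbi.mul_const ‖x - x₀‖).mono' ((hmeas x hx).sub hint.1) (hlip.mono fun a ha => ha x hx)
    exact (this.add hint).congr (ae_of_all _ fun a => by simp)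
  rw [hasFDerivWithinAt_iff_tendsto]
  -- Dominated convergence for the normalized remainders. The mean value inequality on the convex
  -- set bounds them by `2 * bound`.
  have key : Tendsto (fun x => ∫ a, ‖x - x₀‖⁻¹ • (f x a - f x₀ a - f' x₀ a (x - x₀)) ∂μ)
      (𝓝[s] x₀) (𝓝 (∫ _, (0 : G) ∂μ)) := by
    refine tendsto_integral_filter_of_dominated_convergence (fun a => 2 * bound a) ?_ ?_
      (hbi.const_mul 2) ?_
    · filter_upwards [self_mem_nhdsWithin] with x hx
      exact (((hmeas x hx).sub hint.1).sub (hmeas'.apply_continuousLinearMap _)).const_smul _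
    · filter_upwards [self_mem_nhdsWithin] with x hx
      filter_upwards [hlip, hbound] with a ha hb
      rw [norm_smul, norm_inv, norm_norm]
      rcases eq_or_ne x x₀ with rfl | hne
      · simpa using (norm_nonneg _).trans (hb x hx)
      have hpos : 0 < ‖x - x₀‖ := norm_pos_iff.2 (sub_ne_zero.2 hne)
      rw [inv_mul_le_iff₀ hpos]
      calc _ ≤ ‖f x a - f x₀ a‖ + ‖f' x₀ a (x - x₀)‖ := norm_sub_le _ _
        _ ≤ bound a * ‖x - x₀‖ + bound a * ‖x - x₀‖ := by
          refine add_le_add (ha x hx) ((ContinuousLinearMap.le_opNorm _ _).trans ?_)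
          gcongr
          exact hb x₀ hx₀
        _ = _ := by ring
    · filter_upwards [hderiv] with a ha
      have := hasFDerivWithinAt_iff_tendsto.1 (ha x₀ hx₀)
      rw [tendsto_zero_iff_norm_tendsto_zero]
      refine this.congr fun x => ?_
      rw [norm_smul, norm_inv, norm_norm]
  rw [integral_zero] at key
  have key := key.norm
  rw [norm_zero] at key
  refine key.congr' ?_
  filter_upwards [self_mem_nhdsWithin] with x hx
  rw [integral_smul, norm_smul, norm_inv, norm_norm, integral_sub
      (show Integrable (fun a => f x a - f x₀ a) μ from (hintx x hx).sub hint)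
    (hint'.apply_continuousLinearMap _), integral_sub (hintx x hx) hint,
    ContinuousLinearMap.integral_apply hint']

theorem hasDerivWithinAt_integral_of_dominated [CompleteSpace G] {α : Type*} [MeasurableSpace α]
    {μ : Measure α} {s : Set ℝ} (hs : Convex ℝ s) {f f' : ℝ → α → G} {bound : α → ℝ}
    {x₀ : ℝ} (hx₀ : x₀ ∈ s) (hmeas : ∀ x ∈ s, AEStronglyMeasurable (f x) μ)
    (hint : Integrable (f x₀) μ) (hmeas' : AEStronglyMeasurable (f' x₀) μ)
    (hbound : ∀ᵐ a ∂μ, ∀ x ∈ s, ‖f' x a‖ ≤ bound a) (hbi : Integrable bound μ)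
    (hderiv : ∀ᵐ a ∂μ, ∀ x ∈ s, HasDerivWithinAt (fun x => f x a) (f' x a) s x) :
    HasDerivWithinAt (fun x => ∫ a, f x a ∂μ) (∫ a, f' x₀ a ∂μ) s x₀ := by
  have hi' : Integrable (f' x₀) μ := hbi.mono' hmeas' (hbound.mono fun a ha => ha x₀ hx₀)
  have := hasFDerivWithinAt_integral_of_dominated (μ := μ) (f := f)
    (f' := fun x a => ContinuousLinearMap.toSpanSingleton ℝ (f' x a)) hs hx₀ hmeas hint
    ((ContinuousLinearMap.toSpanSingletonCLE (𝕜 := ℝ) (E := G)).continuous.comp_aestronglyMeasurable hmeas')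
    (hbound.mono fun a ha x hx => by
      simpa using ha x hx) hbi
    (hderiv.mono fun a ha x hx => (ha x hx).hasFDerivWithinAt)
  have h2 := this.hasDerivWithinAt
  rw [ContinuousLinearMap.integral_apply] at h2
  · simpa using h2
  · exact (ContinuousLinearMap.toSpanSingletonCLE (𝕜 := ℝ) (E := G)).toContinuousLinearMap.integrable_comp hi'

end Calculus
end ThermalLayer
end

noncomputable section

namespace ThermalLayer

open Filter Topology MeasureTheory Asymptotics

/-! ### Solutions on boxes, recorded together with their derivatives. -/

section Jets

variable {n : ℕ}

/-- Values `(f, ∂_t f, ∇_h f, ∂_y f, ∂_y² f)`. -/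
abbrev JetVal (n : ℕ) : Type := ℝ × ℝ × (Tan n →L[ℝ] ℝ) × ℝ × ℝ

/-- The part of size `R` of the space-time domain. -/
def box (n : ℕ) (R : ℝ) : Set (ℝ × Tan n × ℝ) := Ico 0 R ×ˢ Metric.ball 0 R ×ˢ Ico 0 R

/-- The components of `J` are a function on the box of size `R` and its continuous derivatives. -/
structure IsJet (R : ℝ) (J : ℝ × Tan n × ℝ → JetVal n) : Prop where
  cont : ContinuousOn J (box n R)
  deriv_t : ∀ p ∈ box n R,
    HasDerivWithinAt (fun t => (J (t, p.2)).1) (J p).2.1 (Ico 0 R) p.1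
  deriv_x : ∀ p ∈ box n R,
    HasFDerivAt (fun x => (J (p.1, x, p.2.2)).1) (J p).2.2.1 p.2.1
  deriv_y : ∀ p ∈ box n R,
    HasDerivWithinAt (fun y => (J (p.1, p.2.1, y)).1) (J p).2.2.2.1 (Ico 0 R) p.2.2
  deriv_yy : ∀ p ∈ box n R,
    HasDerivWithinAt (fun y => (J (p.1, p.2.1, y)).2.2.2.1) (J p).2.2.2.2 (Ico 0 R) p.2.2

/-- The jet `J` solves the temperature equation, with zero boundary values, on the box. -/
structure IsJetSol (U : ℝ → Tan n) (R : ℝ) (J : ℝ × Tan n × ℝ → JetVal n) : Prop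
    extends IsJet R J where
  equation : ∀ p ∈ box n R, (J p).2.1 + (J p).2.2.1 (U p.2.2) = (J p).2.2.2.2
  boundary : ∀ p ∈ box n R, p.2.2 = 0 → (J p).1 = 0

theorem box_mono {r R : ℝ} (h : r ≤ R) : box n r ⊆ box n R :=
  prod_mono (Ico_subset_Ico_right h) (prod_mono (Metric.ball_subset_ball h)
    (Ico_subset_Ico_right h))

/-- The half-open boxes are relatively open in the closed domain, so continuity and one-sided
derivatives on a box are the same as on the domain. -/
theorem box_mem_nhdsWithin {R : ℝ} {p : ℝ × Tan n × ℝ} (hp : p ∈ box n R) :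
    box n R ∈ 𝓝[domain n] p := by
  have : box n R = (Iio R ×ˢ Metric.ball 0 R ×ˢ Iio R) ∩ domain n := by
    ext q
    simp only [box, domain, mem_prod, mem_Ico, mem_inter_iff, mem_Iio, mem_Ici, mem_univ]
    tauto
  rw [this]
  refine inter_mem ?_ self_mem_nhdsWithin
  refine mem_nhdsWithin_of_mem_nhds (IsOpen.mem_nhds ?_ ?_)
  · exact isOpen_Iio.prod (Metric.isOpen_ball.prod isOpen_Iio)
  · exact ⟨hp.1.2, hp.2.1, hp.2.2.2⟩

theorem Ico_mem_nhdsWithin_Ici' {R t : ℝ} (ht : t ∈ Ico 0 R) : Ico 0 R ∈ 𝓝[Ici 0] t := by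
  rw [← Ici_inter_Iio]
  exact inter_mem self_mem_nhdsWithin (mem_nhdsWithin_of_mem_nhds (Iio_mem_nhds ht.2))

theorem exists_mem_box {p : ℝ × Tan n × ℝ} (hp : p ∈ domain n) : ∃ R : ℝ, p ∈ box n R := by
  refine ⟨max p.1 (max ‖p.2.1‖ p.2.2) + 1, ⟨hp.1, ?_⟩, ?_, hp.2.2, ?_⟩
  · exact lt_of_le_of_lt (le_max_left _ _) (lt_add_one _)
  · rw [mem_ball_zero_iff]
    exact lt_of_le_of_lt ((le_max_left _ _).trans (le_max_right _ _)) (lt_add_one _)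
  · exact lt_of_le_of_lt ((le_max_right _ _).trans (le_max_right _ _)) (lt_add_one _)

theorem IsJet.mono {r R : ℝ} (h : r ≤ R) {J : ℝ × Tan n × ℝ → JetVal n} (hJ : IsJet R J) :
    IsJet r J where
  cont := hJ.cont.mono (box_mono h)
  deriv_t p hp := (hJ.deriv_t p (box_mono h hp)).mono (Ico_subset_Ico_right h)
  deriv_x p hp := hJ.deriv_x p (box_mono h hp)
  deriv_y p hp := (hJ.deriv_y p (box_mono h hp)).mono (Ico_subset_Ico_right h)
  deriv_yy p hp := (hJ.deriv_yy p (box_mono h hp)).mono (Ico_subset_Ico_right h)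

theorem IsJetSol.mono {U : ℝ → Tan n} {r R : ℝ} (h : r ≤ R) {J : ℝ × Tan n × ℝ → JetVal n}
    (hJ : IsJetSol U R J) : IsJetSol U r J where
  toIsJet := hJ.toIsJet.mono h
  equation p hp := hJ.equation p (box_mono h hp)
  boundary p hp := hJ.boundary p (box_mono h hp)

theorem IsJet.sub {R : ℝ} {J K : ℝ × Tan n × ℝ → JetVal n} (hJ : IsJet R J) (hK : IsJet R K) :
    IsJet R (J - K) where
  cont := hJ.cont.sub hK.cont
  deriv_t p hp := (hJ.deriv_t p hp).sub (hK.deriv_t p hp)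
  deriv_x p hp := (hJ.deriv_x p hp).sub (hK.deriv_x p hp)
  deriv_y p hp := (hJ.deriv_y p hp).sub (hK.deriv_y p hp)
  deriv_yy p hp := (hJ.deriv_yy p hp).sub (hK.deriv_yy p hp)

theorem IsJetSol.sub {U : ℝ → Tan n} {R : ℝ} {J K : ℝ × Tan n × ℝ → JetVal n}
    (hJ : IsJetSol U R J) (hK : IsJetSol U R K) : IsJetSol U R (J - K) where
  toIsJet := hJ.toIsJet.sub hK.toIsJet
  equation p hp := by
    have h1 := hJ.equation p hp
    have h2 := hK.equation p hp
    simp only [Pi.sub_apply, Prod.snd_sub, Prod.fst_sub, sub_apply]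
    linarith
  boundary p hp h := by
    simp [hJ.boundary p hp h, hK.boundary p hp h]

/-- Continuous partial derivatives on the closed domain give continuous differentiability. -/
theorem contDiffOn_domain_of_partial {F : Type*} [NormedAddCommGroup F] [NormedSpace ℝ F]
    {f : ℝ × Tan n × ℝ → F} {ft fy : ℝ × Tan n × ℝ → F} {fx : ℝ × Tan n × ℝ → Tan n →L[ℝ] F}
    (ct : ContinuousOn ft (domain n)) (cx : ContinuousOn fx (domain n))
    (cy : ContinuousOn fy (domain n))
    (ht : ∀ p ∈ domain n, HasDerivWithinAt (fun t => f (t, p.2)) (ft p) (Ici 0) p.1)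
    (hx : ∀ p ∈ domain n, HasFDerivAt (fun x => f (p.1, x, p.2.2)) (fx p) p.2.1)
    (hy : ∀ p ∈ domain n, HasDerivWithinAt (fun y => f (p.1, p.2.1, y)) (fy p) (Ici 0) p.2.2) :
    ContDiffOn ℝ 1 f (domain n) := by
  set A : ℝ × Tan n × ℝ → ℝ × Tan n × ℝ →L[ℝ] F := fun p =>
    (ContinuousLinearMap.toSpanSingleton ℝ (ft p)).coprod
      ((fx p).coprod (ContinuousLinearMap.toSpanSingleton ℝ (fy p))) with hA
  have span : ∀ g : ℝ × Tan n × ℝ → F, ContinuousOn g (domain n) →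
      ContinuousOn (fun p => ContinuousLinearMap.toSpanSingleton ℝ (g p)) (domain n) :=
    fun g hg => (ContinuousLinearMap.toSpanSingletonCLE (𝕜 := ℝ) (E := F)).continuous.comp_continuousOn hg
  have cA : ContinuousOn A (domain n) := by
    have : A = fun p => (ContinuousLinearMap.toSpanSingleton ℝ (ft p)).comp
          (ContinuousLinearMap.fst ℝ ℝ (Tan n × ℝ)) +
        ((fx p).comp ((ContinuousLinearMap.fst ℝ (Tan n) ℝ).comp
            (ContinuousLinearMap.snd ℝ ℝ (Tan n × ℝ))) +
          (ContinuousLinearMap.toSpanSingleton ℝ (fy p)).comp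
            ((ContinuousLinearMap.snd ℝ (Tan n) ℝ).comp
            (ContinuousLinearMap.snd ℝ ℝ (Tan n × ℝ)))) := by
      ext p q <;> simp [hA]
    rw [this]
    exact ((span _ ct).clm_comp continuousOn_const).add
      ((cx.clm_comp continuousOn_const).add ((span _ cy).clm_comp continuousOn_const))
  have hder : ∀ p ∈ domain n, HasFDerivWithinAt f (A p) (domain n) p := by
    -- The two-factor criterion is used twice: `t` is split from `(x', y)`, then `x'` from `y`. It
    -- asks for continuity of the first partial derivative only.
    intro p hp
    refine hasFDerivWithinAt_prod_of_partial (convex_Ici (0 : ℝ)) (t := univ ×ˢ Ici (0 : ℝ))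
      (f₁ := fun p => ContinuousLinearMap.toSpanSingleton ℝ (ft p))
      (f₂ := fun p => (fx p).coprod (ContinuousLinearMap.toSpanSingleton ℝ (fy p)))
      (fun p hp => (ht p hp).hasFDerivWithinAt) ?_ (span _ ct) hp
    intro q hq
    refine hasFDerivWithinAt_prod_of_partial (convex_univ) (t := Ici (0 : ℝ))
      (f := fun r => f (q.1, r))
      (f₁ := fun r => fx (q.1, r))
      (f₂ := fun r => ContinuousLinearMap.toSpanSingleton ℝ (fy (q.1, r)))
      (fun r hr => (hx (q.1, r) ⟨hq.1, hr⟩).hasFDerivWithinAt)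
      (fun r hr => (hy (q.1, r) ⟨hq.1, hr⟩).hasFDerivWithinAt) ?_ hq.2
    exact cx.comp (by fun_prop) (fun r hr => ⟨hq.1, hr⟩)
  have hconv : UniqueDiffOn ℝ (domain n) :=
    (uniqueDiffOn_Ici 0).prod (uniqueDiffOn_univ.prod (uniqueDiffOn_Ici 0))
  rw [show (1 : WithTop ℕ∞) = 0 + 1 from (zero_add 1).symm,
    contDiffOn_succ_iff_fderivWithin hconv]
  refine ⟨fun p hp => (hder p hp).differentiableWithinAt, by simp, contDiffOn_zero.2 ?_⟩
  exact cA.congr fun p hp => (hder p hp).fderivWithin (hconv p hp)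

/-- A jet which solves the problem on every box is a classical solution. -/
theorem isTemperatureSolution_of_isJetSol {U : ℝ → Tan n} {θ₀ : Tan n → ℝ → ℝ}
    {J : ℝ × Tan n × ℝ → JetVal n} (hJ : ∀ R, IsJetSol U R J)
    (h₀ : ∀ x y, 0 ≤ y → (J (0, x, y)).1 = θ₀ x y) :
    IsTemperatureSolution U θ₀ (fun t x y => (J (t, x, y)).1) := by
  have cont : ContinuousOn J (domain n) := by
    intro p hp
    obtain ⟨R, hR⟩ := exists_mem_box hp
    exact ((hJ R).cont p hR).mono_of_mem_nhdsWithin (box_mem_nhdsWithin hR)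
  have ht : ∀ p ∈ domain n,
      HasDerivWithinAt (fun t => (J (t, p.2)).1) (J p).2.1 (Ici 0) p.1 := by
    intro p hp
    obtain ⟨R, hR⟩ := exists_mem_box hp
    exact ((hJ R).deriv_t p hR).mono_of_mem_nhdsWithin (Ico_mem_nhdsWithin_Ici' hR.1)
  have hx : ∀ p ∈ domain n,
      HasFDerivAt (fun x => (J (p.1, x, p.2.2)).1) (J p).2.2.1 p.2.1 := by
    intro p hp
    obtain ⟨R, hR⟩ := exists_mem_box hp
    exact (hJ R).deriv_x p hR
  have hy : ∀ p ∈ domain n,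
      HasDerivWithinAt (fun y => (J (p.1, p.2.1, y)).1) (J p).2.2.2.1 (Ici 0) p.2.2 := by
    intro p hp
    obtain ⟨R, hR⟩ := exists_mem_box hp
    exact ((hJ R).deriv_y p hR).mono_of_mem_nhdsWithin (Ico_mem_nhdsWithin_Ici' hR.2.2)
  have hyy : ∀ p ∈ domain n,
      HasDerivWithinAt (fun y => (J (p.1, p.2.1, y)).2.2.2.1) (J p).2.2.2.2 (Ici 0) p.2.2 := by
    intro p hp
    obtain ⟨R, hR⟩ := exists_mem_box hp
    exact ((hJ R).deriv_yy p hR).mono_of_mem_nhdsWithin (Ico_mem_nhdsWithin_Ici' hR.2.2)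
  have edy : ∀ t x y, 0 ≤ t → 0 ≤ y →
      dy (fun t x y => (J (t, x, y)).1) t x y = (J (t, x, y)).2.2.2.1 := fun t x y ht hy' =>
    (hy (t, x, y) ⟨ht, trivial, hy'⟩).derivWithin (uniqueDiffOn_Ici 0 y hy')
  have hdyy : ∀ t x y, 0 ≤ t → 0 ≤ y → HasDerivWithinAt
      (fun z => dy (fun t x y => (J (t, x, y)).1) t x z) (J (t, x, y)).2.2.2.2 (Ici 0) y := by
    intro t x y ht hy'
    exact (hyy (t, x, y) ⟨ht, trivial, hy'⟩).congr (fun z hz => edy t x z ht hz) (edy t x y ht hy')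
  have edyy : ∀ t x y, 0 ≤ t → 0 ≤ y →
      dy (dy (fun t x y => (J (t, x, y)).1)) t x y = (J (t, x, y)).2.2.2.2 := fun t x y ht hy' =>
    (hdyy t x y ht hy').derivWithin (uniqueDiffOn_Ici 0 y hy')
  refine ⟨?_, ?_, ?_, ?_, ?_, ?_⟩
  · exact contDiffOn_domain_of_partial (f := fun p => (J p).1) cont.snd.fst cont.snd.snd.fst
      cont.snd.snd.snd.fst ht hx hy
  · exact fun t x ht y hy' => (hdyy t x y ht hy').differentiableWithinAt
  · exact cont.snd.snd.snd.snd.congr fun p hp => edyy _ _ _ hp.1 hp.2.2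
  · intro t x y ht' hy'
    have hmem : (t, x, y) ∈ domain n := ⟨ht', trivial, hy'⟩
    obtain ⟨R, hR⟩ := exists_mem_box hmem
    rw [edyy t x y ht' hy', ← (hJ R).equation _ hR]
    congr 1
    · exact (ht (t, x, y) hmem).derivWithin (uniqueDiffOn_Ici 0 t ht')
    · rw [dirDeriv, (hx (t, x, y) hmem).fderiv]
  · intro t x ht'
    obtain ⟨R, hR⟩ := exists_mem_box (n := n) (p := (t, x, 0)) ⟨ht', trivial, self_mem_Ici⟩
    exact (hJ R).boundary _ hR rfl
  · exact h₀

/-- Uniform limits of jets are jets. -/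
theorem IsJet.of_tendstoUniformlyOn {R : ℝ} {J : ℕ → ℝ × Tan n × ℝ → JetVal n}
    {K : ℝ × Tan n × ℝ → JetVal n} (hJ : ∀ m, IsJet R (J m))
    (h : TendstoUniformlyOn J K atTop (box n R)) : IsJet R K := by
  have hlim : ∀ p ∈ box n R, Tendsto (fun m => J m p) atTop (𝓝 (K p)) :=
    fun p hp => h.tendsto_at hp
  have hcomp : ∀ {V : Type} [NormedAddCommGroup V] [NormedSpace ℝ V] (π : JetVal n →L[ℝ] V),
      TendstoUniformlyOn (fun m p => π (J m p)) (fun p => π (K p)) atTop (box n R) := by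
    intro V _ _ π
    exact π.uniformContinuous.comp_tendstoUniformlyOn h
  -- One argument serves the clauses in `t`, `y` and `yy`: `γ` is a coordinate line, `π` the
  -- component being differentiated and `π'` the component claimed to be its derivative.
  have real : ∀ (s : Set ℝ) (hs : Convex ℝ s) (γ : ℝ → ℝ × Tan n × ℝ) (π π' : JetVal n →L[ℝ] ℝ),
      (∀ z ∈ s, γ z ∈ box n R) →
      (∀ m, ∀ z ∈ s, HasDerivWithinAt (fun z => π (J m (γ z))) (π' (J m (γ z))) s z) →
      ∀ z ∈ s, HasDerivWithinAt (fun z => π (K (γ z))) (π' (K (γ z))) s z := by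
    intro s hs γ π π' hγ hd z hz
    have := hasFDerivWithinAt_of_tendstoUniformlyOn hs (f := fun m z => π (J m (γ z)))
      (g := fun z => π (K (γ z)))
      (f' := fun m z => ContinuousLinearMap.toSpanSingleton ℝ (π' (J m (γ z))))
      (g' := fun z => ContinuousLinearMap.toSpanSingleton ℝ (π' (K (γ z))))
      (fun m z hz => (hd m z hz).hasFDerivWithinAt)
      (fun z hz => (hcomp π).tendsto_at (hγ z hz)) ?_ hz
    · exact this.hasDerivWithinAt.congr_deriv (by simp)
    · have h1 := ((hcomp π').comp γ).mono (s' := s) (fun z hz => hγ z hz)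
      exact (ContinuousLinearMap.toSpanSingletonCLE (𝕜 := ℝ) (E := ℝ)).toContinuousLinearMap.uniformContinuous.comp_tendstoUniformlyOn h1
  let π₀ : JetVal n →L[ℝ] ℝ := ContinuousLinearMap.fst ℝ _ _
  let πt : JetVal n →L[ℝ] ℝ := (ContinuousLinearMap.fst ℝ _ _).comp (ContinuousLinearMap.snd ℝ _ _)
  let πx : JetVal n →L[ℝ] (Tan n →L[ℝ] ℝ) := (ContinuousLinearMap.fst ℝ _ _).comp
    ((ContinuousLinearMap.snd ℝ _ _).comp (ContinuousLinearMap.snd ℝ _ _))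
  let πr : JetVal n →L[ℝ] ℝ × ℝ := (ContinuousLinearMap.snd ℝ _ _).comp
    ((ContinuousLinearMap.snd ℝ _ _).comp (ContinuousLinearMap.snd ℝ _ _))
  let πy : JetVal n →L[ℝ] ℝ := (ContinuousLinearMap.fst ℝ _ _).comp πr
  let πyy : JetVal n →L[ℝ] ℝ := (ContinuousLinearMap.snd ℝ _ _).comp πr
  refine ⟨h.continuousOn (Eventually.frequently (Eventually.of_forall fun m => (hJ m).cont)),
    ?_, ?_, ?_, ?_⟩
  · intro p hp
    exact real (Ico 0 R) (convex_Ico _ _) (fun t => (t, p.2)) π₀ πt (fun t ht => ⟨ht, hp.2⟩)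
      (fun m z hz => (hJ m).deriv_t (z, p.2) ⟨hz, hp.2⟩) p.1 hp.1
  · intro p hp
    have := hasFDerivWithinAt_of_tendstoUniformlyOn (convex_ball (0 : Tan n) R)
      (f := fun m x => π₀ (J m (p.1, x, p.2.2))) (g := fun x => π₀ (K (p.1, x, p.2.2)))
      (f' := fun m x => πx (J m (p.1, x, p.2.2))) (g' := fun x => πx (K (p.1, x, p.2.2)))
      (fun m x hx => ((hJ m).deriv_x (p.1, x, p.2.2) ⟨hp.1, hx, hp.2.2⟩).hasFDerivWithinAt)
      (fun x hx => (hcomp π₀).tendsto_at (show (p.1, x, p.2.2) ∈ box n R from ⟨hp.1, hx, hp.2.2⟩))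
      (((hcomp πx).comp (fun x => (p.1, x, p.2.2))).mono (s' := Metric.ball (0 : Tan n) R)
        (fun x hx => ⟨hp.1, hx, hp.2.2⟩)) hp.2.1
    exact this.hasFDerivAt (Metric.isOpen_ball.mem_nhds hp.2.1)
  · intro p hp
    exact real (Ico 0 R) (convex_Ico _ _) (fun y => (p.1, p.2.1, y)) π₀ πy
      (fun t ht => ⟨hp.1, hp.2.1, ht⟩)
      (fun m z hz => (hJ m).deriv_y (p.1, p.2.1, z) ⟨hp.1, hp.2.1, hz⟩) p.2.2 hp.2.2
  · intro p hp
    exact real (Ico 0 R) (convex_Ico _ _) (fun y => (p.1, p.2.1, y)) πy πyy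
      (fun t ht => ⟨hp.1, hp.2.1, ht⟩)
      (fun m z hz => (hJ m).deriv_yy (p.1, p.2.1, z) ⟨hp.1, hp.2.1, hz⟩) p.2.2 hp.2.2

theorem IsJetSol.of_tendstoUniformlyOn {U : ℝ → Tan n} {R : ℝ}
    {J : ℕ → ℝ × Tan n × ℝ → JetVal n} {K : ℝ × Tan n × ℝ → JetVal n}
    (hJ : ∀ m, IsJetSol U R (J m)) (h : TendstoUniformlyOn J K atTop (box n R)) :
    IsJetSol U R K where
  toIsJet := IsJet.of_tendstoUniformlyOn (fun m => (hJ m).toIsJet) h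
  equation p hp := by
    have hl := h.tendsto_at hp
    have h1 : Tendsto (fun m => (J m p).2.1 + (J m p).2.2.1 (U p.2.2)) atTop
        (𝓝 ((K p).2.1 + (K p).2.2.1 (U p.2.2))) :=
      hl.snd_nhds.fst_nhds.add ((ContinuousLinearMap.apply ℝ ℝ (U p.2.2)).continuous.tendsto _ |>.comp
        hl.snd_nhds.snd_nhds.fst_nhds)
    have h2 : Tendsto (fun m => (J m p).2.2.2.2) atTop (𝓝 (K p).2.2.2.2) :=
      hl.snd_nhds.snd_nhds.snd_nhds.snd_nhds
    exact tendsto_nhds_unique h1 (h2.congr fun m => ((hJ m).equation p hp).symm)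
  boundary p hp hy := by
    have hl := (h.tendsto_at hp).fst_nhds
    exact tendsto_nhds_unique hl (tendsto_const_nhds.congr fun m => ((hJ m).boundary p hp hy).symm)

end Jets
end ThermalLayer
end

noncomputable section

namespace ThermalLayer

open Filter Topology MeasureTheory Asymptotics

/-! ### From solutions on boxes to a global solution. -/

section MittagLeffler

variable {n : ℕ}

/-- The jet takes the initial values `θ₀` on the box of size `R`. -/
def HasInitial (R : ℝ) (J : ℝ × Tan n × ℝ → JetVal n) (θ₀ : Tan n → ℝ → ℝ) : Prop :=
  ∀ x y, (0, x, y) ∈ box n R → (J (0, x, y)).1 = θ₀ x y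

/-- Local solvability on boxes, together with approximation of solutions with zero data by global
ones, gives global solvability. -/
theorem exists_global_jetSol {U : ℝ → Tan n} {θ₀ : Tan n → ℝ → ℝ}
    (hloc : ∀ R, 0 < R → ∃ J, IsJetSol U R J ∧ HasInitial R J θ₀)
    (happrox : ∀ r R ε, 0 < r → r < R → 0 < ε → ∀ D, IsJetSol U R D → HasInitial R D 0 →
      ∃ v, (∀ R', IsJetSol U R' v) ∧ (∀ R', HasInitial R' v 0) ∧
        ∀ p ∈ box n r, ‖D p - v p‖ ≤ ε) :
    ∃ J, (∀ R, IsJetSol U R J) ∧ ∀ R, HasInitial R J θ₀ := by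
  -- A fresh solution on the box of size `m + 3` differs from `J` by a solution with zero data.
  -- Subtracting a global approximation `v` of this difference restores closeness on the box of size
  -- `m + 1` without changing the initial values. The gap between `m + 1` and `m + 2` is the room
  -- that the approximation needs.
  have step : ∀ (m : ℕ) (J : ℝ × Tan n × ℝ → JetVal n),
      IsJetSol U (m + 2) J ∧ HasInitial (m + 2) J θ₀ →
      ∃ K, (IsJetSol U ((m + 1 : ℕ) + 2) K ∧ HasInitial ((m + 1 : ℕ) + 2) K θ₀) ∧
        ∀ p ∈ box n (m + 1), ‖K p - J p‖ ≤ (1 / 2) ^ m := by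
    rintro m J ⟨hJ, hJ0⟩
    obtain ⟨K, hK, hK0⟩ := hloc ((m + 1 : ℕ) + 2) (by positivity)
    have hle : (m : ℝ) + 2 ≤ (m + 1 : ℕ) + 2 := by push_cast; linarith
    obtain ⟨v, hv, hv0, hvD⟩ := happrox (m + 1) (m + 2) ((1 / 2) ^ m) (by positivity)
      (by linarith) (by positivity) (K - J) ((hK.mono hle).sub hJ) (by
        intro x y hp
        have h1 := hK0 x y (box_mono hle hp)
        have h2 := hJ0 x y hp
        simp [h1, h2])
    refine ⟨K - v, ⟨hK.sub (hv _), ?_⟩, ?_⟩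
    · intro x y hp
      have h1 := hK0 x y hp
      have h2 := hv0 _ x y hp
      simp [h1, h2]
    · intro p hp
      have := hvD p hp
      rwa [Pi.sub_apply, sub_right_comm] at this
  choose! next hnext hclose using step
  obtain ⟨J₀, hJ₀⟩ := hloc 2 (by norm_num)
  let Θ : ℕ → ℝ × Tan n × ℝ → JetVal n := fun m => Nat.rec J₀ (fun m J => next m J) m
  have hΘ : ∀ m : ℕ, IsJetSol U (m + 2) (Θ m) ∧ HasInitial (m + 2) (Θ m) θ₀ := by
    intro m
    induction m with
    | zero => simpa using (show IsJetSol U 2 (Θ 0) ∧ HasInitial 2 (Θ 0) θ₀ from hJ₀)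
    | succ m ih => exact hnext m (Θ m) ih
  have hd : ∀ m : ℕ, ∀ p ∈ box n (m + 1), ‖Θ (m + 1) p - Θ m p‖ ≤ (1 / 2) ^ m :=
    fun m => hclose m (Θ m) (hΘ m)
  let K : ℝ × Tan n × ℝ → JetVal n := fun p => limUnder atTop (fun m => Θ m p)
  have hbd : ∀ N : ℕ, ∀ p ∈ box n N, ∀ k, dist (Θ (N + k) p) (Θ (N + (k + 1)) p)
      ≤ ((1 / 2) ^ N * 2) / 2 / 2 ^ k := by
    intro N p hp k
    rw [dist_comm, dist_eq_norm]
    refine (hd (N + k) p (box_mono (by push_cast; linarith) hp)).trans (le_of_eq ?_)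
    rw [pow_add]; field_simp; rw [← mul_pow]; norm_num
  have hK : ∀ N : ℕ, ∀ p ∈ box n N, Tendsto (fun m => Θ m p) atTop (𝓝 (K p)) := by
    intro N p hp
    have hc : CauchySeq (fun k => Θ (N + k) p) := cauchySeq_of_le_geometric_two (hbd N p hp)
    obtain ⟨a, ha⟩ := cauchySeq_tendsto_of_complete hc
    have ha' : Tendsto (fun m => Θ m p) atTop (𝓝 a) := by
      refine (tendsto_add_atTop_iff_nat N).1 ?_
      simpa only [add_comm] using ha
    exact tendsto_nhds_limUnder ⟨a, ha'⟩
  have hunif : ∀ N : ℕ, TendstoUniformlyOn (fun k => Θ (N + k)) K atTop (box n N) := by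
    intro N
    rw [Metric.tendstoUniformlyOn_iff]
    intro ε hε
    have hlim : Tendsto (fun k : ℕ => ((1 / 2 : ℝ) ^ N * 2) / 2 ^ k) atTop (𝓝 0) := by
      have := (tendsto_pow_atTop_nhds_zero_of_lt_one (r := (1 / 2 : ℝ)) (by norm_num)
        (by norm_num)).const_mul ((1 / 2 : ℝ) ^ N * 2)
      simpa [div_eq_mul_inv] using this
    filter_upwards [hlim.eventually (gt_mem_nhds hε)] with k hk p hp
    have := dist_le_of_le_geometric_two_of_tendsto (hbd N p hp)
      (by simpa only [add_comm] using (tendsto_add_atTop_iff_nat N).2 (hK N p hp)) k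
    rw [dist_comm]
    exact this.trans_lt hk
  -- Only the terms of index at least `N` are used on the box of size `N`; all of them are solutions
  -- there.
  have hsol : ∀ N : ℕ, IsJetSol U N K := fun N =>
    IsJetSol.of_tendstoUniformlyOn (J := fun k => Θ (N + k))
      (fun k => (hΘ (N + k)).1.mono (by push_cast; linarith [(Nat.cast_nonneg k : (0 : ℝ) ≤ k)]))
      (hunif N)
  refine ⟨K, fun R => ?_, fun R x y hp => ?_⟩
  · obtain ⟨N, hN⟩ := exists_nat_ge R
    exact (hsol N).mono hN
  · obtain ⟨N, hN⟩ := exists_nat_ge R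
    have h1 := ((hunif N).tendsto_at (box_mono hN hp)).fst_nhds
    refine tendsto_nhds_unique h1 (tendsto_const_nhds.congr fun k => ?_)
    refine ((hΘ (N + k)).2 x y (box_mono ?_ hp)).symm
    push_cast; linarith [(Nat.cast_nonneg k : (0 : ℝ) ≤ k)]

end MittagLeffler
end ThermalLayer
end

noncomputable section

namespace ThermalLayer

open Filter Topology MeasureTheory Asymptotics

/-! ### Partial derivatives up to the boundary and primitives in `y`. -/

section HalfSpace

variable {n : ℕ} {F : Type*} [NormedAddCommGroup F] [NormedSpace ℝ F]

theorem uniqueDiffOn_halfSpace : UniqueDiffOn ℝ (halfSpace n) :=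
  uniqueDiffOn_univ.prod (uniqueDiffOn_Ici 0)

theorem uniqueDiffOn_domain : UniqueDiffOn ℝ (domain n) :=
  (uniqueDiffOn_Ici 0).prod (uniqueDiffOn_univ.prod (uniqueDiffOn_Ici 0))

theorem hasFDerivAt_slice_x {f : Tan n × ℝ → F} (hf : DifferentiableOn ℝ f (halfSpace n))
    {p : Tan n × ℝ} (hp : p ∈ halfSpace n) :
    HasFDerivAt (fun x => f (x, p.2))
      ((fderivWithin ℝ f (halfSpace n) p).comp (ContinuousLinearMap.inl ℝ (Tan n) ℝ)) p.1 := by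
  have h := (hf p hp).hasFDerivWithinAt
  have h2 : HasFDerivWithinAt (fun x : Tan n => (x, p.2)) (ContinuousLinearMap.inl ℝ (Tan n) ℝ)
    univ p.1 := (hasFDerivAt_prodMk_left p.1 p.2).hasFDerivWithinAt
  have := HasFDerivWithinAt.comp p.1 (g := f) (t := halfSpace n) (by exact h) h2
    (fun x _ => ⟨trivial, hp.2⟩)
  exact this.hasFDerivAt univ_mem

theorem hasDerivWithinAt_slice_y {f : Tan n × ℝ → F} (hf : DifferentiableOn ℝ f (halfSpace n))
    {p : Tan n × ℝ} (hp : p ∈ halfSpace n) :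
    HasDerivWithinAt (fun y => f (p.1, y))
      (fderivWithin ℝ f (halfSpace n) p (0, 1)) (Ici 0) p.2 := by
  have h := (hf p hp).hasFDerivWithinAt
  have h2 : HasDerivWithinAt (fun y : ℝ => (p.1, y)) ((0 : Tan n), (1 : ℝ)) (Ici 0) p.2 :=
    ((hasDerivAt_const p.2 p.1).prodMk (hasDerivAt_id p.2)).hasDerivWithinAt
  exact HasFDerivWithinAt.comp_hasDerivWithinAt p.2 (l := f) (t := halfSpace n) (by exact h) h2
    (fun x hx => ⟨trivial, hx⟩)

theorem contDiffOn_fderiv_slice {f : Tan n × ℝ → F} (hf : ContDiffOn ℝ ∞ f (halfSpace n)) :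
    ContDiffOn ℝ ∞ (fun p : Tan n × ℝ => fderiv ℝ (fun x => f (x, p.2)) p.1) (halfSpace n) := by
  have h1 : ContDiffOn ℝ ∞ (fderivWithin ℝ f (halfSpace n)) (halfSpace n) :=
    hf.fderivWithin uniqueDiffOn_halfSpace (by simp)
  refine (h1.clm_comp contDiffOn_const).congr fun p hp =>
    (hasFDerivAt_slice_x (hf.differentiableOn (by simp)) hp).fderiv

theorem contDiffOn_derivWithin_slice {f : Tan n × ℝ → F} (hf : ContDiffOn ℝ ∞ f (halfSpace n)) :
    ContDiffOn ℝ ∞ (fun p : Tan n × ℝ => dHalf (fun y => f (p.1, y)) p.2) (halfSpace n) := by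
  have h1 : ContDiffOn ℝ ∞ (fderivWithin ℝ f (halfSpace n)) (halfSpace n) :=
    hf.fderivWithin uniqueDiffOn_halfSpace (by simp)
  refine (h1.clm_apply contDiffOn_const).congr fun p hp =>
    (hasDerivWithinAt_slice_y (hf.differentiableOn (by simp)) hp).derivWithin
      (uniqueDiffOn_Ici 0 _ hp.2)

theorem contDiffOn_divH {w : Tan n → ℝ → Tan n}
    (hw : ContDiffOn ℝ ∞ (fun p : Tan n × ℝ => w p.1 p.2) (halfSpace n)) :
    ContDiffOn ℝ ∞ (fun p : Tan n × ℝ => divH (fun x => w x p.2) p.1) (halfSpace n) := by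
  have h1 := contDiffOn_fderiv_slice hw
  refine ContDiffOn.sum fun i _ => ?_
  exact (EuclideanSpace.proj i : Tan n →L[ℝ] ℝ).contDiff.comp_contDiffOn
    (h1.clm_apply contDiffOn_const)

section Domain

variable {f : ℝ × Tan n × ℝ → F}

theorem hasDerivWithinAt_domain_t (hf : DifferentiableOn ℝ f (domain n))
    {p : ℝ × Tan n × ℝ} (hp : p ∈ domain n) :
    HasDerivWithinAt (fun t => f (t, p.2)) (fderivWithin ℝ f (domain n) p (1, 0)) (Ici 0) p.1 := by
  have h2 : HasDerivWithinAt (fun y : ℝ => (y, p.2)) ((1 : ℝ), (0 : Tan n × ℝ)) (Ici 0) p.1 :=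
    ((hasDerivAt_id p.1).prodMk (hasDerivAt_const p.1 p.2)).hasDerivWithinAt
  exact HasFDerivWithinAt.comp_hasDerivWithinAt p.1 (l := f) (t := domain n)
    (by exact (hf p hp).hasFDerivWithinAt) h2 (fun x hx => ⟨hx, hp.2⟩)

theorem hasDerivWithinAt_domain_y (hf : DifferentiableOn ℝ f (domain n))
    {p : ℝ × Tan n × ℝ} (hp : p ∈ domain n) :
    HasDerivWithinAt (fun y => f (p.1, p.2.1, y)) (fderivWithin ℝ f (domain n) p (0, 0, 1))
      (Ici 0) p.2.2 := by
  have h2 : HasDerivWithinAt (fun y : ℝ => (p.1, p.2.1, y)) ((0 : ℝ), (0 : Tan n), (1 : ℝ))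
      (Ici 0) p.2.2 :=
    ((hasDerivAt_const p.2.2 p.1).prodMk ((hasDerivAt_const p.2.2 p.2.1).prodMk
      (hasDerivAt_id p.2.2))).hasDerivWithinAt
  exact HasFDerivWithinAt.comp_hasDerivWithinAt p.2.2 (l := f) (t := domain n)
    (by exact (hf p hp).hasFDerivWithinAt) h2 (fun x hx => ⟨hp.1, trivial, hx⟩)

theorem hasFDerivAt_domain_x (hf : DifferentiableOn ℝ f (domain n))
    {p : ℝ × Tan n × ℝ} (hp : p ∈ domain n) :
    HasFDerivAt (fun x => f (p.1, x, p.2.2)) ((fderivWithin ℝ f (domain n) p).comp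
      ((ContinuousLinearMap.inr ℝ ℝ (Tan n × ℝ)).comp (ContinuousLinearMap.inl ℝ (Tan n) ℝ)))
      p.2.1 := by
  have h2 : HasFDerivWithinAt (fun x : Tan n => (p.1, x, p.2.2))
      ((ContinuousLinearMap.inr ℝ ℝ (Tan n × ℝ)).comp (ContinuousLinearMap.inl ℝ (Tan n) ℝ))
      univ p.2.1 :=
    ((hasFDerivAt_prodMk_right p.1 (p.2.1, p.2.2)).comp p.2.1
      (hasFDerivAt_prodMk_left p.2.1 p.2.2)).hasFDerivWithinAt
  exact (HasFDerivWithinAt.comp p.2.1 (g := f) (t := domain n)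
    (by exact (hf p hp).hasFDerivWithinAt) h2
    (fun x _ => ⟨hp.1, trivial, hp.2.2⟩)).hasFDerivAt univ_mem

/-- The partial derivative in time of a function on the domain. -/
def partialT (f : ℝ × Tan n × ℝ → F) (p : ℝ × Tan n × ℝ) : F :=
  dHalf (fun t => f (t, p.2)) p.1

/-- The tangential derivative of a function on the domain. -/
def partialX (f : ℝ × Tan n × ℝ → F) (p : ℝ × Tan n × ℝ) : Tan n →L[ℝ] F :=
  fderiv ℝ (fun x => f (p.1, x, p.2.2)) p.2.1

/-- The normal derivative of a function on the domain. -/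
def partialY (f : ℝ × Tan n × ℝ → F) (p : ℝ × Tan n × ℝ) : F :=
  dHalf (fun y => f (p.1, p.2.1, y)) p.2.2

theorem partialT_eq (hf : DifferentiableOn ℝ f (domain n)) {p} (hp : p ∈ domain n) :
    partialT f p = fderivWithin ℝ f (domain n) p (1, 0) :=
  (hasDerivWithinAt_domain_t hf hp).derivWithin (uniqueDiffOn_Ici 0 _ hp.1)

theorem partialY_eq (hf : DifferentiableOn ℝ f (domain n)) {p} (hp : p ∈ domain n) :
    partialY f p = fderivWithin ℝ f (domain n) p (0, 0, 1) :=
  (hasDerivWithinAt_domain_y hf hp).derivWithin (uniqueDiffOn_Ici 0 _ hp.2.2)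

theorem partialX_eq (hf : DifferentiableOn ℝ f (domain n)) {p} (hp : p ∈ domain n) :
    partialX f p = (fderivWithin ℝ f (domain n) p).comp
      ((ContinuousLinearMap.inr ℝ ℝ (Tan n × ℝ)).comp (ContinuousLinearMap.inl ℝ (Tan n) ℝ)) :=
  (hasFDerivAt_domain_x hf hp).fderiv

theorem hasDerivWithinAt_partialT (hf : ContDiffOn ℝ 1 f (domain n)) {p} (hp : p ∈ domain n) :
    HasDerivWithinAt (fun t => f (t, p.2)) (partialT f p) (Ici 0) p.1 := by
  rw [partialT_eq (hf.differentiableOn (by simp)) hp]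
  exact hasDerivWithinAt_domain_t (hf.differentiableOn (by simp)) hp

theorem hasFDerivAt_partialX (hf : ContDiffOn ℝ 1 f (domain n)) {p} (hp : p ∈ domain n) :
    HasFDerivAt (fun x => f (p.1, x, p.2.2)) (partialX f p) p.2.1 := by
  rw [partialX_eq (hf.differentiableOn (by simp)) hp]
  exact hasFDerivAt_domain_x (hf.differentiableOn (by simp)) hp

theorem continuousOn_partialT (hf : ContDiffOn ℝ 1 f (domain n)) :
    ContinuousOn (partialT f) (domain n) :=
  ((hf.continuousOn_fderivWithin uniqueDiffOn_domain (by simp)).clm_apply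
    continuousOn_const).congr fun _ hp => partialT_eq (hf.differentiableOn (by simp)) hp

theorem continuousOn_partialY (hf : ContDiffOn ℝ 1 f (domain n)) :
    ContinuousOn (partialY f) (domain n) :=
  ((hf.continuousOn_fderivWithin uniqueDiffOn_domain (by simp)).clm_apply
    continuousOn_const).congr fun _ hp => partialY_eq (hf.differentiableOn (by simp)) hp

theorem continuousOn_partialX (hf : ContDiffOn ℝ 1 f (domain n)) :
    ContinuousOn (partialX f) (domain n) :=
  ((hf.continuousOn_fderivWithin uniqueDiffOn_domain (by simp)).clm_comp
    continuousOn_const).congr fun _ hp => partialX_eq (hf.differentiableOn (by simp)) hp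

/-- The primitive in the normal variable. -/
def primY (f : ℝ × Tan n × ℝ → F) (p : ℝ × Tan n × ℝ) : F :=
  ∫ z in (0 : ℝ)..p.2.2, f (p.1, p.2.1, z)

theorem continuousOn_primY (hf : ContinuousOn f (domain n)) :
    ContinuousOn (primY f) (domain n) := by
  -- Composition with the retraction `max · 0` extends `f` continuously to the whole space without
  -- changing it on the domain.
  have hc : Continuous (fun p : ℝ × Tan n × ℝ => f (max p.1 0, p.2.1, max p.2.2 0)) :=
    hf.comp_continuous (by fun_prop) fun p => ⟨mem_Ici.2 (le_max_right _ _), trivial,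
      mem_Ici.2 (le_max_right _ _)⟩
  have h1 : Continuous (fun p : ℝ × Tan n × ℝ =>
      ∫ z in (0 : ℝ)..p.2.2, f (max p.1 0, p.2.1, max z 0)) := by
    refine intervalIntegral.continuous_parametric_intervalIntegral_of_continuous
      (f := fun (p : ℝ × Tan n × ℝ) z => f (max p.1 0, p.2.1, max z 0)) ?_
      (by fun_prop)
    exact hc.comp (g := fun p : ℝ × Tan n × ℝ => f (max p.1 0, p.2.1, max p.2.2 0))
      (f := fun q : (ℝ × Tan n × ℝ) × ℝ => (q.1.1, q.1.2.1, q.2)) (by fun_prop)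
  refine h1.continuousOn.congr fun p hp => intervalIntegral.integral_congr fun z hz => ?_
  rw [uIcc_of_le (show (0 : ℝ) ≤ p.2.2 from hp.2.2)] at hz
  have := hp.1
  simp only [mem_Ici] at this
  simp [max_eq_left hz.1, max_eq_left this]

theorem hasDerivWithinAt_integral_Ici [CompleteSpace F] {g : ℝ → F} (hg : ContinuousOn g (Ici 0))
    {y : ℝ} (hy : 0 ≤ y) :
    HasDerivWithinAt (fun y => ∫ z in (0 : ℝ)..y, g z) (g y) (Ici 0) y := by
  have hc : Continuous (fun z => g (max z 0)) :=
    hg.comp_continuous (by fun_prop) fun p => mem_Ici.2 (le_max_right _ _)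
  have h := (hc.integral_hasStrictDerivAt 0 y).hasDerivAt.hasDerivWithinAt (s := Ici 0)
  simp only [max_eq_left hy] at h
  have e : ∀ w, 0 ≤ w → ∫ z in (0 : ℝ)..w, g z = ∫ z in (0 : ℝ)..w, g (max z 0) := by
    intro w hw
    refine intervalIntegral.integral_congr fun z hz => ?_
    rw [uIcc_of_le hw] at hz
    simp [max_eq_left hz.1]
  exact h.congr (fun w hw => e w hw) (e y hy)

/-- Compactness of `s × [0, y]` provides a constant as dominating function. -/
theorem hasFDerivWithinAt_intervalIntegral [CompleteSpace F] {E : Type*} [NormedAddCommGroup E]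
    [NormedSpace ℝ E] {s : Set E} (hs : Convex ℝ s) (hsc : IsCompact s) {y : ℝ} (hy : 0 ≤ y)
    {g : E → ℝ → F} {g' : E → ℝ → E →L[ℝ] F}
    (hg : ContinuousOn (Function.uncurry g) (s ×ˢ Icc 0 y))
    (hg' : ContinuousOn (Function.uncurry g') (s ×ˢ Icc 0 y))
    (hd : ∀ x ∈ s, ∀ z ∈ Icc 0 y, HasFDerivWithinAt (fun x => g x z) (g' x z) s x)
    {x₀ : E} (hx₀ : x₀ ∈ s) :
    HasFDerivWithinAt (fun x => ∫ z in (0 : ℝ)..y, g x z) (∫ z in (0 : ℝ)..y, g' x₀ z) s x₀ := by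
  simp only [intervalIntegral.integral_of_le hy]
  obtain ⟨C, hC⟩ := (hsc.prod isCompact_Icc).exists_bound_of_continuousOn hg'
  have cs : ∀ x ∈ s, ContinuousOn (g x) (Icc 0 y) := fun x hx =>
    hg.comp (f := fun z => (x, z)) (by fun_prop) fun z hz => ⟨hx, hz⟩
  have cs' : ∀ x ∈ s, ContinuousOn (g' x) (Icc 0 y) := fun x hx =>
    hg'.comp (f := fun z => (x, z)) (by fun_prop) fun z hz => ⟨hx, hz⟩
  have i1 : ∀ x ∈ s, Integrable (g x) (volume.restrict (Ioc 0 y)) := fun x hx =>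
    ((cs x hx).integrableOn_Icc.mono_set Ioc_subset_Icc_self)
  have i2 : ∀ x ∈ s, Integrable (g' x) (volume.restrict (Ioc 0 y)) := fun x hx =>
    ((cs' x hx).integrableOn_Icc.mono_set Ioc_subset_Icc_self)
  refine hasFDerivWithinAt_integral_of_dominated hs hx₀ (fun x hx => (i1 x hx).1) (i1 x₀ hx₀)
    (i2 x₀ hx₀).1 (bound := fun _ => C) ?_ (integrable_const C) ?_
  · filter_upwards [ae_restrict_mem measurableSet_Ioc] with z hz x hx
    exact hC (x, z) ⟨hx, Ioc_subset_Icc_self hz⟩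
  · filter_upwards [ae_restrict_mem measurableSet_Ioc] with z hz x hx
    exact hd x hx z (Ioc_subset_Icc_self hz)

theorem hasFDerivAt_primY [CompleteSpace F] (hf : ContDiffOn ℝ 1 f (domain n)) {p}
    (hp : p ∈ domain n) :
    HasFDerivAt (fun x => primY f (p.1, x, p.2.2)) (primY (partialX f) p) p.2.1 := by
  have hmap : MapsTo (fun q : Tan n × ℝ => (p.1, q.1, q.2))
      (Metric.closedBall p.2.1 1 ×ˢ Icc 0 p.2.2) (domain n) :=
    fun q hq => ⟨hp.1, trivial, hq.2.1⟩
  have := hasFDerivWithinAt_intervalIntegral (s := Metric.closedBall p.2.1 1) (y := p.2.2)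
    (g := fun x z => f (p.1, x, z)) (g' := fun x z => partialX f (p.1, x, z))
    (convex_closedBall _ _) (isCompact_closedBall _ _) hp.2.2
    (hf.continuousOn.comp (by fun_prop) hmap)
    ((continuousOn_partialX hf).comp (by fun_prop) hmap)
    (fun x hx z hz => (hasFDerivAt_partialX hf (p := (p.1, x, z))
      ⟨hp.1, trivial, hz.1⟩).hasFDerivWithinAt) (Metric.mem_closedBall_self zero_le_one)
  exact this.hasFDerivAt (Metric.closedBall_mem_nhds _ one_pos)

theorem hasDerivWithinAt_primY_t [CompleteSpace F] (hf : ContDiffOn ℝ 1 f (domain n)) {p}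
    (hp : p ∈ domain n) :
    HasDerivWithinAt (fun t => primY f (t, p.2)) (primY (partialT f) p) (Ici 0) p.1 := by
  have hmap : MapsTo (fun q : ℝ × ℝ => (q.1, p.2.1, q.2))
      (Icc 0 (p.1 + 1) ×ˢ Icc 0 p.2.2) (domain n) :=
    fun q hq => ⟨hq.1.1, trivial, hq.2.1⟩
  have cT := (continuousOn_partialT hf).comp (f := fun q : ℝ × ℝ => (q.1, p.2.1, q.2))
    (by fun_prop) hmap
  have h0 : 0 ≤ p.1 := hp.1
  have hmem : p.1 ∈ Icc 0 (p.1 + 1) := ⟨h0, by linarith⟩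
  have := hasFDerivWithinAt_intervalIntegral (s := Icc 0 (p.1 + 1)) (y := p.2.2)
    (g := fun t z => f (t, p.2.1, z))
    (g' := fun t z => ContinuousLinearMap.toSpanSingleton ℝ (partialT f (t, p.2.1, z)))
    (convex_Icc _ _) isCompact_Icc hp.2.2
    (hf.continuousOn.comp (by fun_prop) hmap)
    ((ContinuousLinearMap.toSpanSingletonCLE (𝕜 := ℝ) (E := F)).continuous.comp_continuousOn cT)
    (fun x hx z hz => ((hasDerivWithinAt_partialT hf (p := (x, p.2.1, z))
      ⟨hx.1, trivial, hz.1⟩).mono (fun w hw => hw.1)).hasFDerivWithinAt) hmem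
  have h2 := this.hasDerivWithinAt
  have hi : IntervalIntegrable (fun z => partialT f (p.1, p.2.1, z)) volume 0 p.2.2 := by
    refine ContinuousOn.intervalIntegrable ?_
    rw [uIcc_of_le hp.2.2]
    exact (continuousOn_partialT hf).comp (by fun_prop) fun z hz => ⟨hp.1, trivial, hz.1⟩
  have e : (∫ z in (0 : ℝ)..p.2.2, ContinuousLinearMap.toSpanSingleton ℝ
      (partialT f (p.1, p.2.1, z))) 1 = primY (partialT f) p := by
    rw [ContinuousLinearMap.intervalIntegral_apply]
    · simp [primY]
    · let T := (ContinuousLinearMap.toSpanSingletonCLE (𝕜 := ℝ) (E := F)).toContinuousLinearMap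
      exact ⟨T.integrable_comp hi.1, T.integrable_comp hi.2⟩
  rw [e] at h2
  refine h2.mono_of_mem_nhdsWithin ?_
  rw [← Ici_inter_Iic]
  exact inter_mem self_mem_nhdsWithin (mem_nhdsWithin_of_mem_nhds (Iic_mem_nhds (by linarith)))

theorem hasDerivWithinAt_primY_y [CompleteSpace F] (hf : ContinuousOn f (domain n)) {p}
    (hp : p ∈ domain n) :
    HasDerivWithinAt (fun y => primY f (p.1, p.2.1, y)) (f p) (Ici 0) p.2.2 :=
  hasDerivWithinAt_integral_Ici (g := fun z => f (p.1, p.2.1, z))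
    (hf.comp (by fun_prop) fun z hz => ⟨hp.1, trivial, hz⟩) hp.2.2

/-- The partial derivatives of the primitive in `t` and `x'` are primitives of those of `f`, and its
`y`-derivative is `f` itself; all three are continuous. -/
theorem contDiffOn_primY [CompleteSpace F] (hf : ContDiffOn ℝ 1 f (domain n)) :
    ContDiffOn ℝ 1 (primY f) (domain n) :=
  contDiffOn_domain_of_partial (continuousOn_primY (continuousOn_partialT hf))
    (continuousOn_primY (continuousOn_partialX hf)) hf.continuousOn
    (fun _ hp => hasDerivWithinAt_primY_t hf hp) (fun _ hp => hasFDerivAt_primY hf hp)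
    (fun _ hp => hasDerivWithinAt_primY_y hf.continuousOn hp)

end Domain
end HalfSpace
end ThermalLayer
end

noncomputable section

namespace ThermalLayer

open Filter Topology MeasureTheory Asymptotics

/-! ### Verification of the formulas for the velocity. -/

section Linearized

variable {n : ℕ} {F : Type*} [NormedAddCommGroup F] [NormedSpace ℝ F]

/-- The transport of a function on the half space by the shear flow. -/
def transported (U : ℝ → Tan n) (g : Tan n × ℝ → F) (p : ℝ × Tan n × ℝ) : F :=
  g (p.2.1 - p.1 • U p.2.2, p.2.2)

theorem contDiffOn_transported {U : ℝ → Tan n} (hU : ContDiffOn ℝ ∞ U (Ici 0))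
    {g : Tan n × ℝ → F} (hg : ContDiffOn ℝ ∞ g (halfSpace n)) :
    ContDiffOn ℝ 1 (transported U g) (domain n) := by
  have hU' : ContDiffOn ℝ 1 (fun p : ℝ × Tan n × ℝ => U p.2.2) (domain n) :=
    (hU.of_le (by simp)).comp (contDiff_snd.comp contDiff_snd).contDiffOn fun p hp => hp.2.2
  refine (hg.of_le (by simp)).comp (t := halfSpace n) ?_ fun p hp => ⟨trivial, hp.2.2⟩
  refine ContDiffOn.prodMk ?_ (contDiff_snd.comp contDiff_snd).contDiffOn
  exact (contDiff_fst.comp contDiff_snd).contDiffOn.sub (contDiff_fst.contDiffOn.smul hU')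

theorem hasFDerivAt_transported {U : ℝ → Tan n} {g : Tan n × ℝ → F}
    (hg : ContDiffOn ℝ ∞ g (halfSpace n)) {p : ℝ × Tan n × ℝ} (hp : p ∈ domain n) :
    HasFDerivAt (fun x => transported U g (p.1, x, p.2.2))
      (fderiv ℝ (fun x => g (x, p.2.2)) (p.2.1 - p.1 • U p.2.2)) p.2.1 := by
  have h := (hasFDerivAt_slice_x (hg.differentiableOn (by simp))
    (p := (p.2.1 - p.1 • U p.2.2, p.2.2)) ⟨trivial, hp.2.2⟩).differentiableAt.hasFDerivAt
  have h2 := h.comp p.2.1 ((hasFDerivAt_id p.2.1).sub_const (p.1 • U p.2.2))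
  simpa [Function.comp_def, transported] using h2

theorem hasDerivAt_transported {U : ℝ → Tan n} {g : Tan n × ℝ → F}
    (hg : ContDiffOn ℝ ∞ g (halfSpace n)) {p : ℝ × Tan n × ℝ} (hp : p ∈ domain n) :
    HasDerivAt (fun t => transported U g (t, p.2))
      (-(fderiv ℝ (fun x => g (x, p.2.2)) (p.2.1 - p.1 • U p.2.2)) (U p.2.2)) p.1 := by
  have h := (hasFDerivAt_slice_x (hg.differentiableOn (by simp))
    (p := (p.2.1 - p.1 • U p.2.2, p.2.2)) ⟨trivial, hp.2.2⟩).differentiableAt.hasFDerivAt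
  have h1 : HasDerivAt (fun t : ℝ => p.2.1 - t • U p.2.2) (-(U p.2.2)) p.1 := by
    simpa using ((hasDerivAt_id p.1).smul_const (U p.2.2)).const_sub p.2.1
  have h2 := h.comp_hasDerivAt p.1 h1
  simpa [Function.comp_def, transported] using h2

theorem partialX_transported {U : ℝ → Tan n} {g : Tan n × ℝ → F}
    (hg : ContDiffOn ℝ ∞ g (halfSpace n)) {p : ℝ × Tan n × ℝ} (hp : p ∈ domain n) :
    partialX (transported U g) p = fderiv ℝ (fun x => g (x, p.2.2)) (p.2.1 - p.1 • U p.2.2) :=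
  (hasFDerivAt_transported hg hp).fderiv

theorem partialT_transported {U : ℝ → Tan n} {g : Tan n × ℝ → F}
    (hg : ContDiffOn ℝ ∞ g (halfSpace n)) {p : ℝ × Tan n × ℝ} (hp : p ∈ domain n) :
    partialT (transported U g) p = -(partialX (transported U g) p) (U p.2.2) := by
  rw [partialX_transported hg hp]
  exact (hasDerivAt_transported hg hp).hasDerivWithinAt.derivWithin (uniqueDiffOn_Ici 0 _ hp.1)

theorem sum_apply_single_mul (a : Tan n →L[ℝ] ℝ) (v : Tan n) :
    ∑ i, a (EuclideanSpace.single i 1) * v i = a v := by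
  conv_rhs => rw [← (EuclideanSpace.basisFun (Fin n) ℝ).sum_repr v, map_sum]
  refine Finset.sum_congr rfl fun i _ => ?_
  simp [mul_comm]

/-- The shear-weighted integral splits into the primitive of the tangential derivative and a
remainder. -/
theorem integral_partialX_sub {U : ℝ → Tan n} (hU : ContinuousOn U (Ici 0))
    {f : ℝ × Tan n × ℝ → ℝ} (hf : ContDiffOn ℝ 1 f (domain n)) {p} (hp : p ∈ domain n) :
    ∫ z in (0 : ℝ)..p.2.2, partialX f (p.1, p.2.1, z) (U p.2.2 - U z) =
      primY (partialX f) p (U p.2.2) - primY (fun q => partialX f q (U q.2.2)) p := by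
  have hy : (0 : ℝ) ≤ p.2.2 := hp.2.2
  have c1 : ContinuousOn (fun z => partialX f (p.1, p.2.1, z)) (Icc 0 p.2.2) :=
    (continuousOn_partialX hf).comp (by fun_prop) fun z hz => ⟨hp.1, trivial, hz.1⟩
  have i1 : IntervalIntegrable (fun z => partialX f (p.1, p.2.1, z)) volume 0 p.2.2 :=
    ContinuousOn.intervalIntegrable (by rwa [uIcc_of_le hy])
  have i2 : IntervalIntegrable (fun z => partialX f (p.1, p.2.1, z) (U p.2.2)) volume 0 p.2.2 :=
    ContinuousOn.intervalIntegrable (by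
      rw [uIcc_of_le hy]; exact c1.clm_apply continuousOn_const)
  have i3 : IntervalIntegrable (fun z => partialX f (p.1, p.2.1, z) (U z)) volume 0 p.2.2 :=
    ContinuousOn.intervalIntegrable (by
      rw [uIcc_of_le hy]; exact c1.clm_apply (hU.mono fun z hz => hz.1))
  simp only [map_sub, primY]
  rw [intervalIntegral.integral_sub i2 i3, ContinuousLinearMap.intervalIntegral_apply i1]

theorem primY_congr {f g : ℝ × Tan n × ℝ → F} (h : EqOn f g (domain n)) {p}
    (hp : p ∈ domain n) : primY f p = primY g p := by
  refine intervalIntegral.integral_congr fun z hz => ?_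
  rw [uIcc_of_le (show (0 : ℝ) ≤ p.2.2 from hp.2.2)] at hz
  exact h ⟨hp.1, trivial, hz.1⟩

variable {U : ℝ → Tan n} {u₀ : Tan n → ℝ → Tan n} {θ₀ : Tan n → ℝ → ℝ}

/-- The tangential velocity recovered from the temperature. -/
def uhFormula (U : ℝ → Tan n) (u₀ : Tan n → ℝ → Tan n) (θ₀ : Tan n → ℝ → ℝ)
    (θ : ℝ → Tan n → ℝ → ℝ) (t : ℝ) (x : Tan n) (y : ℝ) : Tan n :=
  u₀ (x - t • U y) y
    + (t * ∫ z in (0 : ℝ)..y, divH (fun x' => u₀ x' z) (x - t • U z)) • dHalf U y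
    + (∫ z in (0 : ℝ)..y, θ₀ (x - t • U z) z) • dHalf U y
    - (∫ z in (0 : ℝ)..y, θ t x z) • dHalf U y

/-- The normal velocity recovered from the temperature. -/
def udFormula (U : ℝ → Tan n) (u₀ : Tan n → ℝ → Tan n) (θ₀ : Tan n → ℝ → ℝ)
    (θ : ℝ → Tan n → ℝ → ℝ) (t : ℝ) (x : Tan n) (y : ℝ) : ℝ :=
  dy θ t x y - dy θ t x 0
    - (∫ z in (0 : ℝ)..y, divH (fun x' => u₀ x' z) (x - t • U z))
    - t * (∫ z in (0 : ℝ)..y,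
        dirDeriv (U y - U z) (fun ξ => divH (fun x' => u₀ x' z) ξ) (x - t • U z))
    - (∫ z in (0 : ℝ)..y, dirDeriv (U y - U z) (fun ξ => θ₀ ξ z) (x - t • U z))
    + (∫ z in (0 : ℝ)..y, dirDeriv (U y - U z) (fun x' => θ t x' z) x)

/-- Every classical solution of the temperature problem gives a classical solution of the
linearized system, by explicit formulas for the velocity. -/
theorem isLinearizedSolution_of_temperature
    (hU : ContDiffOn ℝ ∞ U (Ici 0))
    (hu₀ : ContDiffOn ℝ ∞ (fun p : Tan n × ℝ => u₀ p.1 p.2) (halfSpace n))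
    (hθ₀ : ContDiffOn ℝ ∞ (fun p : Tan n × ℝ => θ₀ p.1 p.2) (halfSpace n))
    {θ : ℝ → Tan n → ℝ → ℝ} (hθ : IsTemperatureSolution U θ₀ θ) :
    IsLinearizedSolution U u₀ θ₀ (uhFormula U u₀ θ₀ θ) (udFormula U u₀ θ₀ θ) θ := by
  have cU : ContinuousOn U (Ici 0) := hU.continuousOn
  have hU' : ContDiffOn ℝ 1 (dHalf U) (Ici 0) :=
    (hU.derivWithin (uniqueDiffOn_Ici 0) (m := ∞) (by simp)).of_le (by simp)
  have dU : ∀ y, 0 ≤ y → HasDerivWithinAt U (dHalf U y) (Ici 0) y := fun y hy =>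
    ((hU.differentiableOn (by simp)) y hy).hasDerivWithinAt
  set G₀ : Tan n × ℝ → Tan n := fun p => u₀ p.1 p.2 with hG₀
  set G₁ : Tan n × ℝ → ℝ := fun p => divH (fun x => u₀ x p.2) p.1 with hG₁
  set G₂ : Tan n × ℝ → ℝ := fun p => θ₀ p.1 p.2 with hG₂
  have sG₁ : ContDiffOn ℝ ∞ G₁ (halfSpace n) := contDiffOn_divH hu₀
  set F₁ := transported U G₁ with hF₁
  set F₂ := transported U G₂ with hF₂
  set F₃ : ℝ × Tan n × ℝ → ℝ := fun p => θ p.1 p.2.1 p.2.2 with hF₃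
  have s₀ := contDiffOn_transported hU hu₀
  have s₁ : ContDiffOn ℝ 1 F₁ (domain n) := contDiffOn_transported hU sG₁
  have s₂ : ContDiffOn ℝ 1 F₂ (domain n) := contDiffOn_transported hU hθ₀
  have s₃ : ContDiffOn ℝ 1 F₃ (domain n) := hθ.contDiffOn
  have sU' : ContDiffOn ℝ 1 (fun p : ℝ × Tan n × ℝ => dHalf U p.2.2) (domain n) :=
    hU'.comp (contDiff_snd.comp contDiff_snd).contDiffOn fun p hp => hp.2.2
  have cUd : ContinuousOn (fun p : ℝ × Tan n × ℝ => U p.2.2) (domain n) :=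
    cU.comp (by fun_prop) fun p hp => hp.2.2
  have euh : ∀ p : ℝ × Tan n × ℝ, uhFormula U u₀ θ₀ θ p.1 p.2.1 p.2.2 =
      transported U G₀ p + (p.1 * primY F₁ p) • dHalf U p.2.2 + primY F₂ p • dHalf U p.2.2
        - primY F₃ p • dHalf U p.2.2 := fun p => rfl
  have suh : ContDiffOn ℝ 1 (fun p : ℝ × Tan n × ℝ => uhFormula U u₀ θ₀ θ p.1 p.2.1 p.2.2)
      (domain n) := by
    refine ContDiffOn.congr ?_ fun p _ => euh p
    exact ((s₀.add ((contDiff_fst.contDiffOn.mul (contDiffOn_primY s₁)).smul sU')).add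
      ((contDiffOn_primY s₂).smul sU')).sub ((contDiffOn_primY s₃).smul sU')
  -- `K f` is the primitive of `U · ∇_h f`. With it the shear-weighted integrals become `primY
  -- (partialX f) p (U y) - K f p`, in which the outer `y` no longer occurs under the integral sign.
  set K : (ℝ × Tan n × ℝ → ℝ) → ℝ × Tan n × ℝ → ℝ :=
    fun f => primY (fun q => partialX f q (U q.2.2)) with hK
  have cK : ∀ f : ℝ × Tan n × ℝ → ℝ, ContDiffOn ℝ 1 f (domain n) →
      ContinuousOn (fun q => partialX f q (U q.2.2)) (domain n) := by
    intro f hf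
    exact (continuousOn_partialX hf).clm_apply cUd
  have eud : ∀ p ∈ domain n, udFormula U u₀ θ₀ θ p.1 p.2.1 p.2.2 =
      partialY F₃ p - partialY F₃ (p.1, p.2.1, 0) - primY F₁ p
        - p.1 * (primY (partialX F₁) p (U p.2.2) - K F₁ p)
        - (primY (partialX F₂) p (U p.2.2) - K F₂ p)
        + (primY (partialX F₃) p (U p.2.2) - K F₃ p) := by
    intro p hp
    rw [← integral_partialX_sub cU s₁ hp, ← integral_partialX_sub cU s₂ hp,
      ← integral_partialX_sub cU s₃ hp]
    have e1 : ∫ z in (0 : ℝ)..p.2.2, partialX F₁ (p.1, p.2.1, z) (U p.2.2 - U z) =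
        ∫ z in (0 : ℝ)..p.2.2, dirDeriv (U p.2.2 - U z)
          (fun ξ => divH (fun x' => u₀ x' z) ξ) (p.2.1 - p.1 • U z) := by
      refine intervalIntegral.integral_congr fun z hz => ?_
      rw [uIcc_of_le (show (0 : ℝ) ≤ p.2.2 from hp.2.2)] at hz
      simp only [hF₁, dirDeriv]
      rw [partialX_transported (p := (p.1, p.2.1, z)) sG₁ ⟨hp.1, trivial, hz.1⟩]
    have e2 : ∫ z in (0 : ℝ)..p.2.2, partialX F₂ (p.1, p.2.1, z) (U p.2.2 - U z) =
        ∫ z in (0 : ℝ)..p.2.2, dirDeriv (U p.2.2 - U z)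
          (fun ξ => θ₀ ξ z) (p.2.1 - p.1 • U z) := by
      refine intervalIntegral.integral_congr fun z hz => ?_
      rw [uIcc_of_le (show (0 : ℝ) ≤ p.2.2 from hp.2.2)] at hz
      simp only [hF₂, dirDeriv]
      rw [partialX_transported (p := (p.1, p.2.1, z)) hθ₀ ⟨hp.1, trivial, hz.1⟩]
    rw [e1, e2]
    rfl
  have hdyy : ∀ p ∈ domain n, HasDerivWithinAt (fun y => partialY F₃ (p.1, p.2.1, y))
      (dy (dy θ) p.1 p.2.1 p.2.2) (Ici 0) p.2.2 := fun p hp =>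
    (hθ.differentiable_dy p.1 p.2.1 hp.1 p.2.2 hp.2.2).hasDerivWithinAt
  have hudy : ∀ p ∈ domain n, HasDerivWithinAt (fun y => udFormula U u₀ θ₀ θ p.1 p.2.1 y)
      (dy (dy θ) p.1 p.2.1 p.2.2 - F₁ p
        - p.1 * (primY (partialX F₁) p (dHalf U p.2.2))
        - (primY (partialX F₂) p (dHalf U p.2.2))
        + (primY (partialX F₃) p (dHalf U p.2.2))) (Ici 0) p.2.2 := by
    intro p hp
    -- The two endpoint contributions `∇_h f · U(y)` cancel, and only the derivative falling on
    -- `U(y)` remains.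
    have hmix : ∀ f : ℝ × Tan n × ℝ → ℝ, ContDiffOn ℝ 1 f (domain n) → HasDerivWithinAt
        (fun y => primY (partialX f) (p.1, p.2.1, y) (U y) - K f (p.1, p.2.1, y))
        (primY (partialX f) p (dHalf U p.2.2)) (Ici 0) p.2.2 := by
      intro f hf
      have h1 := (hasDerivWithinAt_primY_y (continuousOn_partialX hf) hp).clm_apply (dU p.2.2 hp.2.2)
      have h2 := hasDerivWithinAt_primY_y (cK f hf) hp
      exact (h1.sub h2).congr_deriv (by simp)
    have h := ((((hdyy p hp).sub_const (partialY F₃ (p.1, p.2.1, 0))).sub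
      (hasDerivWithinAt_primY_y s₁.continuousOn hp)).sub ((hmix F₁ s₁).const_mul p.1)).sub
      (hmix F₂ s₂) |>.add (hmix F₃ s₃)
    exact h.congr (fun y hy => eud (p.1, p.2.1, y) ⟨hp.1, trivial, hy⟩) (eud p hp)
  have hux : ∀ p ∈ domain n, HasFDerivAt (fun x => uhFormula U u₀ θ₀ θ p.1 x p.2.2)
      (fderiv ℝ (fun x => u₀ x p.2.2) (p.2.1 - p.1 • U p.2.2)
        + (p.1 • primY (partialX F₁) p).smulRight (dHalf U p.2.2)
        + (primY (partialX F₂) p).smulRight (dHalf U p.2.2)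
        - (primY (partialX F₃) p).smulRight (dHalf U p.2.2)) p.2.1 := by
    intro p hp
    exact (((hasFDerivAt_transported hu₀ hp).add
      (((hasFDerivAt_primY s₁ hp).const_mul p.1).smul_const (dHalf U p.2.2))).add
      ((hasFDerivAt_primY s₂ hp).smul_const (dHalf U p.2.2))).sub
      ((hasFDerivAt_primY s₃ hp).smul_const (dHalf U p.2.2))
  -- The divergence in `x'` of `φ(x') U'(y)` is `U'(y) · ∇_h φ`; these are exactly the terms
  -- produced by the `y`-derivative of the shear integrals, with opposite sign.
  have hdiv : ∀ p ∈ domain n, divH (fun x => uhFormula U u₀ θ₀ θ p.1 x p.2.2) p.2.1 =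
      F₁ p + p.1 * (primY (partialX F₁) p (dHalf U p.2.2))
        + (primY (partialX F₂) p (dHalf U p.2.2)) - (primY (partialX F₃) p (dHalf U p.2.2)) := by
    intro p hp
    rw [divH, (hux p hp).fderiv, ← sum_apply_single_mul (primY (partialX F₁) p),
      ← sum_apply_single_mul (primY (partialX F₂) p),
      ← sum_apply_single_mul (primY (partialX F₃) p)]
    simp only [hF₁, transported, hG₁, divH]
    rw [Finset.mul_sum, ← Finset.sum_add_distrib, ← Finset.sum_add_distrib,
      ← Finset.sum_sub_distrib]
    refine Finset.sum_congr rfl fun i _ => ?_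
    simp [mul_assoc]
  have edy : ∀ p ∈ domain n, dy (udFormula U u₀ θ₀ θ) p.1 p.2.1 p.2.2 =
      dy (dy θ) p.1 p.2.1 p.2.2 - divH (fun x => uhFormula U u₀ θ₀ θ p.1 x p.2.2) p.2.1 := by
    intro p hp
    rw [hdiv p hp]
    refine ((hudy p hp).derivWithin (uniqueDiffOn_Ici 0 _ hp.2.2)).trans ?_
    ring
  have hzero : ∀ t x, udFormula U u₀ θ₀ θ t x 0 = 0 := by
    intro t x
    simp [udFormula]
  have ftc : ∀ p ∈ domain n, primY (fun q => dy (dy θ) q.1 q.2.1 q.2.2) p =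
      partialY F₃ p - partialY F₃ (p.1, p.2.1, 0) := by
    intro p hp
    refine intervalIntegral.integral_eq_sub_of_hasDerivAt_of_le hp.2.2 ?_ ?_ ?_
    · exact fun y hy => ((hdyy (p.1, p.2.1, y) ⟨hp.1, trivial, hy.1⟩).continuousWithinAt).mono
        fun z hz => hz.1
    · exact fun y hy => (hdyy (p.1, p.2.1, y) ⟨hp.1, trivial, hy.1.le⟩).hasDerivAt
        (Ici_mem_nhds hy.1)
    · refine ContinuousOn.intervalIntegrable ?_
      rw [uIcc_of_le hp.2.2]
      exact hθ.continuousOn_dyy.comp (by fun_prop) fun z hz => ⟨hp.1, trivial, hz.1⟩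
  have hIt : ∀ g : Tan n × ℝ → ℝ, ContDiffOn ℝ ∞ g (halfSpace n) → ∀ p ∈ domain n,
      primY (partialT (transported U g)) p = - K (transported U g) p := by
    intro g hg p hp
    rw [primY_congr (fun q hq => partialT_transported hg hq) hp]
    simp only [hK, primY]
    rw [intervalIntegral.integral_neg]
  -- The temperature equation integrated over `(0, y)`. This is where the boundary flux `∂_y θ` at
  -- `y = 0` enters the formula for the normal velocity.
  have hIt₃ : ∀ p ∈ domain n, primY (partialT F₃) p =
      partialY F₃ p - partialY F₃ (p.1, p.2.1, 0) - K F₃ p := by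
    intro p hp
    have e : EqOn (partialT F₃)
        (fun q => dy (dy θ) q.1 q.2.1 q.2.2 - partialX F₃ q (U q.2.2)) (domain n) := by
      intro q hq
      have := hθ.equation q.1 q.2.1 q.2.2 hq.1 hq.2.2
      simp only
      rw [← this]
      simp [partialT, partialX, dt, dirDeriv, hF₃]
    rw [primY_congr e hp, ← ftc p hp]
    have hmaps : MapsTo (fun z => (p.1, p.2.1, z)) (Icc 0 p.2.2) (domain n) :=
      fun z hz => ⟨hp.1, trivial, hz.1⟩
    refine intervalIntegral.integral_sub (ContinuousOn.intervalIntegrable ?_)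
      (ContinuousOn.intervalIntegrable ?_)
    · rw [uIcc_of_le hp.2.2]
      exact hθ.continuousOn_dyy.comp (f := fun z => (p.1, p.2.1, z)) (by fun_prop) hmaps
    · rw [uIcc_of_le hp.2.2]
      exact (cK F₃ s₃).comp (f := fun z => (p.1, p.2.1, z)) (by fun_prop) hmaps
  refine ⟨suh, ?_, ?_, ?_, hθ.contDiffOn, hθ.differentiable_dy, hθ.continuousOn_dyy, ?_,
    hθ.equation, ?_, fun t x _ => hzero t x, hθ.boundary, ?_, hθ.initial⟩
  · have cmix : ∀ f : ℝ × Tan n × ℝ → ℝ, ContDiffOn ℝ 1 f (domain n) → ContinuousOn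
        (fun p => primY (partialX f) p (U p.2.2) - K f p) (domain n) := fun f hf =>
      ((continuousOn_primY (continuousOn_partialX hf)).clm_apply cUd).sub
        (continuousOn_primY (cK f hf))
    have c0 : ContinuousOn (fun p : ℝ × Tan n × ℝ => partialY F₃ (p.1, p.2.1, 0)) (domain n) :=
      (continuousOn_partialY s₃).comp (by fun_prop) fun p hp => ⟨hp.1, trivial, self_mem_Ici⟩
    refine ContinuousOn.congr ?_ eud
    exact (((((continuousOn_partialY s₃).sub c0).sub (continuousOn_primY s₁.continuousOn)).sub
      (continuous_fst.continuousOn.mul (cmix F₁ s₁))).sub (cmix F₂ s₂)).add (cmix F₃ s₃)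
  · exact fun t x ht y hy => (hudy (t, x, y) ⟨ht, trivial, hy⟩).differentiableWithinAt
  · refine ContinuousOn.congr (hθ.continuousOn_dyy.sub ?_) edy
    refine continuousOn_finsetSum _ fun i _ => ?_
    exact (EuclideanSpace.proj i : Tan n →L[ℝ] ℝ).continuous.comp_continuousOn
      ((continuousOn_partialX suh).clm_apply continuousOn_const)
  · intro t x y ht hy
    have hp : (t, x, y) ∈ domain n := ⟨ht, trivial, hy⟩
    have h1 : dt (uhFormula U u₀ θ₀ θ) t x y =
        -(fderiv ℝ (fun x => u₀ x y) (x - t • U y)) (U y)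
        + (primY F₁ (t, x, y) - t * K F₁ (t, x, y)) • dHalf U y
        + (- K F₂ (t, x, y)) • dHalf U y
        - (partialY F₃ (t, x, y) - partialY F₃ (t, x, 0) - K F₃ (t, x, y)) • dHalf U y := by
      have hd := (((hasDerivAt_transported (U := U) hu₀ hp).hasDerivWithinAt (s := Ici 0)).add
        (((hasDerivWithinAt_id t (Ici 0)).mul (hasDerivWithinAt_primY_t s₁ hp)).smul_const
          (dHalf U y))).add ((hasDerivWithinAt_primY_t s₂ hp).smul_const (dHalf U y)) |>.sub
        ((hasDerivWithinAt_primY_t s₃ hp).smul_const (dHalf U y))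
      refine (hd.derivWithin (uniqueDiffOn_Ici 0 _ ht)).trans ?_
      rw [hIt G₁ sG₁ _ hp, hIt G₂ hθ₀ _ hp, hIt₃ _ hp]
      simp [hF₁, hF₂, hG₀, sub_eq_add_neg]
    -- The transport terms of the initial velocity cancel against each other, and the coefficients
    -- of `U'` left over add up to minus the normal velocity.
    have h2 := congrArg (fun A => A (U y)) (hux (t, x, y) hp).fderiv
    rw [h1, dirDeriv, h2, eud (t, x, y) hp]
    simp only [add_apply, sub_apply,
      ContinuousLinearMap.smulRight_apply, smul_apply, smul_eq_mul]
    module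
  · intro t x y ht hy
    have hp : (t, x, y) ∈ domain n := ⟨ht, trivial, hy⟩
    rw [edy (t, x, y) hp]
    ring
  · intro x y hy
    -- At `t = 0` the two temperature integrals in the formula are equal and cancel.
    have hin : ∫ z in (0 : ℝ)..y, θ₀ (x - (0 : ℝ) • U z) z = ∫ z in (0 : ℝ)..y, θ 0 x z := by
      refine intervalIntegral.integral_congr fun z hz => ?_
      rw [uIcc_of_le hy] at hz
      simp [hθ.initial x z hz.1]
    simp only [uhFormula, hin]
    simp

end Linearized
end ThermalLayer
end

noncomputable section

namespace ThermalLayer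

open Filter Topology MeasureTheory Asymptotics

/-! ### A one-dimensional bump of Gevrey order `3/2`. -/

section Gevrey

open scoped Nat

/-- A holomorphic function whose restriction to `(0, 1)` is a bump of Gevrey order `3 / 2`. -/
def bumpHol (z : ℂ) : ℂ := Complex.exp (-(z ^ 2)⁻¹ - ((1 - z) ^ 2)⁻¹)

/-- With `w = a + ib` one has `Re w⁻² = (a² - b²) / (a² + b²)²`. On this disc `a² - b² ≥ 48/64 t²`
and `a² + b² ≤ 82/64 t²`, which leaves room for the constant `1/4`. -/
theorem re_inv_sq_ge {w : ℂ} {t : ℝ} (ht : 0 < t) (hw : ‖w - t‖ ≤ t / 8) :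
    1 / (4 * t ^ 2) ≤ ((w ^ 2)⁻¹).re := by
  have h1 := (Complex.abs_re_le_norm (w - t)).trans hw
  have h2 := (Complex.abs_im_le_norm (w - t)).trans hw
  simp only [Complex.sub_re, Complex.ofReal_re, Complex.sub_im, Complex.ofReal_im, sub_zero] at h1 h2
  rw [abs_le] at h1 h2
  have ha : 7 / 8 * t ≤ w.re := by linarith [h1.1]
  have ha' : w.re ≤ 9 / 8 * t := by linarith [h1.2]
  have hb : w.im ^ 2 ≤ (t / 8) ^ 2 := sq_le_sq' h2.1 h2.2
  have hre : (7 / 8 * t) ^ 2 ≤ w.re ^ 2 := by gcongr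
  have hre' : w.re ^ 2 ≤ (9 / 8 * t) ^ 2 := by
    have : 0 ≤ w.re := by nlinarith
    gcongr
  rw [Complex.inv_re]
  have e1 : (w ^ 2).re = w.re ^ 2 - w.im ^ 2 := by simp [pow_two]
  have e2 : Complex.normSq (w ^ 2) = (w.re ^ 2 + w.im ^ 2) ^ 2 := by
    rw [map_pow, Complex.normSq_apply]; ring
  rw [e1, e2]
  have ht2 : 0 < t ^ 2 := by positivity
  rw [div_le_div_iff₀ (by positivity) (by nlinarith [sq_nonneg w.im])]
  have hs : w.re ^ 2 + w.im ^ 2 ≤ 82 / 64 * t ^ 2 := by nlinarith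
  have hd : 48 / 64 * t ^ 2 ≤ w.re ^ 2 - w.im ^ 2 := by nlinarith
  have : (w.re ^ 2 + w.im ^ 2) ^ 2 ≤ (82 / 64 * t ^ 2) ^ 2 := by gcongr
  nlinarith

/-- Here `m` is the distance from `t` to the nearer endpoint. Both terms of the exponent have a
favourable real part on the disc, and the nearer endpoint alone gives the decay. -/
theorem norm_bumpHol_le {t m : ℝ} (hm : 0 < m) (h0 : m ≤ t) (h1 : m ≤ 1 - t)
    (hmin : m = t ∨ m = 1 - t) {z : ℂ} (hz : ‖z - t‖ ≤ m / 8) :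
    ‖bumpHol z‖ ≤ Real.exp (-(1 / (4 * m ^ 2))) := by
  rw [bumpHol, Complex.norm_exp, Real.exp_le_exp]
  have a1 := re_inv_sq_ge (w := z) (t := t) (by linarith) (by linarith)
  have a2 := re_inv_sq_ge (w := 1 - z) (t := 1 - t) (by linarith) (by
    have : (1 - z) - ((1 - t : ℝ) : ℂ) = -(z - t) := by push_cast; ring
    rw [this, norm_neg]; linarith)
  have p1 : 0 ≤ 1 / (4 * t ^ 2) := by positivity
  have p2 : 0 ≤ 1 / (4 * (1 - t) ^ 2) := by positivity
  simp only [Complex.sub_re, Complex.neg_re]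
  rcases hmin with h | h <;> rw [h] <;> linarith

theorem analyticAt_bumpHol {z : ℂ} (h0 : z ≠ 0) (h1 : z ≠ 1) : AnalyticAt ℂ bumpHol z := by
  have : (1 - z) ^ 2 ≠ 0 := pow_ne_zero _ (sub_ne_zero.2 h1.symm)
  have h2 : z ^ 2 ≠ 0 := pow_ne_zero _ h0
  unfold bumpHol
  fun_prop (disch := assumption)

/-- Cauchy's estimate on the circle of radius `m / 8`, which stays away from both singularities. -/
theorem norm_iteratedDeriv_bumpHol_le (j : ℕ) {t m : ℝ} (hm : 0 < m) (h0 : m ≤ t)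
    (h1 : m ≤ 1 - t) (hmin : m = t ∨ m = 1 - t) :
    ‖iteratedDeriv j bumpHol t‖ ≤ j ! * Real.exp (-(1 / (4 * m ^ 2))) / (m / 8) ^ j := by
  have hne : ∀ z ∈ Metric.closedBall (t : ℂ) (m / 8), AnalyticAt ℂ bumpHol z := by
    intro z hz
    rw [Metric.mem_closedBall, dist_eq_norm] at hz
    have := (Complex.abs_re_le_norm (z - t)).trans hz
    simp only [Complex.sub_re, Complex.ofReal_re] at this
    rw [abs_le] at this
    refine analyticAt_bumpHol ?_ ?_
    · rintro rfl; simp at this; linarith [this.1]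
    · rintro rfl; simp at this; linarith [this.2]
  refine Complex.norm_iteratedDeriv_le_of_forall_mem_sphere_norm_le j (by positivity) ?_ ?_
  · refine DifferentiableOn.diffContOnCl ?_
    rw [closure_ball _ (by positivity)]
    exact fun z hz => (hne z hz).differentiableAt.differentiableWithinAt
  · intro z hz
    exact norm_bumpHol_le hm h0 h1 hmin (by rw [mem_sphere_iff_norm] at hz; exact hz.le)

/-- The derivatives of a compactly supported function of Gevrey order `3 / 2`. -/
def bump (j : ℕ) (t : ℝ) : ℝ := if 0 < t ∧ t < 1 then (iteratedDeriv j bumpHol t).re else 0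

/-- This is `x ^ j / j! ≤ exp x` at `x = 1 / (2 m²)`. The decay is quadratic in `1 / m`, so `2j`
powers of `1 / m` cost only one `j!`. Together with the `(j!)²` from the square of Cauchy's estimate
this gives `(j!)³`, that is, Gevrey order `3/2`. -/
theorem inv_pow_mul_exp_le (j : ℕ) {m : ℝ} (hm : 0 < m) :
    (m⁻¹) ^ (2 * j) * Real.exp (-(1 / (2 * m ^ 2))) ≤ 2 ^ j * j ! := by
  have h := Real.pow_div_factorial_le_exp (1 / (2 * m ^ 2)) (by positivity) j
  rw [Real.exp_neg, ← div_eq_mul_inv, div_le_iff₀ (Real.exp_pos _)]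
  rw [div_le_iff₀ (by positivity)] at h
  have e : (m⁻¹) ^ (2 * j) = 2 ^ j * (1 / (2 * m ^ 2)) ^ j := by
    rw [pow_mul, ← mul_pow]
    congr 1
    field_simp
  rw [e]
  nlinarith [pow_pos (show (0 : ℝ) < 2 by norm_num) j]

theorem bump_sq_le_min (j : ℕ) {t m : ℝ} (hm : 0 < m) (h0 : m ≤ t)
    (h1 : m ≤ 1 - t) (hmin : m = t ∨ m = 1 - t) :
    bump j t ^ 2 ≤ (j ! : ℝ) ^ 2 * 64 ^ j * ((m⁻¹) ^ (2 * j) * Real.exp (-(1 / (2 * m ^ 2)))) := by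
  have ht : 0 < t ∧ t < 1 := ⟨by linarith, by linarith⟩
  rw [bump, if_pos ht]
  have h := (Complex.abs_re_le_norm _).trans (norm_iteratedDeriv_bumpHol_le j hm h0 h1 hmin)
  rw [← sq_abs]
  calc _ ≤ (j ! * Real.exp (-(1 / (4 * m ^ 2))) / (m / 8) ^ j) ^ 2 := by gcongr
    _ = _ := by
      have : Real.exp (-(1 / (2 * m ^ 2))) = Real.exp (-(1 / (4 * m ^ 2))) ^ 2 := by
        rw [← Real.exp_nat_mul]; congr 1; push_cast; ring
      have h64 : (64 : ℝ) ^ j = (8 ^ j) ^ 2 := by rw [← pow_mul, mul_comm j 2, pow_mul]; norm_num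
      rw [this, h64, pow_mul, div_pow, div_pow, inv_pow, inv_pow, div_pow]
      field_simp
      ring

theorem exists_min {t : ℝ} (ht : 0 < t ∧ t < 1) : ∃ m, 0 < m ∧ m ≤ t ∧ m ≤ 1 - t ∧
    (m = t ∨ m = 1 - t) := by
  rcases le_total t (1 - t) with h | h
  · exact ⟨t, ht.1, le_rfl, h, Or.inl rfl⟩
  · exact ⟨1 - t, by linarith, h, le_rfl, Or.inr rfl⟩

theorem bump_sq_le (j : ℕ) (t : ℝ) : bump j t ^ 2 ≤ 128 ^ j * (j ! : ℝ) ^ 3 := by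
  by_cases ht : 0 < t ∧ t < 1
  · obtain ⟨m, hm, h0, h1, hmin⟩ := exists_min ht
    refine (bump_sq_le_min j hm h0 h1 hmin).trans ?_
    calc _ ≤ (j ! : ℝ) ^ 2 * 64 ^ j * (2 ^ j * j !) :=
          mul_le_mul_of_nonneg_left (inv_pow_mul_exp_le j hm) (by positivity)
      _ = _ := by
        rw [show (128 : ℝ) = 64 * 2 by norm_num, mul_pow]; ring
  · rw [bump, if_neg ht, zero_pow two_ne_zero]
    positivity

/-- The exponential absorbs four more powers of `1 / m` when the preceding bound is used with `j +
2`, leaving `m ^ 4` in the square. Quadratic flatness at points outside `(0, 1)` is what makes the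
extension by zero differentiable there. -/
theorem bump_le_dist_sq (j : ℕ) : ∃ C, ∀ t₀, ¬ (0 < t₀ ∧ t₀ < 1) → ∀ t,
    |bump j t| ≤ C * |t - t₀| ^ 2 := by
  set D : ℝ := (j ! : ℝ) ^ 2 * 64 ^ j * (2 ^ (j + 2) * (j + 2)!) with hD
  have hD0 : 0 ≤ D := by positivity
  refine ⟨Real.sqrt D, fun t₀ ht₀ t => ?_⟩
  by_cases ht : 0 < t ∧ t < 1
  swap
  · rw [bump, if_neg ht]; simp; positivity
  obtain ⟨m, hm, h0, h1, hmin⟩ := exists_min ht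
  have hmt : m ≤ |t - t₀| := by
    rw [not_and_or, not_lt, not_lt] at ht₀
    rcases ht₀ with h | h
    · exact (by linarith : m ≤ t - t₀).trans (le_abs_self _)
    · rw [abs_sub_comm]; exact (by linarith : m ≤ t₀ - t).trans (le_abs_self _)
  have hb : bump j t ^ 2 ≤ (Real.sqrt D * m ^ 2) ^ 2 := by
    refine (bump_sq_le_min j hm h0 h1 hmin).trans ?_
    rw [mul_pow, Real.sq_sqrt hD0, hD]
    have := inv_pow_mul_exp_le (j + 2) hm
    have e : (m⁻¹) ^ (2 * j) = (m⁻¹) ^ (2 * (j + 2)) * (m ^ 2) ^ 2 := by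
      rw [show 2 * (j + 2) = 2 * j + 4 by ring, pow_add]; field_simp
    rw [e]
    calc _ = (j ! : ℝ) ^ 2 * 64 ^ j * ((m⁻¹) ^ (2 * (j + 2)) * Real.exp (-(1 / (2 * m ^ 2))))
            * (m ^ 2) ^ 2 := by ring
      _ ≤ _ := by gcongr
  calc |bump j t| ≤ Real.sqrt D * m ^ 2 := abs_le_of_sq_le_sq hb (by positivity)
    _ ≤ _ := by gcongr

/-- Inside the interval this is the complex derivative restricted to the real line; elsewhere,
endpoints included, quadratic flatness gives derivative zero. -/
theorem hasDerivAt_bump (j : ℕ) (t : ℝ) : HasDerivAt (bump j) (bump (j + 1) t) t := by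
  by_cases ht : 0 < t ∧ t < 1
  · have hA : AnalyticAt ℂ bumpHol t := by
      refine analyticAt_bumpHol ?_ ?_
      · exact_mod_cast ht.1.ne'
      · exact_mod_cast ht.2.ne
    have hB : HasDerivAt (iteratedDeriv j bumpHol) (iteratedDeriv (j + 1) bumpHol t) (t : ℂ) := by
      rw [iteratedDeriv_succ]
      refine DifferentiableAt.hasDerivAt ?_
      rw [iteratedDeriv_eq_iterate]
      exact (hA.iterated_deriv j).differentiableAt
    have := hB.real_of_complex
    rw [show bump (j + 1) t = (iteratedDeriv (j + 1) bumpHol t).re by rw [bump, if_pos ht]]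
    refine this.congr_of_eventuallyEq ?_
    filter_upwards [Ioo_mem_nhds ht.1 ht.2] with s hs
    rw [bump, if_pos ⟨hs.1, hs.2⟩]
  · obtain ⟨C, hC⟩ := bump_le_dist_sq j
    have e0 : bump j t = 0 := by rw [bump, if_neg ht]
    rw [show bump (j + 1) t = 0 by rw [bump, if_neg ht], hasDerivAt_iff_isLittleO, e0]
    simp only [sub_zero, smul_zero]
    have h1 : (fun s => bump j s) =O[𝓝 t] (fun s => (s - t) ^ 2) := by
      refine IsBigO.of_bound C (Eventually.of_forall fun s => ?_)
      rw [Real.norm_eq_abs, Real.norm_eq_abs, abs_pow]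
      exact hC t ht s
    refine h1.trans_isLittleO ?_
    have h2 : Tendsto (fun s => s - t) (𝓝 t) (𝓝 0) := by
      have : Continuous (fun s : ℝ => s - t) := by fun_prop
      simpa using this.tendsto t
    have := (isLittleO_pow_id (n := 2) (𝕜 := ℝ) (by norm_num)).comp_tendsto h2
    exact this

theorem bump_zero_pos {t : ℝ} (ht : 0 < t ∧ t < 1) : 0 < bump 0 t := by
  rw [bump, if_pos ht, iteratedDeriv_zero, bumpHol]
  have : (-((t : ℂ) ^ 2)⁻¹ - ((1 - (t : ℂ)) ^ 2)⁻¹) =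
      ((-((t : ℝ) ^ 2)⁻¹ - ((1 - t) ^ 2)⁻¹ : ℝ) : ℂ) := by push_cast; ring
  rw [this, ← Complex.ofReal_exp, Complex.ofReal_re]
  exact Real.exp_pos _

theorem bump_zero_nonneg (t : ℝ) : 0 ≤ bump 0 t := by
  by_cases ht : 0 < t ∧ t < 1
  · exact (bump_zero_pos ht).le
  · rw [bump, if_neg ht]

end Gevrey
end ThermalLayer
end

noncomputable section

namespace ThermalLayer

open Filter Topology MeasureTheory Asymptotics

/-! ### One-sided Gevrey mollifiers in `(t, x')`. -/

section Mollifier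

open scoped Nat

variable {n : ℕ}

/-- The weights of the Gevrey class of order `3 / 2`. -/
def gev (j : ℕ) : ℝ := Real.sqrt ((j ! : ℝ) ^ 3)

theorem gev_nonneg (j : ℕ) : 0 ≤ gev j := Real.sqrt_nonneg _

/-- The coordinate functionals on the space of tangential variables `(t, x')`. -/
def coord (o : Option (Fin n)) : ℝ × Tan n →L[ℝ] ℝ :=
  match o with
  | none => ContinuousLinearMap.fst ℝ ℝ (Tan n)
  | some i => (EuclideanSpace.proj i).comp (ContinuousLinearMap.snd ℝ ℝ (Tan n))

/-- A smooth mollifier `k []` in the tangential variables together with its partial derivatives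
`k w`, supported in the future `δ`-ball and of Gevrey order `3 / 2`. -/
structure IsGevreyMollifier (δ : ℝ) (k : List (Option (Fin n)) → ℝ × Tan n → ℝ) : Prop where
  hasFDerivAt : ∀ w s, HasFDerivAt (k w) (∑ i, k (i :: w) s • coord i) s
  perm : ∀ w w', w.Perm w' → k w = k w'
  support : ∀ w s, k w s ≠ 0 → 0 ≤ s.1 ∧ ‖s‖ ≤ δ
  bound : ∃ C A : ℝ, 0 ≤ C ∧ 0 ≤ A ∧ ∀ w s, |k w s| ≤ C * A ^ w.length * gev w.length
  nonneg : ∀ s, 0 ≤ k [] s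
  integral_eq_one : ∫ s, k [] s = 1

/-- The rescaled one-dimensional bump. -/
def bumpScaled (ε : ℝ) (j : ℕ) (t : ℝ) : ℝ := ε⁻¹ ^ j * bump j (ε⁻¹ * t)

theorem hasDerivAt_bumpScaled (ε : ℝ) (j : ℕ) (t : ℝ) :
    HasDerivAt (bumpScaled ε j) (bumpScaled ε (j + 1) t) t := by
  have h1 : HasDerivAt (fun t : ℝ => ε⁻¹ * t) ε⁻¹ t := by
    simpa using (hasDerivAt_id t).const_mul ε⁻¹
  have := ((hasDerivAt_bump j (ε⁻¹ * t)).comp t h1).const_mul (ε⁻¹ ^ j)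
  refine this.congr_deriv ?_
  rw [bumpScaled, pow_succ]; ring

theorem bumpScaled_ne_zero {ε : ℝ} (hε : 0 < ε) {j : ℕ} {t : ℝ} (h : bumpScaled ε j t ≠ 0) :
    0 < t ∧ t < ε := by
  by_contra hc
  refine h ?_
  rw [bumpScaled, bump, if_neg, mul_zero]
  rintro ⟨h1, h2⟩
  refine hc ⟨?_, ?_⟩
  · exact (mul_pos_iff_of_pos_left (inv_pos.2 hε)).1 h1
  · rwa [inv_mul_lt_iff₀ hε, mul_one] at h2

/-- The product kernel. -/
def kernel (ε : ℝ) (w : List (Option (Fin n))) (s : ℝ × Tan n) : ℝ :=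
  ∏ o, bumpScaled ε (w.count o) (coord o s)

theorem hasFDerivAt_kernel (ε : ℝ) (w : List (Option (Fin n))) (s : ℝ × Tan n) :
    HasFDerivAt (kernel ε w) (∑ i, kernel ε (i :: w) s • coord i) s := by
  have h : ∀ o ∈ (Finset.univ : Finset (Option (Fin n))),
      HasFDerivAt (fun s => bumpScaled ε (w.count o) (coord o s))
        (bumpScaled ε (w.count o + 1) (coord o s) • (coord o : ℝ × Tan n →L[ℝ] ℝ)) s := by
    intro o _
    exact (hasDerivAt_bumpScaled ε (w.count o) (coord o s)).comp_hasFDerivAt s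
      (coord o : ℝ × Tan n →L[ℝ] ℝ).hasFDerivAt
  have h2 := HasFDerivAt.finsetProd h
  refine h2.congr_fderiv ?_
  refine Finset.sum_congr rfl fun i _ => ?_
  rw [smul_smul]
  congr 1
  rw [kernel, ← Finset.prod_erase_mul _ _ (Finset.mem_univ i)]
  congr 1
  · refine Finset.prod_congr rfl fun o ho => ?_
    rw [List.count_cons_of_ne (Finset.ne_of_mem_erase ho).symm]
  · rw [List.count_cons_self]

theorem sum_count_eq_length (w : List (Option (Fin n))) : ∑ o, w.count o = w.length := by
  induction w with
  | nil => simp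
  | cons i w ih =>
    rw [List.length_cons, ← ih]
    simp [List.count_cons, Finset.sum_add_distrib]

/-- The orders of the one-dimensional derivatives are the letter counts of `w`, and the product of
their factorials divides the factorial of the length. The constant `12` comes from `128 ≤ 12²`. -/
theorem kernel_sq_le {ε : ℝ} (hε : 0 < ε) (w : List (Option (Fin n))) (s : ℝ × Tan n) :
    kernel ε w s ^ 2 ≤ ((12 * ε⁻¹) ^ w.length) ^ 2 * (w.length ! : ℝ) ^ 3 := by
  rw [kernel, ← Finset.prod_pow]
  have h1 : ∀ o ∈ (Finset.univ : Finset (Option (Fin n))),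
      bumpScaled ε (w.count o) (coord o s) ^ 2 ≤
        ((12 * ε⁻¹) ^ w.count o) ^ 2 * ((w.count o)! : ℝ) ^ 3 := by
    intro o _
    rw [bumpScaled, mul_pow]
    calc _ ≤ (ε⁻¹ ^ w.count o) ^ 2 * (128 ^ w.count o * ((w.count o)! : ℝ) ^ 3) := by
          gcongr; exact bump_sq_le _ _
      _ ≤ (ε⁻¹ ^ w.count o) ^ 2 * ((12 ^ w.count o) ^ 2 * ((w.count o)! : ℝ) ^ 3) := by
          gcongr
          rw [← pow_mul, mul_comm, pow_mul]
          gcongr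
          norm_num
      _ = _ := by rw [mul_pow]; ring
  refine (Finset.prod_le_prod (fun o _ => sq_nonneg _) h1).trans ?_
  rw [Finset.prod_mul_distrib, Finset.prod_pow, Finset.prod_pow, Finset.prod_pow_eq_pow_sum,
    sum_count_eq_length]
  gcongr
  have := Nat.le_of_dvd (Nat.factorial_pos _)
    (Nat.prod_factorial_dvd_factorial_sum (Finset.univ : Finset (Option (Fin n))) (fun o => w.count o))
  rw [sum_count_eq_length] at this
  exact_mod_cast this

theorem kernel_ne_zero {ε : ℝ} (hε : 0 < ε) {w : List (Option (Fin n))} {s : ℝ × Tan n}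
    (h : kernel ε w s ≠ 0) (o : Option (Fin n)) : 0 < coord o s ∧ coord o s < ε := by
  rw [kernel, Finset.prod_ne_zero_iff] at h
  exact bumpScaled_ne_zero hε (h o (Finset.mem_univ o))

/-- The bump lives on `(0, 1)` and not on a symmetric interval. Hence the kernel is supported at
positive times, and mollification preserves vanishing in the past. -/
theorem exists_gevreyMollifier {δ : ℝ} (hδ : 0 < δ) :
    ∃ k : List (Option (Fin n)) → ℝ × Tan n → ℝ, IsGevreyMollifier δ k := by
  -- Each coordinate lies in `(0, ε)` on the support, and the Euclidean norm of `x'` is at most the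
  -- sum of its `n` coordinates.
  obtain ⟨ε, hε, hεδ⟩ : ∃ ε : ℝ, 0 < ε ∧ ε * (n + 1) ≤ δ :=
    ⟨δ / (n + 1), by positivity, le_of_eq (by field_simp)⟩
  have hsupp : ∀ (w : List (Option (Fin n))) s, kernel ε w s ≠ 0 → 0 ≤ s.1 ∧ ‖s‖ ≤ δ := by
    intro w s h
    have h0 := kernel_ne_zero hε h none
    have hi := fun i => kernel_ne_zero hε h (some i)
    replace h0 : 0 < s.1 ∧ s.1 < ε := h0
    refine ⟨h0.1.le, ?_⟩
    rw [Prod.norm_def]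
    refine max_le ?_ ?_
    · rw [Real.norm_of_nonneg h0.1.le]
      nlinarith [(Nat.cast_nonneg n : (0 : ℝ) ≤ n)]
    · have hsum : ‖s.2‖ ≤ ∑ i, ‖s.2 i‖ := by
        conv_lhs => rw [← (EuclideanSpace.basisFun (Fin n) ℝ).sum_repr s.2]
        refine (norm_sum_le _ _).trans (Finset.sum_le_sum fun i _ => ?_)
        rw [norm_smul]
        simp
      refine hsum.trans ?_
      calc ∑ i, ‖s.2 i‖ ≤ ∑ _i : Fin n, ε := by
            refine Finset.sum_le_sum fun i _ => ?_
            have hsi : 0 < s.2 i ∧ s.2 i < ε := hi i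
            rw [Real.norm_of_nonneg hsi.1.le]
            exact hsi.2.le
        _ = n * ε := by simp
        _ ≤ δ := by nlinarith
  have hnn : ∀ s : ℝ × Tan n, 0 ≤ kernel ε [] s := fun s =>
    Finset.prod_nonneg fun o _ => by
      simp only [List.count_nil, bumpScaled, pow_zero, one_mul]; exact bump_zero_nonneg _
  have hcont : ∀ w : List (Option (Fin n)), Continuous (kernel ε w) := fun w =>
    continuous_iff_continuousAt.2 fun s => (hasFDerivAt_kernel ε w s).continuousAt
  have hcs : HasCompactSupport (kernel ε ([] : List (Option (Fin n)))) := by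
    refine HasCompactSupport.intro (isCompact_closedBall (0 : ℝ × Tan n) δ) fun s hs => ?_
    by_contra h
    exact hs (mem_closedBall_zero_iff.2 (hsupp _ _ h).2)
  have hpos : 0 < ∫ s : ℝ × Tan n, kernel ε [] s := by
    -- At the point with all coordinates `ε / 2` every factor is the bump at `1 / 2`, which is
    -- positive.
    refine (hcont []).integral_pos_of_hasCompactSupport_nonneg_nonzero hcs hnn
      (x := (ε / 2, WithLp.toLp 2 fun _ => ε / 2)) ?_
    rw [kernel, Finset.prod_ne_zero_iff]
    intro o _
    have hc : coord o ((ε / 2, WithLp.toLp 2 fun _ => ε / 2) : ℝ × Tan n) = ε / 2 := by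
      cases o <;> simp [coord]
    rw [hc]
    simp only [List.count_nil, bumpScaled, pow_zero, one_mul]
    refine (bump_zero_pos ?_).ne'
    have : ε⁻¹ * (ε / 2) = 1 / 2 := by field_simp
    rw [this]; norm_num
  set I := ∫ s : ℝ × Tan n, kernel ε [] s with hI
  refine ⟨fun w s => I⁻¹ * kernel ε w s, ?_, ?_, ?_, ?_, ?_, ?_⟩
  · intro w s
    refine ((hasFDerivAt_kernel ε w s).const_mul I⁻¹).congr_fderiv ?_
    rw [Finset.smul_sum]
    exact Finset.sum_congr rfl fun i _ => by rw [smul_smul]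
  · intro w w' h
    funext s
    simp only [kernel, h.count_eq]
  · intro w s h
    exact hsupp w s (right_ne_zero_of_mul h)
  · refine ⟨I⁻¹, 12 * ε⁻¹, by positivity, by positivity, fun w s => ?_⟩
    rw [abs_mul, abs_of_pos (inv_pos.2 hpos), mul_assoc]
    gcongr
    refine abs_le_of_sq_le_sq ?_ (mul_nonneg (by positivity) (gev_nonneg _))
    rw [mul_pow, gev, Real.sq_sqrt (by positivity)]
    exact kernel_sq_le hε w s
  · intro s
    exact mul_nonneg (inv_pos.2 hpos).le (hnn s)
  · rw [integral_const_mul]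
    exact inv_mul_cancel₀ hpos.ne'

/-- Since `(2j)! ≥ (j!)²`, the terms are at most `x ^ j / √(j!)`. This is the point where Gevrey
order below `2` is needed. -/
theorem summable_pow_div_sqrt_factorial {x : ℝ} (hx : 0 ≤ x) :
    Summable (fun j : ℕ => x ^ j * gev j / (2 * j)!) := by
  have h1 : Summable (fun j : ℕ => ((2 * x ^ 2) ^ j / j ! + (1 / 2) ^ j) / 2) :=
    ((Real.summable_pow_div_factorial (2 * x ^ 2)).add
      (summable_geometric_of_lt_one (by norm_num) (by norm_num))).div_const 2
  refine Summable.of_nonneg_of_le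
    (fun j => div_nonneg (mul_nonneg (by positivity) (gev_nonneg j)) (by positivity))
    (fun j => ?_) h1
  have hf : (0 : ℝ) < j ! := by positivity
  have hfac : (j ! : ℝ) ^ 2 ≤ (2 * j)! := by
    have := Nat.le_of_dvd (Nat.factorial_pos _) (Nat.factorial_mul_factorial_dvd_factorial_add j j)
    rw [← two_mul] at this
    rw [pow_two]
    exact_mod_cast this
  have h2 : x ^ j * gev j / (2 * j)! ≤ x ^ j * gev j / (j ! : ℝ) ^ 2 :=
    div_le_div_of_nonneg_left (mul_nonneg (by positivity) (gev_nonneg j)) (by positivity) hfac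
  refine h2.trans ?_
  have hg : gev j / (j ! : ℝ) ^ 2 = Real.sqrt (1 / j !) := by
    rw [eq_comm, Real.sqrt_eq_iff_mul_self_eq (by positivity)
      (div_nonneg (gev_nonneg j) (by positivity)), div_mul_div_comm, gev,
      Real.mul_self_sqrt (by positivity)]
    field_simp
  rw [mul_div_assoc, hg]
  -- The square root is split so that the arithmetic-geometric mean inequality compares with an
  -- exponential and a geometric series.
  have e1 : x ^ j * Real.sqrt (1 / j !) = Real.sqrt ((2 * x ^ 2) ^ j / j !) * Real.sqrt ((1 / 2) ^ j) := by
    rw [← Real.sqrt_mul (by positivity), ← Real.sqrt_sq (show 0 ≤ x ^ j by positivity),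
      ← Real.sqrt_mul (by positivity)]
    congr 1
    rw [mul_pow, ← pow_mul, ← pow_mul, mul_comm j 2]
    rw [show (1 / 2 : ℝ) ^ j = ((2 : ℝ) ^ j)⁻¹ by rw [one_div, inv_pow]]
    field_simp
  rw [e1]
  have s1 := Real.sq_sqrt (show 0 ≤ (2 * x ^ 2) ^ j / (j ! : ℝ) by positivity)
  have s2 := Real.sq_sqrt (show 0 ≤ (1 / 2 : ℝ) ^ j by positivity)
  nlinarith [sq_nonneg (Real.sqrt ((2 * x ^ 2) ^ j / j !) - Real.sqrt ((1 / 2) ^ j))]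

end Mollifier
end ThermalLayer
end

noncomputable section

namespace ThermalLayer

open Filter Topology MeasureTheory Asymptotics

/-! ### Coefficient functions of the sideways Cauchy problem. -/

section Sideways

open scoped Nat

theorem abs_integral_le_monomial_of_nonneg {f : ℝ → ℝ} {c y : ℝ} {k : ℕ} (hy : 0 ≤ y)
    (hi : IntervalIntegrable f volume 0 y)
    (hb : ∀ z ∈ Icc 0 y, |f z| ≤ c * (z ^ k / k !)) :
    |∫ z in (0 : ℝ)..y, f z| ≤ c * (y ^ (k + 1) / (k + 1)!) := by
  have h1 : |∫ z in (0 : ℝ)..y, f z| ≤ ∫ z in (0 : ℝ)..y, c * (z ^ k / k !) := by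
    refine (intervalIntegral.abs_integral_le_integral_abs hy).trans ?_
    refine intervalIntegral.integral_mono_on hy hi.abs ?_ hb
    exact Continuous.intervalIntegrable (by fun_prop) _ _
  refine h1.trans (le_of_eq ?_)
  rw [intervalIntegral.integral_const_mul, intervalIntegral.integral_div, integral_pow,
    Nat.factorial_succ]
  have : (k ! : ℝ) ≠ 0 := by positivity
  have : (k : ℝ) + 1 ≠ 0 := by positivity
  push_cast
  simp only [ne_eq, Nat.add_eq_zero_iff, one_ne_zero, and_false, not_false_eq_true, zero_pow,
    sub_zero]
  field_simp

theorem abs_integral_le_monomial {f : ℝ → ℝ} (hf : Continuous f) {c L : ℝ} {k : ℕ}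
    (hb : ∀ z, |z| ≤ L → |f z| ≤ c * (|z| ^ k / k !)) {y : ℝ} (hy : |y| ≤ L) :
    |∫ z in (0 : ℝ)..y, f z| ≤ c * (|y| ^ (k + 1) / (k + 1)!) := by
  rcases le_total 0 y with h | h
  · rw [abs_of_nonneg h] at hy ⊢
    refine abs_integral_le_monomial_of_nonneg h (hf.intervalIntegrable _ _) fun z hz => ?_
    have := hb z (by rw [abs_of_nonneg hz.1]; linarith [hz.2])
    rwa [abs_of_nonneg hz.1] at this
  · have e : ∫ z in (0 : ℝ)..y, f z = -∫ z in (0 : ℝ)..(-y), f (-z) := by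
      rw [intervalIntegral.integral_comp_neg, neg_neg, neg_zero, intervalIntegral.integral_symm]
    rw [abs_of_nonpos h] at hy ⊢
    rw [e, abs_neg]
    refine abs_integral_le_monomial_of_nonneg (by linarith)
      ((hf.comp continuous_neg).intervalIntegrable _ _) fun z hz => ?_
    have := hb (-z) (by rw [abs_neg, abs_of_nonneg hz.1]; linarith [hz.2])
    rwa [abs_neg, abs_of_nonneg hz.1] at this

/-- From `(i + j)! ≤ 2 ^ (i + j) i! j!`, raised to the power `3/2`, with `2 ^ (3/2) ≤ 4`. -/
theorem gev_add_le (i j : ℕ) : gev (i + j) ≤ 4 ^ (i + j) * gev i * gev j := by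
  have h1 : ((i + j)! : ℝ) ≤ 2 ^ (i + j) * (i ! * j !) := by
    have h := Nat.add_choose_mul_factorial_mul_factorial i j
    have hc : (i + j).choose j ≤ 2 ^ (i + j) := Nat.choose_le_two_pow _ _
    have : (i + j)! ≤ 2 ^ (i + j) * (i ! * j !) := by
      rw [← h, mul_assoc]
      exact Nat.mul_le_mul_right _ hc
    exact_mod_cast this
  have h2 : ((i + j)! : ℝ) ^ 3 ≤ (4 ^ (i + j)) ^ 2 * ((i ! : ℝ) ^ 3 * (j ! : ℝ) ^ 3) := by
    calc ((i + j)! : ℝ) ^ 3 ≤ (2 ^ (i + j) * (i ! * j !)) ^ 3 := by gcongr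
      _ = (8 : ℝ) ^ (i + j) * ((i ! : ℝ) ^ 3 * (j ! : ℝ) ^ 3) := by
        rw [mul_pow, mul_pow, ← pow_mul, mul_comm (i + j) 3, pow_mul]; norm_num
      _ ≤ (16 : ℝ) ^ (i + j) * ((i ! : ℝ) ^ 3 * (j ! : ℝ) ^ 3) := by gcongr; norm_num
      _ = _ := by rw [← pow_mul, mul_comm (i + j) 2, pow_mul]; norm_num
  rw [gev]
  refine (Real.sqrt_le_sqrt h2).trans (le_of_eq ?_)
  rw [Real.sqrt_mul (by positivity), Real.sqrt_sq (by positivity), Real.sqrt_mul (by positivity),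
    gev, gev, mul_assoc]

variable {ι : Type*}

/-- There are `(card ι) ^ j` words of length `j`. -/
theorem summable_list_length [Fintype ι] {f : ℕ → ℝ} (hf : ∀ j, 0 ≤ f j)
    (hs : Summable (fun j => (Fintype.card ι : ℝ) ^ j * f j)) :
    Summable (fun w : List ι => f w.length) := by
  rw [← (List.equivSigmaTuple (α := ι)).symm.summable_iff]
  have e : ((fun w : List ι => f w.length) ∘ (List.equivSigmaTuple (α := ι)).symm) =
      fun p => f p.1 := by
    funext p
    simp [List.equivSigmaTuple]
  rw [e, summable_sigma_of_nonneg fun p => hf p.1]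
  refine ⟨fun j => Summable.of_finite, ?_⟩
  refine hs.congr fun j => ?_
  rw [tsum_fintype]
  simp

/-- Every nonempty word is uniquely a first letter followed by a word; this turns the second
derivative of the series back into series of the same kind. -/
theorem tsum_list_cons [Fintype ι] {F : List ι → ℝ} (h0 : F [] = 0)
    (hs : Summable F) : ∑' w, F w = ∑ i, ∑' w, F (i :: w) := by
  have hinj : Function.Injective (fun q : ι × List ι => q.1 :: q.2) := by
    rintro ⟨a, b⟩ ⟨c, d⟩ h
    simpa using h
  have h1 : ∑' q : ι × List ι, F (q.1 :: q.2) = ∑' w, F w := by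
    refine hinj.tsum_eq (f := F) ?_
    intro w hw
    cases w with
    | nil => exact absurd h0 hw
    | cons i w => exact ⟨(i, w), rfl⟩
  have h2 : Summable (fun q : ι × List ι => F (q.1 :: q.2)) := hs.comp_injective hinj
  rw [← h1, h2.tsum_prod, tsum_fintype]

/-- The coefficient functions of the solution of the sideways Cauchy problem. -/
def sidePoly (V : ι → ℝ → ℝ) : List ι → ℝ → ℝ
  | [], y => y
  | i :: w, y => ∫ z in (0 : ℝ)..y, ∫ ζ in (0 : ℝ)..z, V i ζ * sidePoly V w ζ

/-- The first derivatives of `sidePoly`. -/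
def sidePolyD (V : ι → ℝ → ℝ) : List ι → ℝ → ℝ
  | [], _ => 1
  | i :: w, z => ∫ ζ in (0 : ℝ)..z, V i ζ * sidePoly V w ζ

/-- The second derivatives of `sidePoly`. -/
def sidePolyDD (V : ι → ℝ → ℝ) : List ι → ℝ → ℝ
  | [], _ => 0
  | i :: w, z => V i z * sidePoly V w z

variable {V : ι → ℝ → ℝ}

theorem continuous_sidePoly_aux (hV : ∀ i, Continuous (V i)) (w : List ι) :
    Continuous (sidePoly V w) ∧ Continuous (sidePolyD V w) := by
  have prim : ∀ f : ℝ → ℝ, Continuous f → Continuous (fun y => ∫ z in (0 : ℝ)..y, f z) :=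
    fun f hf => continuous_iff_continuousAt.2 fun y =>
      (hf.integral_hasStrictDerivAt 0 y).hasDerivAt.continuousAt
  induction w with
  | nil => exact ⟨continuous_id, continuous_const⟩
  | cons i w ih =>
    have h := prim _ ((hV i).mul ih.1)
    exact ⟨prim _ h, h⟩

theorem hasDerivAt_sidePoly (hV : ∀ i, Continuous (V i)) (w : List ι) (y : ℝ) :
    HasDerivAt (sidePoly V w) (sidePolyD V w y) y := by
  cases w with
  | nil => exact hasDerivAt_id y
  | cons i w =>
    exact ((continuous_sidePoly_aux hV (i :: w)).2.integral_hasStrictDerivAt 0 y).hasDerivAt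

theorem hasDerivAt_sidePolyD (hV : ∀ i, Continuous (V i)) (w : List ι) (y : ℝ) :
    HasDerivAt (sidePolyD V w) (sidePolyDD V w y) y := by
  cases w with
  | nil => exact hasDerivAt_const y 1
  | cons i w =>
    exact (((hV i).mul (continuous_sidePoly_aux hV w).1).integral_hasStrictDerivAt 0 y).hasDerivAt

theorem sidePoly_zero (w : List ι) : sidePoly V w 0 = 0 := by
  cases w <;> simp [sidePoly]

theorem sidePolyD_zero (i : ι) (w : List ι) : sidePolyD V (i :: w) 0 = 0 := by
  simp [sidePolyD]

variable {M L : ℝ}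

/-- Each letter contributes a factor bounded by `M` and two integrations from `0`, starting from the
function `y`. -/
theorem abs_sidePoly_le (hV : ∀ i, Continuous (V i)) (hM : 0 ≤ M)
    (hVM : ∀ i z, |z| ≤ L → |V i z| ≤ M) (w : List ι) {y : ℝ} (hy : |y| ≤ L) :
    |sidePoly V w y| ≤ M ^ w.length * (|y| ^ (2 * w.length + 1) / (2 * w.length + 1)!) := by
  induction w generalizing y with
  | nil => simp [sidePoly]
  | cons i w ih =>
    have h1 : ∀ z, |z| ≤ L → |V i z * sidePoly V w z| ≤
        M ^ (w.length + 1) * (|z| ^ (2 * w.length + 1) / (2 * w.length + 1)!) := by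
      intro z hz
      rw [abs_mul, pow_succ', mul_assoc]
      exact mul_le_mul (hVM i z hz) (ih hz) (abs_nonneg _) hM
    have h2 : ∀ z, |z| ≤ L → |∫ ζ in (0 : ℝ)..z, V i ζ * sidePoly V w ζ| ≤
        M ^ (w.length + 1) * (|z| ^ (2 * w.length + 1 + 1) / (2 * w.length + 1 + 1)!) :=
      fun z hz => abs_integral_le_monomial ((hV i).mul (continuous_sidePoly_aux hV w).1) h1 hz
    exact abs_integral_le_monomial (continuous_sidePoly_aux hV (i :: w)).2 h2 hy

/-- A single bound for the functions and their first two derivatives, so that one majorant serves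
all termwise differentiations. `1 + L²` dominates both `|y|` and `|y|²`, and the spare factor `4 ^
w.length` pays for raising the factorial in the second derivative to `(2 * w.length)!`. -/
theorem sidePoly_bounds (hV : ∀ i, Continuous (V i)) (hM : 0 ≤ M)
    (hVM : ∀ i z, |z| ≤ L → |V i z| ≤ M) (w : List ι) {y : ℝ} (hy : |y| ≤ L) :
    |sidePoly V w y| ≤ (1 + L ^ 2) * ((4 * M * (1 + L ^ 2)) ^ w.length / (2 * w.length)!) ∧
    |sidePolyD V w y| ≤ (1 + L ^ 2) * ((4 * M * (1 + L ^ 2)) ^ w.length / (2 * w.length)!) ∧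
    |sidePolyDD V w y| ≤ (1 + L ^ 2) * ((4 * M * (1 + L ^ 2)) ^ w.length / (2 * w.length)!) := by
  have hB1 : 1 ≤ 1 + L ^ 2 := by nlinarith [sq_nonneg L]
  have hyB : |y| ≤ 1 + L ^ 2 := by nlinarith [sq_nonneg (L - 1), abs_nonneg y]
  have hy2B : |y| ^ 2 ≤ 1 + L ^ 2 := by
    have : |y| ^ 2 ≤ L ^ 2 := by gcongr
    linarith
  set B := 1 + L ^ 2 with hB
  have even : ∀ j : ℕ, |y| ^ (2 * j) ≤ B ^ j := fun j => by rw [pow_mul]; gcongr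
  have odd : ∀ j : ℕ, |y| ^ (2 * j + 1) ≤ B * B ^ j := fun j => by
    rw [pow_succ, mul_comm]; gcongr; exact even j
  have four : ∀ j : ℕ, (1 : ℝ) ≤ 4 ^ j := fun j => one_le_pow₀ (by norm_num)
  have E : ∀ j : ℕ, B * ((4 * M * B) ^ j / (2 * j)!) = M ^ j * (4 ^ j * (B * B ^ j) / (2 * j)!) := by
    intro j; rw [mul_pow, mul_pow]; ring
  refine ⟨?_, ?_, ?_⟩
  · refine (abs_sidePoly_le hV hM hVM w hy).trans ?_
    rw [E]
    gcongr ?_ * ?_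
    have hfac : ((2 * w.length)! : ℝ) ≤ (2 * w.length + 1)! := by
      exact_mod_cast Nat.factorial_le (Nat.le_succ _)
    refine div_le_div₀ (by positivity) ?_ (by positivity) hfac
    calc _ ≤ B * B ^ w.length := odd _
      _ ≤ _ := le_mul_of_one_le_left (by positivity) (four _)
  · rw [E]
    cases w with
    | nil => simp [sidePolyD]; exact hB1
    | cons i w =>
      have h1 : ∀ z, |z| ≤ L → |V i z * sidePoly V w z| ≤
          M ^ (w.length + 1) * (|z| ^ (2 * w.length + 1) / (2 * w.length + 1)!) := by
        intro z hz
        rw [abs_mul, pow_succ', mul_assoc]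
        exact mul_le_mul (hVM i z hz) (abs_sidePoly_le hV hM hVM w hz) (abs_nonneg _) hM
      refine (abs_integral_le_monomial ((hV i).mul (continuous_sidePoly_aux hV w).1) h1 hy).trans ?_
      rw [List.length_cons, show 2 * w.length + 1 + 1 = 2 * (w.length + 1) by ring]
      gcongr ?_ * (?_ / ?_)
      calc _ ≤ B ^ (w.length + 1) := even _
        _ ≤ B * B ^ (w.length + 1) := le_mul_of_one_le_left (by positivity) hB1
        _ ≤ _ := le_mul_of_one_le_left (by positivity) (four _)
  · rw [E]
    cases w with
    | nil => simp [sidePolyDD]; positivity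
    | cons i w =>
      have h1 : |V i y * sidePoly V w y| ≤
          M ^ (w.length + 1) * (|y| ^ (2 * w.length + 1) / (2 * w.length + 1)!) := by
        rw [abs_mul, pow_succ', mul_assoc]
        exact mul_le_mul (hVM i y hy) (abs_sidePoly_le hV hM hVM w hy) (abs_nonneg _) hM
      refine h1.trans ?_
      rw [List.length_cons]
      gcongr ?_ * ?_
      -- With `j = w.length`: `(2j + 2)! = (2j + 2) (2j + 1)!`, and `2j + 2 ≤ 4 ^ (j + 1)`.
      have hf : ((2 * (w.length + 1))! : ℝ) ≤ 4 ^ (w.length + 1) * (2 * w.length + 1)! := by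
        rw [show 2 * (w.length + 1) = (2 * w.length + 1) + 1 by ring, Nat.factorial_succ]
        push_cast
        gcongr
        have : (w.length : ℕ) < 2 ^ w.length := Nat.lt_two_pow_self
        have h3 : 2 * w.length + 1 + 1 ≤ 4 ^ (w.length + 1) := by
          calc 2 * w.length + 1 + 1 ≤ 4 * 2 ^ w.length := by omega
            _ ≤ 4 * 4 ^ w.length := by gcongr; norm_num
            _ = _ := by ring
        exact_mod_cast h3
      rw [div_le_div_iff₀ (by positivity) (by positivity)]
      have ho := odd w.length
      calc |y| ^ (2 * w.length + 1) * ((2 * (w.length + 1))! : ℝ)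
          ≤ (B * B ^ (w.length + 1)) * (4 ^ (w.length + 1) * (2 * w.length + 1)!) := by
            gcongr
            refine ho.trans ?_
            gcongr
            omega
        _ = _ := by ring

end Sideways
end ThermalLayer
end

noncomputable section

namespace ThermalLayer

open Filter Topology MeasureTheory Asymptotics

/-! ### Convergence, differentiation and uniqueness for the sideways problem. -/

section SidewaysSum

open scoped Nat

variable {ι : Type*}

/-- Growth of a family indexed by words as for the derivatives of a Gevrey function. -/
def IsGev (C A : ℝ) (g : List ι → ℝ) : Prop := ∀ w, |g w| ≤ C * A ^ w.length * gev w.length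

/-- Derivatives of a Gevrey family form Gevrey families again, with `A` replaced by `4 A`
independently of the order of differentiation; only the prefactor depends on `u`. -/
theorem IsGev.append {C A : ℝ} {g : List ι → ℝ} (hC : 0 ≤ C) (hA : 0 ≤ A) (hg : IsGev C A g)
    (u : List ι) :
    IsGev (C * (4 * A) ^ u.length * gev u.length) (4 * A) (fun w => g (w ++ u)) := by
  intro w
  refine (hg (w ++ u)).trans ?_
  rw [List.length_append]
  calc C * A ^ (w.length + u.length) * gev (w.length + u.length)
      ≤ C * A ^ (w.length + u.length) *
        (4 ^ (w.length + u.length) * gev w.length * gev u.length) := by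
        gcongr; exact gev_add_le _ _
    _ = _ := by rw [mul_pow, mul_pow, pow_add, pow_add]; ring

theorem IsGev.cons {C A : ℝ} {g : List ι → ℝ} (hC : 0 ≤ C) (hA : 0 ≤ A) (hg : IsGev C A g)
    (i : ι) : IsGev (C * (4 * A) * gev 1) (4 * A) (fun w => g (i :: w)) := by
  intro w
  refine (hg (i :: w)).trans ?_
  rw [List.length_cons]
  calc C * A ^ (w.length + 1) * gev (w.length + 1)
      ≤ C * A ^ (w.length + 1) * (4 ^ (w.length + 1) * gev w.length * gev 1) := by
        gcongr; exact gev_add_le _ _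
    _ = _ := by rw [mul_pow, pow_succ, pow_succ]; ring

/-- Solution of the sideways Cauchy problem with Cauchy data `0` and `g []`, where `g w` are
the partial derivatives. -/
def sideSum (V : ι → ℝ → ℝ) (g : List ι → ℝ) (y : ℝ) : ℝ := ∑' w, sidePoly V w y * g w

/-- The derivative of `sideSum`. -/
def sideSumD (V : ι → ℝ → ℝ) (g : List ι → ℝ) (y : ℝ) : ℝ := ∑' w, sidePolyD V w y * g w

/-- A summable majorant for the terms of `sideSum` and of its derivatives. -/
def sideMajorant (L M C A : ℝ) (w : List ι) : ℝ :=
  (1 + L ^ 2) * C * ((4 * M * (1 + L ^ 2) * A) ^ w.length * gev w.length / (2 * w.length)!)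

theorem summable_sideMajorant [Fintype ι] (L : ℝ) {M C A : ℝ} (hM : 0 ≤ M) (hA : 0 ≤ A) :
    Summable (sideMajorant (ι := ι) L M C A) := by
  refine Summable.mul_left _ ?_
  have hX : 0 ≤ 4 * M * (1 + L ^ 2) * A := by positivity
  refine summable_list_length (ι := ι)
    (f := fun j => (4 * M * (1 + L ^ 2) * A) ^ j * gev j / (2 * j)!)
    (fun j => div_nonneg (mul_nonneg (by positivity) (gev_nonneg _)) (by positivity)) ?_
  refine (summable_pow_div_sqrt_factorial (x := Fintype.card ι * (4 * M * (1 + L ^ 2) * A))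
    (by positivity)).congr fun j => ?_
  rw [mul_pow]; ring

variable {V : ι → ℝ → ℝ}

theorem exists_bound_coeff [Fintype ι] (hV : ∀ i, Continuous (V i)) (L : ℝ) :
    ∃ M, 0 ≤ M ∧ ∀ i z, |z| ≤ L → |V i z| ≤ M := by
  have h : ∀ i, ∃ M, 0 ≤ M ∧ ∀ z, |z| ≤ L → |V i z| ≤ M := by
    intro i
    obtain ⟨M, hM⟩ := (isCompact_Icc (a := -L) (b := L)).exists_bound_of_continuousOn
      (hV i).continuousOn
    exact ⟨max M 0, le_max_right _ _, fun z hz => (hM z (abs_le.1 hz)).trans (le_max_left _ _)⟩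
  choose M hM0 hM using h
  exact ⟨∑ i, M i, Finset.sum_nonneg fun i _ => hM0 i, fun i z hz => (hM i z hz).trans
    (Finset.single_le_sum (f := M) (fun i _ => hM0 i) (Finset.mem_univ i))⟩

theorem term_le_majorant {L M C A : ℝ} {a : ℝ} {g : List ι → ℝ} (hg : IsGev C A g) (w : List ι)
    (hM : 0 ≤ M)
    (ha : |a| ≤ (1 + L ^ 2) * ((4 * M * (1 + L ^ 2)) ^ w.length / (2 * w.length)!)) :
    ‖a * g w‖ ≤ sideMajorant L M C A w := by
  rw [Real.norm_eq_abs, abs_mul]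
  calc |a| * |g w| ≤ ((1 + L ^ 2) * ((4 * M * (1 + L ^ 2)) ^ w.length / (2 * w.length)!)) *
        (C * A ^ w.length * gev w.length) :=
        mul_le_mul ha (hg w) (abs_nonneg _) (by positivity)
    _ = _ := by rw [sideMajorant, mul_pow _ A]; ring

theorem hasDerivAt_sideSum [Fintype ι] (hV : ∀ i, Continuous (V i)) {C A : ℝ} (hA : 0 ≤ A) {g : List ι → ℝ}
    (hg : IsGev C A g) (y : ℝ) : HasDerivAt (sideSum V g) (sideSumD V g y) y := by
  obtain ⟨M, hM, hVM⟩ := exists_bound_coeff hV (|y| + 1)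
  refine hasDerivAt_tsum_of_isPreconnected (t := Ioo (-(|y| + 1)) (|y| + 1)) (y₀ := 0)
    (summable_sideMajorant (ι := ι) (|y| + 1) (C := C) hM hA) isOpen_Ioo isPreconnected_Ioo
    (fun w z _ => (hasDerivAt_sidePoly hV w z).mul_const (g w)) ?_ ?_ ?_ ?_
  · intro w z hz
    exact term_le_majorant hg w hM (sidePoly_bounds hV hM hVM w (abs_lt.2 hz).le).2.1
  · constructor <;> linarith [abs_nonneg y]
  · simp [sidePoly_zero, summable_zero]
  · exact abs_lt.1 (by linarith [abs_nonneg y])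

/-- The second derivative of a term undoes both integrations and leaves `V i` times the term of the
shorter word. Summation over the first letter gives `∂_y² v = ∑ V i ∂_i v`, where `∂_i` acts on the
Cauchy data. -/
theorem hasDerivAt_sideSumD [Fintype ι] (hV : ∀ i, Continuous (V i)) {C A : ℝ} (hA : 0 ≤ A)
    {g : List ι → ℝ} (hg : IsGev C A g) (y : ℝ) :
    HasDerivAt (sideSumD V g) (∑ i, V i y * sideSum V (fun w => g (i :: w)) y) y := by
  obtain ⟨M, hM, hVM⟩ := exists_bound_coeff hV (|y| + 1)
  have hs := summable_sideMajorant (ι := ι) (|y| + 1) (C := C) hM hA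
  have hyL : |y| ≤ |y| + 1 := by linarith
  have h := hasDerivAt_tsum_of_isPreconnected (t := Ioo (-(|y| + 1)) (|y| + 1)) (y₀ := y) (y := y)
    hs isOpen_Ioo isPreconnected_Ioo
    (fun w z _ => (hasDerivAt_sidePolyD hV w z).mul_const (g w)) ?_ ?_ ?_ ?_
  · refine h.congr_deriv ?_
    rw [tsum_list_cons (by simp [sidePolyDD])]
    · refine Finset.sum_congr rfl fun i _ => ?_
      rw [sideSum, ← tsum_mul_left]
      exact tsum_congr fun w => by rw [sidePolyDD]; ring
    · exact Summable.of_norm_bounded hs fun w =>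
        term_le_majorant hg w hM (sidePoly_bounds hV hM hVM w hyL).2.2
  · intro w z hz
    exact term_le_majorant hg w hM (sidePoly_bounds hV hM hVM w (abs_lt.2 hz).le).2.2
  · exact abs_lt.1 (by linarith [abs_nonneg y])
  · exact Summable.of_norm_bounded hs fun w =>
        term_le_majorant hg w hM (sidePoly_bounds hV hM hVM w hyL).2.1
  · exact abs_lt.1 (by linarith [abs_nonneg y])

theorem sideSum_zero (g : List ι → ℝ) : sideSum V g 0 = 0 := by
  simp [sideSum, sidePoly_zero]

theorem sideSumD_zero (g : List ι → ℝ) : sideSumD V g 0 = g [] := by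
  rw [sideSumD, tsum_eq_single []]
  · simp [sidePolyD]
  · intro w hw
    cases w with
    | nil => exact absurd rfl hw
    | cons i w => rw [sidePolyD_zero, zero_mul]

theorem continuous_sideSum [Fintype ι] (hV : ∀ i, Continuous (V i)) {S : Type*} [TopologicalSpace S]
    {C A : ℝ} (hA : 0 ≤ A) {G : S → List ι → ℝ} (hG : ∀ s, IsGev C A (G s))
    (hc : ∀ w, Continuous fun s => G s w) :
    Continuous (fun p : S × ℝ => sideSum V (G p.1) p.2) ∧
    Continuous (fun p : S × ℝ => sideSumD V (G p.1) p.2) := by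
  have key : ∀ P : List ι → ℝ → ℝ, (∀ w, Continuous (P w)) → (∀ (L M : ℝ), 0 ≤ M →
      (∀ i z, |z| ≤ L → |V i z| ≤ M) → ∀ w z, |z| ≤ L → |P w z| ≤
        (1 + L ^ 2) * ((4 * M * (1 + L ^ 2)) ^ w.length / (2 * w.length)!)) →
      Continuous (fun p : S × ℝ => ∑' w, P w p.2 * G p.1 w) := by
    intro P hP hb
    rw [continuous_iff_continuousAt]
    intro p
    obtain ⟨M, hM, hVM⟩ := exists_bound_coeff hV (|p.2| + 1)
    have hs := summable_sideMajorant (ι := ι) (|p.2| + 1) (C := C) hM hA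
    have hco : ContinuousOn (fun p : S × ℝ => ∑' w, P w p.2 * G p.1 w)
        {q | |q.2| < |p.2| + 1} :=
      continuousOn_tsum (fun w => (((hP w).comp continuous_snd).mul
        ((hc w).comp continuous_fst)).continuousOn) hs fun w q hq =>
          term_le_majorant (hG q.1) w hM (hb _ M hM hVM w q.2 (le_of_lt hq))
    refine hco.continuousAt (IsOpen.mem_nhds ?_ ?_)
    · exact isOpen_lt (by fun_prop) continuous_const
    · exact lt_add_one |p.2|
  exact ⟨key _ (fun w => (continuous_sidePoly_aux hV w).1)
    fun L M hM hVM w z hz => (sidePoly_bounds hV hM hVM w hz).1,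
    key _ (fun w => (continuous_sidePoly_aux hV w).2)
    fun L M hM hVM w z hz => (sidePoly_bounds hV hM hVM w hz).2.1⟩

/-- The coefficients do not depend on `s`, so the `s`-derivative acts on the data alone. The
differentiated series is majorized uniformly in `s` with `4 A` in place of `A`. -/
theorem hasFDerivAt_sideSum [Fintype ι] (hV : ∀ i, Continuous (V i)) {E : Type*} [NormedAddCommGroup E]
    [NormedSpace ℝ E] {C A : ℝ} (hC : 0 ≤ C) (hA : 0 ≤ A) {G : E → List ι → ℝ}
    (hG : ∀ s, IsGev C A (G s)) (c : ι → E →L[ℝ] ℝ)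
    (hd : ∀ w s, HasFDerivAt (fun s => G s w) (∑ i, G s (i :: w) • c i) s) (y : ℝ) (s : E) :
    HasFDerivAt (fun s => sideSum V (G s) y)
      (∑ i, sideSum V (fun w => G s (i :: w)) y • c i) s := by
  obtain ⟨M, hM, hVM⟩ := exists_bound_coeff hV |y|
  have hs := summable_sideMajorant (ι := ι) |y| (C := C) hM hA
  have hs4 := summable_sideMajorant (ι := ι) |y| (C := C * (4 * A) * gev 1) (A := 4 * A) hM
    (by positivity)
  have hi : ∀ s i, Summable (fun w => sidePoly V w y * G s (i :: w)) := fun s i =>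
    Summable.of_norm_bounded hs4 fun w => term_le_majorant (g := fun w => G s (i :: w))
      ((hG s).cons hC hA i) w hM (sidePoly_bounds hV hM hVM w le_rfl).1
  have h := hasFDerivAt_tsum (x₀ := s) (hs4.mul_right (∑ i, ‖c i‖))
    (f := fun w s => sidePoly V w y * G s w)
    (f' := fun w s => ∑ i, (sidePoly V w y * G s (i :: w)) • c i) ?_ ?_ ?_ s
  · refine h.congr_fderiv ?_
    rw [Summable.tsum_finsetSum]
    · refine Finset.sum_congr rfl fun i _ => ?_
      rw [sideSum, (hi s i).tsum_smul_const]
    · exact fun i _ => (hi s i).smul_const _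
  · intro w s
    refine ((hd w s).const_mul (sidePoly V w y)).congr_fderiv ?_
    rw [Finset.smul_sum]
    exact Finset.sum_congr rfl fun i _ => by rw [smul_smul]
  · intro w s
    refine (norm_sum_le _ _).trans ?_
    rw [Finset.mul_sum]
    refine Finset.sum_le_sum fun i _ => ?_
    rw [norm_smul]
    gcongr
    exact term_le_majorant (g := fun w => G s (i :: w))
      ((hG s).cons hC hA i) w hM (sidePoly_bounds hV hM hVM w le_rfl).1
  · exact Summable.of_norm_bounded hs fun w =>
      term_le_majorant (hG s) w hM (sidePoly_bounds hV hM hVM w le_rfl).1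

/-- Comparison of growth with a monomial instead of integration, so that no integrability of `f'` is
assumed. -/
theorem abs_le_monomial_of_deriv {f f' : ℝ → ℝ} {c L : ℝ} {k : ℕ}
    (hf : ∀ z ∈ Ico 0 L, HasDerivWithinAt f (f' z) (Ico 0 L) z) (h0 : f 0 = 0)
    (hb : ∀ z ∈ Ico 0 L, |f' z| ≤ c * (z ^ k / k !)) {y : ℝ} (hy : y ∈ Ico 0 L) :
    |f y| ≤ c * (y ^ (k + 1) / (k + 1)!) := by
  have hsub : Icc 0 y ⊆ Ico 0 L := fun z hz => ⟨hz.1, hz.2.trans_lt hy.2⟩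
  refine image_norm_le_of_norm_deriv_right_le_deriv_boundary (f := f) (f' := f') (a := 0) (b := y)
    (B := fun z => c * (z ^ (k + 1) / (k + 1)!)) (B' := fun z => c * (z ^ k / k !))
    (fun z hz => (hf z (hsub hz)).continuousWithinAt.mono hsub) ?_ ?_ ?_ ?_ ⟨hy.1, le_rfl⟩
  · intro z hz
    refine (hf z (hsub (Ico_subset_Icc_self hz))).mono_of_mem_nhdsWithin ?_
    have : Ico z L ∈ 𝓝[Ici z] z := Ico_mem_nhdsGE (hz.2.trans hy.2)
    exact mem_of_superset this (Ico_subset_Ico_left hz.1)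
  · simp [h0]
  · intro z
    have := ((hasDerivAt_pow (k + 1) z).div_const ((k + 1)! : ℝ)).const_mul c
    refine this.congr_deriv ?_
    have h1 : (k ! : ℝ) ≠ 0 := by positivity
    have h2 : (k : ℝ) + 1 ≠ 0 := by positivity
    rw [Nat.factorial_succ]
    push_cast
    field_simp
  · exact fun z hz => hb z (hsub (Ico_subset_Icc_self hz))

/-- Uniqueness for the sideways Cauchy problem, written as an infinite system of ordinary
differential equations for the partial derivatives. -/
theorem sideways_unique [Fintype ι] (hV : ∀ i, Continuous (V i)) {L C A : ℝ} (hA : 0 ≤ A)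
    {e e' : List ι → ℝ → ℝ}
    (h1 : ∀ u, ∀ y ∈ Ico 0 L, HasDerivWithinAt (e u) (e' u y) (Ico 0 L) y)
    (h2 : ∀ u, ∀ y ∈ Ico 0 L,
      HasDerivWithinAt (e' u) (∑ i, V i y * e (i :: u) y) (Ico 0 L) y)
    (h0 : ∀ u, e u 0 = 0) (h0' : ∀ u, e' u 0 = 0)
    (hb : ∀ y ∈ Ico 0 L, IsGev C A (fun u => e u y)) {y : ℝ} (hy : y ∈ Ico 0 L) : e [] y = 0 := by
  obtain ⟨M, hM, hVM⟩ := exists_bound_coeff hV L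
  set K : ℝ := Fintype.card ι * M with hK
  have hK0 : 0 ≤ K := by positivity
  -- Each round applies the system once more: one further letter, at the cost of one step of the
  -- Gevrey weight, buys two integrations in `y`. The gain `1 / (2N)!` beats `gev N`, so the bound
  -- at the empty word tends to zero.
  have main : ∀ N : ℕ, ∀ u, ∀ y ∈ Ico 0 L, |e u y| ≤
      C * A ^ (u.length + N) * gev (u.length + N) * K ^ N * (y ^ (2 * N) / (2 * N)!) := by
    intro N
    induction N with
    | zero => intro u y hy; simpa using hb y hy u
    | succ N ih =>
      intro u y hy
      have hD : ∀ z ∈ Ico 0 L, |∑ i, V i z * e (i :: u) z| ≤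
          C * A ^ (u.length + (N + 1)) * gev (u.length + (N + 1)) * K ^ (N + 1) *
            (z ^ (2 * N) / (2 * N)!) := by
        intro z hz
        have hz' : |z| ≤ L := by rw [abs_of_nonneg hz.1]; exact hz.2.le
        calc _ ≤ ∑ i, |V i z * e (i :: u) z| := Finset.abs_sum_le_sum_abs _ _
          _ ≤ ∑ _i : ι, M * (C * A ^ (u.length + (N + 1)) * gev (u.length + (N + 1)) * K ^ N *
              (z ^ (2 * N) / (2 * N)!)) := by
            refine Finset.sum_le_sum fun i _ => ?_
            rw [abs_mul]
            have := ih (i :: u) z hz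
            rw [List.length_cons, show u.length + 1 + N = u.length + (N + 1) by ring] at this
            exact mul_le_mul (hVM i z hz') this (abs_nonneg _) hM
          _ = _ := by rw [Finset.sum_const, Finset.card_univ, nsmul_eq_mul, hK, pow_succ]; ring
      have hD' : ∀ z ∈ Ico 0 L, |e' u z| ≤ _ := fun z hz =>
        abs_le_monomial_of_deriv (h2 u) (h0' u) hD hz
      have := abs_le_monomial_of_deriv (h1 u) (h0 u) hD' hy
      rwa [show 2 * N + 1 + 1 = 2 * (N + 1) by ring] at this
  have hlim : Tendsto (fun N : ℕ => C * ((A * K * y ^ 2) ^ N * gev N / (2 * N)!)) atTop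
      (𝓝 (C * 0)) :=
    (summable_pow_div_sqrt_factorial (x := A * K * y ^ 2)
      (by have := hy.1; positivity)).tendsto_atTop_zero.const_mul C
  rw [mul_zero] at hlim
  have : |e [] y| ≤ 0 := by
    refine ge_of_tendsto hlim (Eventually.of_forall fun N => (main N [] y hy).trans (le_of_eq ?_))
    rw [List.length_nil, zero_add, mul_pow, mul_pow, ← pow_mul]
    ring
  exact abs_eq_zero.1 (le_antisymm this (abs_nonneg _))

/-- A family solving the sideways system is given by the series. -/
theorem eq_sideSum [Fintype ι] (hV : ∀ i, Continuous (V i)) {L C A : ℝ} (hC : 0 ≤ C) (hA : 0 ≤ A)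
    {d d' : List ι → ℝ → ℝ} {g : List ι → ℝ} (hg : IsGev C A g)
    (hperm : ∀ w w' : List ι, w.Perm w' → g w = g w')
    (h1 : ∀ u, ∀ y ∈ Ico 0 L, HasDerivWithinAt (d u) (d' u y) (Ico 0 L) y)
    (h2 : ∀ u, ∀ y ∈ Ico 0 L,
      HasDerivWithinAt (d' u) (∑ i, V i y * d (i :: u) y) (Ico 0 L) y)
    (h0 : ∀ u, d u 0 = 0) (h0' : ∀ u, d' u 0 = g u)
    (hb : ∀ y ∈ Ico 0 L, IsGev C A (fun u => d u y)) {y : ℝ} (hy : y ∈ Ico 0 L) :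
    d [] y = sideSum V g y := by
  obtain ⟨M, hM, hVM⟩ := exists_bound_coeff hV L
  set T : ℝ := ∑' w : List ι, sideMajorant L M 1 (4 * A) w with hT
  have hsm := summable_sideMajorant (ι := ι) L (M := M) (C := 1) (A := 4 * A) hM (by positivity)
  have hT0 : 0 ≤ T := tsum_nonneg fun w => by
    unfold sideMajorant
    have := gev_nonneg w.length
    positivity
  have hgu : ∀ u, IsGev (C * (4 * A) ^ u.length * gev u.length) (4 * A) (fun w => g (w ++ u)) :=
    fun u => hg.append hC hA u
  have h4A : 0 ≤ 4 * A := by positivity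
  have hsum : ∀ y ∈ Ico 0 L, ∀ u, |sideSum V (fun w => g (w ++ u)) y| ≤
      C * T * (4 * A) ^ u.length * gev u.length := by
    intro y hy u
    have hy' : |y| ≤ L := by rw [abs_of_nonneg hy.1]; exact hy.2.le
    rw [← Real.norm_eq_abs]
    have hs' := hsm.mul_left (C * (4 * A) ^ u.length * gev u.length)
    have hle : ∀ w, ‖sidePoly V w y * g (w ++ u)‖ ≤
        C * (4 * A) ^ u.length * gev u.length * sideMajorant L M 1 (4 * A) w := by
      intro w
      refine (term_le_majorant (hgu u) w hM (sidePoly_bounds hV hM hVM w hy').1).trans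
        (le_of_eq ?_)
      unfold sideMajorant; ring
    refine (tsum_of_norm_bounded hs'.hasSum hle).trans (le_of_eq ?_)
    rw [tsum_mul_left, ← hT]; ring
  -- Uniqueness is applied to the whole family of differences, the difference at `u` involving the
  -- data differentiated along `u`. Both parts fit one Gevrey bound with constant `4 * A`.
  have := sideways_unique hV (L := L) (C := C + C * T) (A := 4 * A) h4A
    (e := fun u y => d u y - sideSum V (fun w => g (w ++ u)) y)
    (e' := fun u y => d' u y - sideSumD V (fun w => g (w ++ u)) y)
    (fun u y hy => (h1 u y hy).sub (hasDerivAt_sideSum hV h4A (hgu u) y).hasDerivWithinAt)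
    ?_ ?_ ?_ ?_ hy
  · simpa [sub_eq_zero] using this
  · intro u y hy
    refine ((h2 u y hy).sub (hasDerivAt_sideSumD hV h4A (hgu u) y).hasDerivWithinAt).congr_deriv ?_
    rw [← Finset.sum_sub_distrib]
    refine Finset.sum_congr rfl fun i _ => ?_
    rw [mul_sub]
    congr 2
    refine congrArg (fun g => sideSum V g y) (funext fun w => ?_)
    -- One family carries the new letter in front of `w`, the other between `w` and `u`; partial
    -- derivatives commute.
    exact hperm _ _ List.perm_middle.symm
  · intro u
    simp [h0 u, sideSum_zero]
  · intro u
    simp [h0' u, sideSumD_zero]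
  · intro y hy u
    refine (abs_sub _ _).trans ?_
    refine (add_le_add (hb y hy u) (hsum y hy u)).trans ?_
    have hpow : A ^ u.length ≤ (4 * A) ^ u.length := by gcongr; linarith
    have hgn := gev_nonneg u.length
    calc _ ≤ C * (4 * A) ^ u.length * gev u.length + C * T * (4 * A) ^ u.length * gev u.length := by
          gcongr
      _ = _ := by ring

end SidewaysSum
end ThermalLayer
end

noncomputable section

namespace ThermalLayer

open Filter Topology MeasureTheory Asymptotics

/-! ### Global solutions from Gevrey Cauchy data at `y = 0`. -/

section GlobalSideways

variable {n : ℕ}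

/-- The coefficients of the tangential transport operator, extended to all `y`. -/
def transportCoeff (U : ℝ → Tan n) (i : Option (Fin n)) (y : ℝ) : ℝ :=
  coord i ((1 : ℝ), U (max y 0))

theorem continuous_transportCoeff {U : ℝ → Tan n} (hU : ContinuousOn U (Ici 0))
    (i : Option (Fin n)) : Continuous (transportCoeff U i) := by
  have h : Continuous (fun y => U (max y 0)) :=
    hU.comp_continuous (by fun_prop) fun p => mem_Ici.2 (le_max_right _ _)
  exact (coord i).continuous.comp (continuous_const.prodMk h)

theorem sum_coord (L : ℝ × Tan n →L[ℝ] ℝ) (a : Option (Fin n) → ℝ)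
    (hL : L = ∑ i, a i • coord i) :
    (∀ t, L (t, 0) = a none * t) ∧
      L.comp (ContinuousLinearMap.inr ℝ ℝ (Tan n)) =
        ∑ i : Fin n, a (some i) • (EuclideanSpace.proj i : Tan n →L[ℝ] ℝ) := by
  subst hL
  constructor
  · intro t
    simp [Fintype.sum_option, coord]
  · ext x
    simp [Fintype.sum_option, coord]

/-- The jet of the solution of the sideways Cauchy problem with data given by the family `G`. -/
def sideJet (U : ℝ → Tan n) (G : ℝ × Tan n → List (Option (Fin n)) → ℝ) (p : ℝ × Tan n × ℝ) :
    JetVal n :=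
  (sideSum (transportCoeff U) (G (p.1, p.2.1)) p.2.2,
    sideSum (transportCoeff U) (fun w => G (p.1, p.2.1) (none :: w)) p.2.2,
    ∑ i : Fin n, sideSum (transportCoeff U) (fun w => G (p.1, p.2.1) (some i :: w)) p.2.2 •
      (EuclideanSpace.proj i : Tan n →L[ℝ] ℝ),
    sideSumD (transportCoeff U) (G (p.1, p.2.1)) p.2.2,
    ∑ i, transportCoeff U i p.2.2 *
      sideSum (transportCoeff U) (fun w => G (p.1, p.2.1) (i :: w)) p.2.2)

/-- The Gevrey bound is assumed uniformly in `(t, x')` and the series converges for every `y`, so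
there is no restriction on the box. -/
theorem isJetSol_sideJet {U : ℝ → Tan n} (hU : ContinuousOn U (Ici 0))
    {G : ℝ × Tan n → List (Option (Fin n)) → ℝ} {C A : ℝ} (hC : 0 ≤ C) (hA : 0 ≤ A)
    (hG : ∀ s, IsGev C A (G s))
    (hd : ∀ w s, HasFDerivAt (fun s => G s w) (∑ i, G s (i :: w) • coord i) s) (R : ℝ) :
    IsJetSol U R (sideJet U G) := by
  have hV := fun i => continuous_transportCoeff hU i
  have hGc : ∀ w, Continuous (fun s => G s w) := fun w =>
    continuous_iff_continuousAt.2 fun s => (hd w s).continuousAt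
  have h4A : 0 ≤ 4 * A := by positivity
  have reassoc : Continuous (fun p : ℝ × Tan n × ℝ => ((p.1, p.2.1), p.2.2)) := by fun_prop
  have c0 := continuous_sideSum hV hA hG hGc
  have c1 := fun i => (continuous_sideSum hV h4A (fun s => (hG s).cons hC hA i)
    (fun w => hGc (i :: w))).1.comp reassoc
  have hds := fun y s => hasFDerivAt_sideSum hV hC hA hG coord hd y s
  refine ⟨⟨?_, ?_, ?_, ?_, ?_⟩, ?_, ?_⟩
  · refine Continuous.continuousOn ?_
    refine (c0.1.comp reassoc).prodMk ((c1 none).prodMk (Continuous.prodMk ?_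
      ((c0.2.comp reassoc).prodMk ?_)))
    · exact continuous_finsetSum _ fun i _ => (c1 (some i)).smul continuous_const
    · exact continuous_finsetSum _ fun i _ => ((hV i).comp (by fun_prop)).mul (c1 i)
  · intro p _
    have h := hds p.2.2 (p.1, p.2.1)
    have h2 : HasDerivAt (fun t : ℝ => (t, p.2.1)) ((1 : ℝ), (0 : Tan n)) p.1 :=
      (hasDerivAt_id p.1).prodMk (hasDerivAt_const p.1 p.2.1)
    have h3 := h.comp_hasDerivAt p.1 h2
    rw [(sum_coord _ _ rfl).1, mul_one] at h3
    exact h3.hasDerivWithinAt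
  · intro p _
    have h := hds p.2.2 (p.1, p.2.1)
    have h3 := h.comp p.2.1 (hasFDerivAt_prodMk_right p.1 p.2.1)
    rw [(sum_coord _ _ rfl).2] at h3
    exact h3
  · intro p _
    exact (hasDerivAt_sideSum hV hA (hG (p.1, p.2.1)) p.2.2).hasDerivWithinAt
  · intro p _
    exact (hasDerivAt_sideSumD hV hA (hG (p.1, p.2.1)) p.2.2).hasDerivWithinAt
  · intro p hp
    have hy : max p.2.2 0 = p.2.2 := max_eq_left hp.2.2.1
    simp only [sideJet, Fintype.sum_option]
    simp [transportCoeff, coord, hy, mul_comm]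
  · intro p _ hp
    simp only [sideJet, hp, sideSum_zero]

theorem hasInitial_sideJet {U : ℝ → Tan n}
    {G : ℝ × Tan n → List (Option (Fin n)) → ℝ} (h0 : ∀ x w, G (0, x) w = 0) (R : ℝ) :
    HasInitial R (sideJet U G) 0 := by
  intro x y _
  simp [sideJet, sideSum, h0]

end GlobalSideways

/-! ### Extension to negative times of solutions with zero initial data. -/

section ZeroData

variable {n : ℕ} {U : ℝ → Tan n} {R : ℝ} {D : ℝ × Tan n × ℝ → JetVal n}

/-- Tangential and normal derivatives of the zero function vanish, and the equation then makes the
time derivative vanish as well. This is what makes the extension by zero continuously differentiable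
across `t = 0`. -/
theorem jet_eq_zero_of_initial (hD : IsJetSol U R D) (h0 : HasInitial R D 0) {x : Tan n} {y : ℝ}
    (hp : (0, x, y) ∈ box n R) : D (0, x, y) = 0 := by
  have f0 : ∀ x y, (0, x, y) ∈ box n R → (D (0, x, y)).1 = 0 := fun x y hp => h0 x y hp
  have hfx : (D (0, x, y)).2.2.1 = 0 := by
    have h1 := hD.deriv_x _ hp
    have h2 : HasFDerivAt (fun x => (D (0, x, y)).1) (0 : Tan n →L[ℝ] ℝ) x := by
      refine (hasFDerivAt_const (0 : ℝ) x).congr_of_eventuallyEq ?_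
      filter_upwards [Metric.isOpen_ball.mem_nhds hp.2.1] with z hz
      exact f0 z y ⟨hp.1, hz, hp.2.2⟩
    exact h1.unique h2
  have hu : ∀ z ∈ Ico 0 R, UniqueDiffWithinAt ℝ (Ico 0 R) z := uniqueDiffOn_Ico 0 R
  have fy0 : ∀ y, (0, x, y) ∈ box n R → (D (0, x, y)).2.2.2.1 = 0 := by
    intro y hp
    have h1 := hD.deriv_y _ hp
    have h2 : HasDerivWithinAt (fun y => (D (0, x, y)).1) 0 (Ico 0 R) y :=
      (hasDerivWithinAt_const y (Ico 0 R) (0 : ℝ)).congr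
        (fun z hz => f0 x z ⟨hp.1, hp.2.1, hz⟩) (f0 x y hp)
    exact (hu y hp.2.2).eq_deriv _ h1 h2
  have hfyy : (D (0, x, y)).2.2.2.2 = 0 := by
    have h1 := hD.deriv_yy _ hp
    have h2 : HasDerivWithinAt (fun y => (D (0, x, y)).2.2.2.1) 0 (Ico 0 R) y :=
      (hasDerivWithinAt_const y (Ico 0 R) (0 : ℝ)).congr
        (fun z hz => fy0 z ⟨hp.1, hp.2.1, hz⟩) (fy0 y hp)
    exact (hu y hp.2.2).eq_deriv _ h1 h2
  have hft : (D (0, x, y)).2.1 = 0 := by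
    have := hD.equation _ hp
    rw [hfx, hfyy] at this
    simpa using this
  refine Prod.ext (f0 x y hp) (Prod.ext hft (Prod.ext hfx (Prod.ext (fy0 y hp) hfyy)))

/-- Extension by zero to negative times. -/
def pastExt (D : ℝ × Tan n × ℝ → JetVal n) (y : ℝ) (s : ℝ × Tan n) : JetVal n :=
  D (max s.1 0, s.2, y)

theorem max_mem_box {s : ℝ × Tan n} {y : ℝ} (hs : s ∈ Iio R ×ˢ Metric.ball (0 : Tan n) R)
    (hy : y ∈ Ico 0 R) : (max s.1 0, s.2, y) ∈ box n R :=
  ⟨⟨le_max_right _ _, max_lt hs.1 (hy.1.trans_lt hy.2)⟩, hs.2, hy⟩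

theorem continuousOn_pastExt (hD : IsJetSol U R D) :
    ContinuousOn (fun q : (ℝ × Tan n) × ℝ => pastExt D q.2 q.1)
      ((Iio R ×ˢ Metric.ball 0 R) ×ˢ Ico 0 R) :=
  hD.cont.comp (f := fun q : (ℝ × Tan n) × ℝ => (max q.1.1 0, q.1.2, q.2)) (by fun_prop)
    fun _ hq => max_mem_box hq.1 hq.2

theorem pastExt_eq_zero (hD : IsJetSol U R D) (h0 : HasInitial R D 0) {s : ℝ × Tan n} {y : ℝ}
    (hs : s ∈ Iio R ×ˢ Metric.ball (0 : Tan n) R) (hy : y ∈ Ico 0 R) (h : s.1 ≤ 0) :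
    pastExt D y s = 0 := by
  have := max_mem_box hs hy
  rw [max_eq_right h] at this
  rw [pastExt, max_eq_right h]
  exact jet_eq_zero_of_initial hD h0 this

theorem hasFDerivAt_pastExt (hD : IsJetSol U R D) (h0 : HasInitial R D 0) {s : ℝ × Tan n} {y : ℝ}
    (hs : s ∈ Iio R ×ˢ Metric.ball (0 : Tan n) R) (hy : y ∈ Ico 0 R) :
    HasFDerivAt (fun s => (pastExt D y s).1)
      ((ContinuousLinearMap.toSpanSingleton ℝ (pastExt D y s).2.1).coprod
        (pastExt D y s).2.2.1) s := by
  have hopen : IsOpen (Iio R ×ˢ Metric.ball (0 : Tan n) R) := isOpen_Iio.prod Metric.isOpen_ball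
  have hcont : ContinuousOn (pastExt D y) (Iio R ×ˢ Metric.ball (0 : Tan n) R) :=
    (continuousOn_pastExt hD).comp (f := fun s => (s, y)) (by fun_prop) fun s hs => ⟨hs, hy⟩
  refine (hasFDerivWithinAt_prod_of_partial (convex_Iio R) (t := Metric.ball (0 : Tan n) R)
    (f := fun s => (pastExt D y s).1)
    (f₁ := fun s => ContinuousLinearMap.toSpanSingleton ℝ (pastExt D y s).2.1)
    (f₂ := fun s => (pastExt D y s).2.2.1) ?_ ?_ ?_ hs).hasFDerivAt (hopen.mem_nhds hs)
  · intro q hq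
    have hR : 0 < R := hy.1.trans_lt hy.2
    suffices h : HasDerivAt (fun t => (pastExt D y (t, q.2)).1) (pastExt D y q).2.1 q.1 from
      h.hasDerivWithinAt.hasFDerivWithinAt
    have hpos : ∀ t, 0 ≤ t → t < R → HasDerivWithinAt (fun t => (pastExt D y (t, q.2)).1)
        (pastExt D y (t, q.2)).2.1 (Ici 0) t := by
      intro t ht0 htR
      have h1 := hD.deriv_t (t, q.2, y) ⟨⟨ht0, htR⟩, hq.2, hy⟩
      have h2 := h1.mono_of_mem_nhdsWithin (Ico_mem_nhdsWithin_Ici' ⟨ht0, htR⟩)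
      simp only [pastExt, max_eq_left ht0]
      exact h2.congr (fun z hz => by simp only [max_eq_left (show (0 : ℝ) ≤ z from hz)])
        (by simp only [max_eq_left ht0])
    have hneg : ∀ t, t ≤ 0 → HasDerivWithinAt (fun t => (pastExt D y (t, q.2)).1)
        (pastExt D y (t, q.2)).2.1 (Iic 0) t := by
      intro t ht
      have hz : ∀ z : ℝ, z ≤ 0 → pastExt D y (z, q.2) = 0 := fun z hz =>
        pastExt_eq_zero hD h0 ⟨hz.trans_lt hR, hq.2⟩ hy hz
      rw [hz t ht]
      exact (hasDerivWithinAt_const t (Iic 0) (0 : ℝ)).congr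
        (fun z hz' => by rw [hz z hz']; rfl) (by rw [hz t ht]; rfl)
    rcases lt_trichotomy q.1 0 with h | h | h
    · exact (hneg q.1 h.le).hasDerivAt (Iic_mem_nhds h)
    -- At `t = 0` the one-sided derivatives from both sides carry the same value and are glued.
    · have h1 := hpos q.1 h.ge hq.1
      have h2 := hneg q.1 h.le
      have h3 := h2.union h1
      rw [Iic_union_Ici] at h3
      exact h3.hasDerivAt univ_mem
    · exact (hpos q.1 h.le hq.1).hasDerivAt (Ici_mem_nhds h)
  · intro q hq
    exact (hD.deriv_x (max q.1 0, q.2, y) (max_mem_box hq hy)).hasFDerivWithinAt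
  · exact (ContinuousLinearMap.toSpanSingletonCLE (𝕜 := ℝ) (E := ℝ)).continuous.comp_continuousOn
      hcont.snd.fst

theorem pastExt_equation (hD : IsJetSol U R D) {s : ℝ × Tan n} {y : ℝ}
    (hs : s ∈ Iio R ×ˢ Metric.ball (0 : Tan n) R) (hy : y ∈ Ico 0 R) :
    (pastExt D y s).2.2.2.2 = ((ContinuousLinearMap.toSpanSingleton ℝ (pastExt D y s).2.1).coprod
        (pastExt D y s).2.2.1) ((1 : ℝ), U y) := by
  have := hD.equation _ (max_mem_box hs hy)
  rw [pastExt, ← this]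
  simp

end ZeroData
end ThermalLayer
end

noncomputable section

namespace ThermalLayer

open Filter Topology MeasureTheory Asymptotics

/-! ### Approximation of zero-data solutions by global ones. -/

section Runge

variable {n : ℕ}

/-- Both sets contain the support of the respective integrand, so both sides are integrals over the
whole space related by `σ ↦ s - σ`. The exchange moves the dependence on `s` from the kernel to the
function. -/
theorem setIntegral_sub_swap {F : Type*} [NormedAddCommGroup F] [NormedSpace ℝ F]
    {k : ℝ × Tan n → ℝ} {K B : Set (ℝ × Tan n)} {s : ℝ × Tan n}
    (hK : ∀ σ, k (s - σ) ≠ 0 → σ ∈ K) (hB : ∀ σ, k σ ≠ 0 → σ ∈ B) (f : ℝ × Tan n → F) :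
    ∫ σ in K, k (s - σ) • f σ = ∫ σ in B, k σ • f (s - σ) := by
  have haar : (volume : Measure (ℝ × Tan n)).IsAddHaarMeasure :=
    Measure.prod.instIsAddHaarMeasure volume volume
  rw [setIntegral_eq_integral_of_forall_compl_eq_zero,
    setIntegral_eq_integral_of_forall_compl_eq_zero,
    ← integral_sub_left_eq_self (fun σ => k σ • f (s - σ)) volume s]
  · simp
  · intro σ hσ
    by_contra h
    exact hσ (hB σ fun h' => h (by rw [h', zero_smul]))
  · intro σ hσ
    by_contra h
    exact hσ (hK σ fun h' => h (by rw [h', zero_smul]))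

variable {δ : ℝ} {k : List (Option (Fin n)) → ℝ × Tan n → ℝ}

theorem IsGevreyMollifier.continuous (hk : IsGevreyMollifier δ k) (w : List (Option (Fin n))) :
    Continuous (k w) :=
  continuous_iff_continuousAt.2 fun s => (hk.hasFDerivAt w s).continuousAt

theorem IsGevreyMollifier.exists_bound (hk : IsGevreyMollifier δ k) (w : List (Option (Fin n))) :
    ∃ B, 0 ≤ B ∧ ∀ s, |k w s| ≤ B := by
  obtain ⟨C, A, hC, hA, h⟩ := hk.bound
  exact ⟨_, mul_nonneg (mul_nonneg hC (pow_nonneg hA _)) (gev_nonneg _), h w⟩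

/-- The derivative falls on the kernel, so only continuity of `f` on `K` is used and the result
holds at every `s`, near `K` or not. -/
theorem hasFDerivAt_convolution_compact {E : Type*} [NormedAddCommGroup E] [NormedSpace ℝ E]
    [MeasurableSpace E] [OpensMeasurableSpace E] {μ : Measure E}
    [IsFiniteMeasureOnCompacts μ] {κ : E → ℝ} {κ' : E → E →L[ℝ] ℝ}
    (hκ : ∀ s, HasFDerivAt κ (κ' s) s) (hκ' : Continuous κ') {B : ℝ} (hB : ∀ s, ‖κ' s‖ ≤ B)
    {K : Set E} (hK : IsCompact K) {f : E → ℝ} (hf : ContinuousOn f K) (s : E) :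
    HasFDerivAt (fun s => ∫ σ in K, κ (s - σ) * f σ ∂μ) (∫ σ in K, f σ • κ' (s - σ) ∂μ) s := by
  obtain ⟨Cf, hCf⟩ := hK.exists_bound_of_continuousOn hf
  have hfin : IsFiniteMeasure (μ.restrict K) := ⟨by simpa using hK.measure_lt_top⟩
  have hκc : Continuous κ := continuous_iff_continuousAt.2 fun s => (hκ s).continuousAt
  have hint : ∀ s, Integrable (fun σ => κ (s - σ) * f σ) (μ.restrict K) := fun s =>
    ContinuousOn.integrableOn_compact hK
      ((hκc.comp (f := fun σ => s - σ) (by fun_prop)).continuousOn.mul hf)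
  have hint' : Integrable (fun σ => f σ • κ' (s - σ)) (μ.restrict K) :=
    ContinuousOn.integrableOn_compact hK
      (hf.smul (hκ'.comp (f := fun σ => s - σ) (by fun_prop)).continuousOn)
  have h := hasFDerivWithinAt_integral_of_dominated (μ := μ.restrict K)
    (s := univ) (x₀ := s) (f := fun s σ => κ (s - σ) * f σ)
    (f' := fun s σ => f σ • κ' (s - σ)) (bound := fun _ => Cf * B)
    convex_univ (mem_univ s) (fun x _ => (hint x).1) (hint s) hint'.1 ?_ (integrable_const _) ?_
  · exact h.hasFDerivAt univ_mem
  · filter_upwards [ae_restrict_mem hK.measurableSet] with σ hσ x _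
    rw [norm_smul]
    exact mul_le_mul (hCf σ hσ) (hB _) (norm_nonneg _) ((norm_nonneg _).trans (hCf σ hσ))
  · refine Eventually.of_forall fun σ x _ => HasFDerivAt.hasFDerivWithinAt ?_
    exact ((hκ (x - σ)).comp x ((hasFDerivAt_id x).sub_const σ)).mul_const (f σ)

/-- Derivative of a mollification in the tangential variables. -/
theorem hasFDerivAt_mollify (hk : IsGevreyMollifier δ k) {K : Set (ℝ × Tan n)}
    (hK : IsCompact K) {f : ℝ × Tan n → ℝ} (hf : ContinuousOn f K) (w : List (Option (Fin n)))
    (s : ℝ × Tan n) :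
    HasFDerivAt (fun s => ∫ σ in K, k w (s - σ) * f σ)
      (∑ i, (∫ σ in K, k (i :: w) (s - σ) * f σ) • coord i) s := by
  choose B hB0 hB using fun i => hk.exists_bound (i :: w)
  have hint : ∀ i, Integrable (fun σ => k (i :: w) (s - σ) * f σ) (volume.restrict K) := fun i =>
    ContinuousOn.integrableOn_compact hK
      (((hk.continuous (i :: w)).comp (f := fun σ => s - σ) (by fun_prop)).continuousOn.mul hf)
  have h := hasFDerivAt_convolution_compact (μ := volume) (κ := k w)
    (κ' := fun s => ∑ i, k (i :: w) s • coord i) (hk.hasFDerivAt w)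
    (continuous_finsetSum _ fun i _ => (hk.continuous (i :: w)).smul continuous_const)
    (B := ∑ i : Option (Fin n), B i * ‖(coord i : ℝ × Tan n →L[ℝ] ℝ)‖) (fun s => by
      refine (norm_sum_le _ _).trans (Finset.sum_le_sum fun i _ => ?_)
      rw [norm_smul]
      exact mul_le_mul_of_nonneg_right (hB i s) (norm_nonneg _)) hK hf s
  refine h.congr_fderiv ?_
  have e : ∀ σ, f σ • ∑ i, k (i :: w) (s - σ) • (coord i : ℝ × Tan n →L[ℝ] ℝ) =
      ∑ i, (k (i :: w) (s - σ) * f σ) • coord i := fun σ => by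
    rw [Finset.smul_sum]
    exact Finset.sum_congr rfl fun i _ => by rw [smul_smul, mul_comm]
  simp only [e]
  refine (integral_finsetSum Finset.univ fun i _ => (hint i).smul_const _).trans ?_
  exact Finset.sum_congr rfl fun i _ => integral_smul_const _ _

/-- Approximation of solutions with zero initial data on a box by global ones. -/
theorem exists_global_approx {U : ℝ → Tan n} (hU : ContinuousOn U (Ici 0)) {r R ε : ℝ}
    (hr : 0 < r) (hrR : r < R) (hε : 0 < ε) {D : ℝ × Tan n × ℝ → JetVal n}
    (hD : IsJetSol U R D) (h0 : HasInitial R D 0) :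
    ∃ v, (∀ R', IsJetSol U R' v) ∧ (∀ R', HasInitial R' v 0) ∧
        ∀ p ∈ box n r, ‖D p - v p‖ ≤ ε := by
  -- Radii `r < r₁ < r' < R`: the solution is integrated over `K` of size `r'`, the mollified
  -- function solves the equation for `(t, x')` in `S` of size `r₁`, and closeness is claimed at
  -- size `r`. Both `K` and `S` reach into negative times, so that `S` is open and contains `t = 0`.
  obtain ⟨r₁, hr₁, hr₁R⟩ := exists_between hrR
  obtain ⟨r', hr', hr'R⟩ := exists_between hr₁R
  set K : Set (ℝ × Tan n) := Icc (-1) r' ×ˢ Metric.closedBall 0 r' with hKdef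
  have hK : IsCompact K := isCompact_Icc.prod (isCompact_closedBall _ _)
  have hKΩ : K ⊆ Iio R ×ˢ Metric.ball (0 : Tan n) R := fun s hs =>
    ⟨hs.1.2.trans_lt hr'R, Metric.closedBall_subset_ball hr'R hs.2⟩
  have hyR : ∀ y ∈ Ico 0 r', y ∈ Ico 0 R := fun y hy => ⟨hy.1, hy.2.trans hr'R⟩
  have hyR' : ∀ y ∈ Icc 0 r', y ∈ Ico 0 R := fun y hy => ⟨hy.1, hy.2.trans_lt hr'R⟩
  have hcont : ContinuousOn (fun q : (ℝ × Tan n) × ℝ => pastExt D q.2 q.1) (K ×ˢ Icc 0 r') :=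
    (continuousOn_pastExt hD).mono fun q hq => ⟨hKΩ hq.1, hyR' _ hq.2⟩
  have hcomp : IsCompact (K ×ˢ Icc 0 r') := hK.prod isCompact_Icc
  obtain ⟨CF, hCF⟩ := hcomp.exists_bound_of_continuousOn hcont
  have hCF0 : 0 ≤ CF := (norm_nonneg _).trans (hCF ((0, 0), 0)
    ⟨⟨⟨by norm_num, by linarith⟩, Metric.mem_closedBall_self (by linarith)⟩,
      ⟨le_rfl, by linarith⟩⟩)
  have huc := hcomp.uniformContinuousOn_of_continuous hcont
  rw [Metric.uniformContinuousOn_iff] at huc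
  obtain ⟨δ₀, hδ₀, huc⟩ := huc ε hε
  -- The first bound is for the uniform continuity estimate; the other two ensure `S - B ⊆ K`, in
  -- the past and outwards respectively.
  obtain ⟨δ, hδ, hδ1, hδ2, hδ3⟩ : ∃ δ > 0, δ < δ₀ ∧ δ ≤ 1 / 4 ∧ δ ≤ r' - r₁ := by
    refine ⟨min (δ₀ / 2) (min (1 / 4) (r' - r₁)), ?_, ?_, ?_, ?_⟩
    · have : 0 < r' - r₁ := by linarith
      positivity
    · exact (min_le_left _ _).trans_lt (by linarith)
    · exact (min_le_right _ _).trans (min_le_left _ _)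
    · exact (min_le_right _ _).trans (min_le_right _ _)
  obtain ⟨k, hk⟩ := exists_gevreyMollifier (n := n) hδ
  obtain ⟨Ck, A, hCk, hA, hkb⟩ := hk.bound
  set B : Set (ℝ × Tan n) := Metric.closedBall 0 δ with hBdef
  have hBc : IsCompact B := isCompact_closedBall _ _
  have hkB : ∀ w σ, k w σ ≠ 0 → σ ∈ B := fun w σ h =>
    mem_closedBall_zero_iff.2 (hk.support w σ h).2
  set S : Set (ℝ × Tan n) := Ioo (-1 / 2) r₁ ×ˢ Metric.ball 0 r₁ with hSdef
  have hSo : IsOpen S := isOpen_Ioo.prod Metric.isOpen_ball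
  have hSc : Convex ℝ S := (convex_Ioo _ _).prod (convex_ball _ _)
  have hSB : ∀ s ∈ S, ∀ σ ∈ B, s - σ ∈ K := by
    intro s hs σ hσ
    rw [hBdef, mem_closedBall_zero_iff, Prod.norm_def, max_le_iff, Real.norm_eq_abs, abs_le] at hσ
    have h1 := hs.1.1
    have h2 := hs.1.2
    have h3 := mem_ball_zero_iff.1 hs.2
    refine ⟨⟨?_, ?_⟩, ?_⟩
    · simp only [Prod.fst_sub]; linarith [hσ.1.2]
    · simp only [Prod.fst_sub]; linarith [hσ.1.1]
    · rw [mem_closedBall_zero_iff, Prod.snd_sub]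
      refine (norm_sub_le _ _).trans ?_
      linarith [hσ.2]
  have hkK : ∀ s ∈ S, ∀ w σ, k w (s - σ) ≠ 0 → σ ∈ K := by
    intro s hs w σ h
    have := hSB s hs _ (hkB w _ h)
    rwa [sub_sub_cancel] at this
  have hfin : IsFiniteMeasure (volume.restrict K) := ⟨by simpa using hK.measure_lt_top⟩
  have hfinB : IsFiniteMeasure (volume.restrict B) := ⟨by simpa using hBc.measure_lt_top⟩
  have hFc : ∀ y ∈ Icc 0 r', ContinuousOn (pastExt D y) K := fun y hy =>
    hcont.comp (f := fun s => (s, y)) (by fun_prop) fun s hs => ⟨hs, hy⟩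
  have hFint : ∀ y ∈ Icc 0 r', ∀ w s,
      Integrable (fun σ => k w (s - σ) • pastExt D y σ) (volume.restrict K) := fun y hy w s =>
    ContinuousOn.integrableOn_compact hK
      (((hk.continuous w).comp (f := fun σ => s - σ) (by fun_prop)).continuousOn.smul (hFc y hy))
  -- the mollified jet
  set m : List (Option (Fin n)) → ℝ → ℝ × Tan n → JetVal n :=
    fun w y s => ∫ σ in K, k w (s - σ) • pastExt D y σ with hm
  have hmπ : ∀ {F : Type} [NormedAddCommGroup F] [NormedSpace ℝ F] [CompleteSpace F]
      (π : JetVal n →L[ℝ] F), ∀ y ∈ Icc 0 r', ∀ w s,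
      π (m w y s) = ∫ σ in K, k w (s - σ) • π (pastExt D y σ) := by
    intro F _ _ _ π y hy w s
    rw [hm, ← π.integral_comp_comm (hFint y hy w s)]
    simp only [map_smul]
  have hmb : ∀ y ∈ Icc 0 r', ∀ w s,
      ‖m w y s‖ ≤ Ck * CF * (volume.real K) * A ^ w.length * gev w.length := by
    intro y hy w s
    have : ‖m w y s‖ ≤ (Ck * A ^ w.length * gev w.length * CF) * volume.real K := by
      refine norm_setIntegral_le_of_norm_le_const hK.measure_lt_top fun σ hσ => ?_
      rw [norm_smul]
      exact mul_le_mul (hkb w _) (hCF (σ, y) ⟨hσ, hy⟩) (norm_nonneg _)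
        (mul_nonneg (mul_nonneg hCk (pow_nonneg hA _)) (gev_nonneg _))
    linarith [this]
  have hsubI : ∀ y ∈ Ico 0 r', y ∈ Icc 0 r' := fun y hy => Ico_subset_Icc_self hy
  have hzero : (0 : ℝ) ∈ Icc 0 r' := ⟨le_rfl, by linarith⟩
  let π₀ : JetVal n →L[ℝ] ℝ := ContinuousLinearMap.fst ℝ _ _
  let πt : JetVal n →L[ℝ] ℝ := (ContinuousLinearMap.fst ℝ _ _).comp (ContinuousLinearMap.snd ℝ _ _)
  let πx : JetVal n →L[ℝ] (Tan n →L[ℝ] ℝ) := (ContinuousLinearMap.fst ℝ _ _).comp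
    ((ContinuousLinearMap.snd ℝ _ _).comp (ContinuousLinearMap.snd ℝ _ _))
  let πr : JetVal n →L[ℝ] ℝ × ℝ := (ContinuousLinearMap.snd ℝ _ _).comp
    ((ContinuousLinearMap.snd ℝ _ _).comp (ContinuousLinearMap.snd ℝ _ _))
  let πy : JetVal n →L[ℝ] ℝ := (ContinuousLinearMap.fst ℝ _ _).comp πr
  let πyy : JetVal n →L[ℝ] ℝ := (ContinuousLinearMap.snd ℝ _ _).comp πr
  have hfd : ∀ (π : JetVal n →L[ℝ] ℝ), ∀ y ∈ Icc 0 r', ∀ w s,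
      HasFDerivAt (fun s => π (m w y s)) (∑ i, π (m (i :: w) y s) • coord i) s := by
    intro π y hy w s
    simp only [hmπ π y hy]
    exact hasFDerivAt_mollify hk hK (f := fun σ => π (pastExt D y σ))
      (π.continuous.comp_continuousOn (hFc y hy)) w s
  -- the tangential derivative falls on the solution
  have hswap : ∀ y ∈ Icc 0 r', ∀ w, ∀ s ∈ S, ∑ i, (m (i :: w) y s).1 • coord i =
      (ContinuousLinearMap.toSpanSingleton ℝ (m w y s).2.1).coprod (m w y s).2.2.1 := by
    intro y hy w s hs
    obtain ⟨Bk, hBk0, hBk⟩ := hk.exists_bound w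
    let Φ : JetVal n →L[ℝ] (ℝ × Tan n →L[ℝ] ℝ) :=
      ((ContinuousLinearMap.precomp ℝ (ContinuousLinearMap.fst ℝ ℝ (Tan n))).comp
        (ContinuousLinearMap.toSpanSingletonCLE (𝕜 := ℝ) (E := ℝ)).toContinuousLinearMap).comp πt +
      (ContinuousLinearMap.precomp ℝ (ContinuousLinearMap.snd ℝ ℝ (Tan n))).comp πx
    have hΦ : ∀ J : JetVal n, Φ J =
        (ContinuousLinearMap.toSpanSingleton ℝ J.2.1).coprod J.2.2.1 := by
      intro J
      ext v <;> simp [Φ, πt, πx]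
    have e1 : EqOn (fun s => (m w y s).1) (fun s => ∫ σ in B, k w σ • (pastExt D y (s - σ)).1) S := by
      intro s hs
      exact (hmπ π₀ y hy w s).trans (setIntegral_sub_swap (hkK s hs w) (hkB w) _)
    have hmaps : ∀ x ∈ S, ContinuousOn (fun σ => pastExt D y (x - σ)) B := fun x hx =>
      (hFc y hy).comp (by fun_prop) fun σ hσ => hSB x hx σ hσ
    have h2 : HasFDerivWithinAt (fun s => ∫ σ in B, k w σ • (pastExt D y (s - σ)).1)
        (∫ σ in B, k w σ • Φ (pastExt D y (s - σ))) S s := by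
      have i1 : ∀ x ∈ S, Integrable (fun σ => k w σ • (pastExt D y (x - σ)).1)
          (volume.restrict B) := fun x hx => ContinuousOn.integrableOn_compact hBc
        ((hk.continuous w).continuousOn.smul (hmaps x hx).fst)
      have i2 : ∀ x ∈ S, Integrable (fun σ => k w σ • Φ (pastExt D y (x - σ)))
          (volume.restrict B) := fun x hx => ContinuousOn.integrableOn_compact hBc
        ((hk.continuous w).continuousOn.smul (Φ.continuous.comp_continuousOn (hmaps x hx)))
      refine hasFDerivWithinAt_integral_of_dominated (f := fun s σ => k w σ • (pastExt D y (s - σ)).1)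
        (f' := fun s σ => k w σ • Φ (pastExt D y (s - σ))) (bound := fun _ => Bk * (‖Φ‖ * CF))
        hSc hs (fun x hx => (i1 x hx).1) (i1 s hs) (i2 s hs).1 ?_ (integrable_const _) ?_
      · filter_upwards [ae_restrict_mem hBc.measurableSet] with σ hσ x hx
        rw [norm_smul]
        refine mul_le_mul (hBk σ) ((Φ.le_opNorm _).trans ?_) (norm_nonneg _) hBk0
        gcongr
        exact hCF (x - σ, y) ⟨hSB x hx σ hσ, hy⟩
      · filter_upwards [ae_restrict_mem hBc.measurableSet] with σ hσ x hx
        have h3 := hasFDerivAt_pastExt hD h0 (hKΩ (hSB x hx σ hσ)) (hyR' y hy)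
        have h4 := (h3.comp x ((hasFDerivAt_id x).sub_const σ)).const_smul (k w σ)
        rw [hΦ]
        exact h4.hasFDerivWithinAt
    have h3 := (h2.congr e1 (e1 hs)).hasFDerivAt (hSo.mem_nhds hs)
    -- The same function has been differentiated in two ways, on the kernel and on the solution;
    -- uniqueness of the derivative equates the results.
    have h4 := (hfd π₀ y hy w s).unique h3
    have e2 : Φ (m w y s) = ∫ σ in B, k w σ • Φ (pastExt D y (s - σ)) :=
      (hmπ Φ y hy w s).trans (setIntegral_sub_swap (hkK s hs w) (hkB w) _)
    rw [← hΦ, e2]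
    exact h4
  have hdy : ∀ (π π' : JetVal n →L[ℝ] ℝ), (∀ p ∈ box n R,
      HasDerivWithinAt (fun y => π (D (p.1, p.2.1, y))) (π' (D p)) (Ico 0 R) p.2.2) →
      ∀ w s, ∀ y ∈ Ico 0 r', HasDerivWithinAt (fun y => π (m w y s)) (π' (m w y s)) (Ico 0 r') y := by
    intro π π' hπ w s y hy
    obtain ⟨Bk, hBk0, hBk⟩ := hk.exists_bound w
    have i1 : ∀ (π : JetVal n →L[ℝ] ℝ), ∀ y ∈ Ico 0 r',
        Integrable (fun σ => k w (s - σ) • π (pastExt D y σ)) (volume.restrict K) := fun π y hy => by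
      have := π.integrable_comp (hFint y (hsubI y hy) w s)
      simpa only [map_smul] using this
    have h := hasDerivWithinAt_integral_of_dominated (μ := volume.restrict K) (s := Ico 0 r')
      (f := fun y σ => k w (s - σ) • π (pastExt D y σ))
      (f' := fun y σ => k w (s - σ) • π' (pastExt D y σ)) (bound := fun _ => Bk * (‖π'‖ * CF))
      (convex_Ico _ _) hy (fun y hy => (i1 π y hy).1) (i1 π y hy) (i1 π' y hy).1 ?_
      (integrable_const _) ?_
    · rw [hmπ π' y (hsubI y hy)]
      exact h.congr (fun z hz => hmπ π z (hsubI z hz) w s) (hmπ π y (hsubI y hy) w s)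
    · filter_upwards [ae_restrict_mem hK.measurableSet] with σ hσ z hz
      rw [norm_smul]
      refine mul_le_mul (hBk _) ((π'.le_opNorm _).trans ?_) (norm_nonneg _) hBk0
      gcongr
      exact hCF (σ, z) ⟨hσ, hsubI z hz⟩
    · filter_upwards [ae_restrict_mem hK.measurableSet] with σ hσ z hz
      exact ((hπ _ (max_mem_box (hKΩ hσ) (hyR z hz))).mono
        (Ico_subset_Ico_right hr'R.le)).const_smul (k w (s - σ))
  set V := transportCoeff U with hVdef
  have hV : ∀ i, Continuous (V i) := fun i => continuous_transportCoeff hU i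
  -- The normal derivative at `y = 0` of the mollified jet, with all its tangential derivatives. It
  -- is defined and Gevrey for all `s`, although it is linked to the equation only for `s ∈ S`.
  set G : ℝ × Tan n → List (Option (Fin n)) → ℝ := fun s w => πy (m w 0 s) with hGdef
  set C₀ : ℝ := Ck * CF * volume.real K with hC₀
  have hC₀0 : 0 ≤ C₀ := by positivity
  have hgev : ∀ π : JetVal n →L[ℝ] ℝ, (∀ J, |π J| ≤ ‖J‖) → ∀ y ∈ Icc 0 r', ∀ s,
      IsGev C₀ A (fun w => π (m w y s)) := fun π hπ y hy s w => (hπ _).trans (hmb y hy w s)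
  have nπ₀ : ∀ J : JetVal n, |π₀ J| ≤ ‖J‖ := fun J => norm_fst_le J
  have nπy : ∀ J : JetVal n, |πy J| ≤ ‖J‖ := fun J =>
    (norm_fst_le J.2.2.2).trans ((norm_snd_le J.2.2).trans ((norm_snd_le J.2).trans (norm_snd_le J)))
  have hG : ∀ s, IsGev C₀ A (G s) := fun s => hgev πy nπy 0 hzero s
  have hGd : ∀ w s, HasFDerivAt (fun s => G s w) (∑ i, G s (i :: w) • coord i) s :=
    fun w s => hfd πy 0 hzero w s
  have hcoeff : ∀ y, 0 ≤ y → ∀ i, coord i ((1 : ℝ), U y) = V i y := fun y hy i => by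
    rw [hVdef, transportCoeff, max_eq_left hy]
  -- The transport coefficients depend on `y` only, so mollification in `(t, x')` commutes with the
  -- equation.
  have hyyeq : ∀ y ∈ Icc 0 r', ∀ w, ∀ s ∈ S, (m w y s).2.2.2.2 =
      ∑ i, V i y * (m (i :: w) y s).1 := by
    intro y hy w s hs
    have e1 := congrArg (fun T : ℝ × Tan n →L[ℝ] ℝ => T (1, U y)) (hswap y hy w s hs)
    simp only [sum_apply, smul_apply, smul_eq_mul, hcoeff y hy.1] at e1
    rw [show (m w y s).2.2.2.2 = πyy (m w y s) from rfl]
    calc πyy (m w y s) = ∫ σ in K, k w (s - σ) • πyy (pastExt D y σ) := hmπ πyy y hy w s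
      _ = ∫ σ in K, k w (s - σ) • (πt + (ContinuousLinearMap.apply ℝ ℝ (U y)).comp πx)
          (pastExt D y σ) := by
        refine setIntegral_congr_fun hK.measurableSet fun σ hσ => ?_
        have := pastExt_equation hD (hKΩ hσ) (hyR' y hy)
        simp only [πyy, πr, πt, πx]
        congr 1
        refine this.trans ?_
        simp
      _ = _ := (hmπ (πt + (ContinuousLinearMap.apply ℝ ℝ (U y)).comp πx) y hy w s).symm
      _ = ∑ i, V i y * (m (i :: w) y s).1 := by
        rw [← Finset.sum_congr rfl fun i _ => mul_comm ((m (i :: w) y s).1) (V i y), e1]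
        simp [πt, πx]
  -- At fixed `s ∈ S` the derivatives of the mollified solution solve the sideways system in `y`,
  -- with data `0` and `G s`.
  have hmain : ∀ s ∈ S, ∀ y ∈ Ico 0 r', (m [] y s).1 = sideSum V (G s) y := by
    intro s hs y hy
    refine eq_sideSum hV (L := r') hC₀0 hA (d := fun w y => π₀ (m w y s))
      (d' := fun w y => πy (m w y s)) (hG s) ?_ ?_ ?_ ?_ ?_ ?_ hy
    · intro w w' h
      simp only [hGdef, hm, hk.perm w w' h]
    · exact fun u y hy => hdy π₀ πy (fun p hp => hD.deriv_y p hp) u s y hy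
    · intro u y hy
      exact (hdy πy πyy (fun p hp => hD.deriv_yy p hp) u s y hy).congr_deriv
        (hyyeq y (hsubI y hy) u s hs)
    · intro u
      rw [hmπ π₀ 0 hzero]
      refine setIntegral_eq_zero_of_forall_eq_zero fun σ hσ => ?_
      have := hD.boundary _ (max_mem_box (hKΩ hσ) (hyR' 0 hzero)) rfl
      rw [show π₀ (pastExt D 0 σ) = 0 from this, smul_zero]
    · intro u; rfl
    · exact fun y hy => hgev π₀ nπ₀ y (hsubI y hy) s
  -- The first components agree on the open set `S` for all `y` in the interval, hence so do their
  -- derivatives; the `yy` component follows from the equation.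
  have hjet : ∀ s ∈ S, ∀ y ∈ Ico 0 r', sideJet U G (s.1, s.2, y) = m [] y s := by
    intro s hs y hy
    have hyI := hsubI y hy
    have hder : ∑ i, sideSum V (fun w => G s (i :: w)) y • coord i =
        (ContinuousLinearMap.toSpanSingleton ℝ (m [] y s).2.1).coprod (m [] y s).2.2.1 := by
      rw [← hswap y hyI [] s hs]
      have h1 := hasFDerivAt_sideSum hV hC₀0 hA hG coord hGd y s
      refine h1.unique ((hfd π₀ y hyI [] s).congr_of_eventuallyEq ?_)
      filter_upwards [hSo.mem_nhds hs] with x hx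
      exact (hmain x hx y hy).symm
    have hs1 := sum_coord _ _ hder.symm
    refine Prod.ext (hmain s hs y hy).symm (Prod.ext ?_ (Prod.ext ?_ (Prod.ext ?_ ?_)))
    · have := hs1.1 1
      simp only [ContinuousLinearMap.coprod_apply, ContinuousLinearMap.toSpanSingleton_apply,
        one_smul, map_zero, add_zero, mul_one] at this
      exact this.symm
    · have := hs1.2
      refine Eq.trans this.symm ?_
      ext x
      simp
    · have h1 := (hasDerivAt_sideSum hV hA (hG s) y).hasDerivWithinAt (s := Ico 0 r')
      have h2 := hdy π₀ πy (fun p hp => hD.deriv_y p hp) [] s y hy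
      refine (uniqueDiffOn_Ico 0 r' y hy).eq_deriv _ h1 (h2.congr ?_ ?_)
      · exact fun z hz => (hmain s hs z hz).symm
      · exact (hmain s hs y hy).symm
    · have e1 := congrArg (fun T : ℝ × Tan n →L[ℝ] ℝ => T (1, U y)) hder
      have e2 := congrArg (fun T : ℝ × Tan n →L[ℝ] ℝ => T (1, U y)) (hswap y hyI [] s hs)
      have e3 := e1.trans e2.symm
      simp only [sum_apply, smul_apply, smul_eq_mul, hcoeff y hy.1] at e3
      rw [hyyeq y hyI [] s hs]
      simp only [sideJet]
      rw [Finset.sum_congr rfl fun i _ => mul_comm _ _, e3]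
      exact Finset.sum_congr rfl fun i _ => mul_comm _ _
  refine ⟨sideJet U G, isJetSol_sideJet hU hC₀0 hA hG hGd, hasInitial_sideJet ?_, ?_⟩
  · intro x w
    simp only [hGdef]
    rw [hmπ πy 0 hzero]
    refine setIntegral_eq_zero_of_forall_eq_zero fun σ hσ => ?_
    by_cases hkσ : k w ((0, x) - σ) = 0
    · rw [hkσ, zero_smul]
    -- At `t = 0` the one-sided kernel sees only `σ.1 ≤ 0`, where the extension vanishes.
    · have h1 := (hk.support w _ hkσ).1
      simp only [Prod.fst_sub, zero_sub] at h1
      rw [pastExt_eq_zero hD h0 (hKΩ hσ) (hyR' 0 hzero) (by linarith), map_zero, smul_zero]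
  · intro p hp
    have hs : (p.1, p.2.1) ∈ S := ⟨⟨by linarith [hp.1.1], by linarith [hp.1.2]⟩,
      Metric.ball_subset_ball hr₁.le hp.2.1⟩
    have hy : p.2.2 ∈ Ico 0 r' := ⟨hp.2.2.1, by linarith [hp.2.2.2]⟩
    have hyI := hsubI _ hy
    rw [show sideJet U G p = m [] p.2.2 (p.1, p.2.1) from hjet (p.1, p.2.1) hs p.2.2 hy]
    have hDp : D p = pastExt D p.2.2 (p.1, p.2.1) := by
      rw [pastExt, max_eq_left hp.1.1]
    have hkint : IntegrableOn (k []) B := (hk.continuous []).continuousOn.integrableOn_compact hBc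
    have hone : ∫ σ in B, k [] σ = 1 := by
      rw [setIntegral_eq_integral_of_forall_compl_eq_zero, hk.integral_eq_one]
      intro σ hσ
      by_contra h
      exact hσ (hkB [] σ h)
    have e1 : D p = ∫ σ in B, k [] σ • D p := by
      rw [integral_smul_const, hone, one_smul]
    have e2 : m [] p.2.2 (p.1, p.2.1) =
        ∫ σ in B, k [] σ • pastExt D p.2.2 ((p.1, p.2.1) - σ) :=
      setIntegral_sub_swap (hkK _ hs []) (hkB []) _
    have hsK : (p.1, p.2.1) ∈ K := by
      simpa using hSB _ hs 0 (Metric.mem_closedBall_self hδ.le)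
    -- The kernel has mass one, so the error is an average of differences of `D` over shifts of size
    -- at most `δ < δ₀`.
    rw [e1, e2, ← integral_sub (hkint.smul_const _)]
    · refine (norm_integral_le_of_norm_le (hkint.mul_const ε) ?_).trans (le_of_eq ?_)
      · filter_upwards [ae_restrict_mem hBc.measurableSet] with σ hσ
        rw [← smul_sub, norm_smul, Real.norm_of_nonneg (hk.nonneg σ)]
        refine mul_le_mul_of_nonneg_left ?_ (hk.nonneg σ)
        have h5 := huc ((p.1, p.2.1), p.2.2) ⟨hsK, hyI⟩ ((p.1, p.2.1) - σ, p.2.2)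
          ⟨hSB _ hs σ hσ, hyI⟩ (by
            rw [Prod.dist_eq, dist_self, max_eq_left dist_nonneg, dist_eq_norm, sub_sub_cancel]
            exact (mem_closedBall_zero_iff.1 hσ).trans_lt hδ1)
        rw [hDp, ← dist_eq_norm]
        exact h5.le
      · rw [integral_mul_const, hone, one_mul]
    · refine ContinuousOn.integrableOn_compact hBc ((hk.continuous []).continuousOn.smul ?_)
      exact (hFc _ hyI).comp (by fun_prop) fun σ hσ => hSB _ hs σ hσ

end Runge
end ThermalLayer
end

noncomputable section

namespace ThermalLayer

open Filter Topology MeasureTheory Asymptotics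

/-! ### Implicit Euler scheme for contraction resolvents, without density of the domain. -/

section Euler

variable {X : Type*} [NormedAddCommGroup X] [NormedSpace ℝ X]

/-- `J h` is the resolvent `(1 - h A)⁻¹`, a contraction, of the operator `A` with graph `Γ`. -/
structure IsContractionResolvent (Γ : X → X → Prop) (J : ℝ → X →L[ℝ] X) : Prop where
  norm_le : ∀ h, 0 < h → ∀ f, ‖J h f‖ ≤ ‖f‖
  graph : ∀ h, 0 < h → ∀ f, Γ (J h f) (h⁻¹ • (J h f - f))
  left_inv : ∀ h, 0 < h → ∀ f g, Γ f g → J h (f - h • g) = f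

namespace IsContractionResolvent

variable {Γ : X → X → Prop} {J : ℝ → X →L[ℝ] X}

theorem apply_eq (hJ : IsContractionResolvent Γ J)
    {h : ℝ} (hh : 0 < h) {f g : X} (hfg : Γ f g) : J h f = f + h • J h g := by
  have := hJ.left_inv h hh f g hfg
  rw [map_sub, map_smul, sub_eq_iff_eq_add] at this
  exact this

theorem graph_apply (hJ : IsContractionResolvent Γ J)
    {h : ℝ} (hh : 0 < h) {f g : X} (hfg : Γ f g) : Γ (J h f) (J h g) := by
  have h1 := hJ.graph h hh f
  rwa [hJ.apply_eq hh hfg, add_sub_cancel_left, smul_smul, inv_mul_cancel₀ hh.ne', one_smul,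
    ← hJ.apply_eq hh hfg] at h1

theorem graph_pow (hJ : IsContractionResolvent Γ J)
    {h : ℝ} (hh : 0 < h) {f g : X} (hfg : Γ f g) (m : ℕ) :
    Γ ((J h ^ m) f) ((J h ^ m) g) := by
  induction m with
  | zero => simpa using hfg
  | succ m ih =>
    simp only [pow_succ', mul_apply_eq_comp]
    exact hJ.graph_apply hh ih

theorem norm_pow_le (hJ : IsContractionResolvent Γ J)
    {h : ℝ} (hh : 0 < h) (m : ℕ) (f : X) : ‖(J h ^ m) f‖ ≤ ‖f‖ := by
  induction m with
  | zero => simp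
  | succ m ih =>
    simp only [pow_succ', mul_apply_eq_comp]
    exact (hJ.norm_le h hh _).trans ih

/-- `J k` maps the graph to itself; applied to the graph relation of `J h u` and inverted by `J h`,
this gives commutation. -/
theorem commute (hJ : IsContractionResolvent Γ J)
    {h k : ℝ} (hh : 0 < h) (hk : 0 < k) : Commute (J h) (J k) := by
  ext u
  simp only [mul_apply_eq_comp]
  have h1 := hJ.graph_apply hk (hJ.graph h hh u)
  have h2 := hJ.left_inv h hh _ _ h1
  rwa [map_smul, smul_smul, mul_inv_cancel₀ hh.ne', one_smul, map_sub (J k), sub_sub_cancel] at h2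

theorem norm_apply_sub_le (hJ : IsContractionResolvent Γ J)
    {h : ℝ} (hh : 0 < h) {f g : X} (hfg : Γ f g) :
    ‖J h f - f‖ ≤ h * ‖g‖ := by
  rw [hJ.apply_eq hh hfg, add_sub_cancel_left, norm_smul, Real.norm_of_nonneg hh.le]
  exact mul_le_mul_of_nonneg_left (hJ.norm_le h hh g) hh.le

theorem norm_pow_sub_le (hJ : IsContractionResolvent Γ J)
    {h : ℝ} (hh : 0 < h) {f g : X} (hfg : Γ f g) (m : ℕ) :
    ‖(J h ^ m) f - f‖ ≤ m * h * ‖g‖ := by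
  induction m with
  | zero => simp
  | succ m ih =>
    have h1 := hJ.norm_apply_sub_le hh (hJ.graph_pow hh hfg m)
    have h2 := mul_le_mul_of_nonneg_left (hJ.norm_pow_le hh m g) hh.le
    have h3 := norm_sub_le_norm_sub_add_norm_sub (J h ((J h ^ m) f)) ((J h ^ m) f) f
    rw [pow_succ', mul_apply_eq_comp]
    rw [Nat.cast_succ]
    linarith

theorem norm_pow_sub_pow_le (hJ : IsContractionResolvent Γ J)
    {h : ℝ} (hh : 0 < h) {f g : X} (hfg : Γ f g) {m m' : ℕ}
    (hm : m ≤ m') : ‖(J h ^ m') f - (J h ^ m) f‖ ≤ ((m' : ℝ) - m) * h * ‖g‖ := by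
  obtain ⟨d, rfl⟩ := Nat.exists_eq_add_of_le hm
  rw [pow_add, mul_apply_eq_comp, ← map_sub]
  refine (hJ.norm_pow_le hh m _).trans ((hJ.norm_pow_sub_le hh hfg d).trans (le_of_eq ?_))
  push_cast
  ring

/-- Taylor expansion of the implicit Euler scheme to first order. -/
theorem norm_pow_sub_sub_le (hJ : IsContractionResolvent Γ J)
    {h : ℝ} (hh : 0 < h) {f g k : X} (hfg : Γ f g) (hgk : Γ g k)
    (m : ℕ) : ‖(J h ^ m) f - f - (m * h) • g‖ ≤ (m * h) ^ 2 * ‖k‖ := by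
  induction m with
  | zero => simp
  | succ m ih =>
    have e1 : (J h ^ (m + 1)) f = (J h ^ m) f + h • (J h ^ (m + 1)) g := by
      rw [pow_succ', mul_apply_eq_comp, mul_apply_eq_comp,
        hJ.apply_eq hh (hJ.graph_pow hh hfg m)]
    have e2 : (J h ^ (m + 1)) f - f - ((m + 1 : ℕ) * h) • g =
        ((J h ^ m) f - f - (m * h) • g) + h • ((J h ^ (m + 1)) g - g) := by
      rw [e1]; push_cast; module
    rw [e2]
    refine (norm_add_le _ _).trans ?_
    rw [norm_smul, Real.norm_of_nonneg hh.le]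
    have h1 := mul_le_mul_of_nonneg_left (hJ.norm_pow_sub_le hh hgk (m + 1)) hh.le
    have h2 : 0 ≤ (m : ℝ) * h ^ 2 * ‖k‖ := by positivity
    rw [Nat.cast_succ] at h1 ⊢
    nlinarith

/-- One step of size `h` and two of size `h / 2` have the same first-order expansion `f + h • g`,
each with error at most `h ^ 2 * ‖k‖`. -/
theorem norm_halving_le (hJ : IsContractionResolvent Γ J)
    {h : ℝ} (hh : 0 < h) {f g k : X} (hfg : Γ f g) (hgk : Γ g k) :
    ‖J h f - (J (h / 2) ^ 2) f‖ ≤ 2 * h ^ 2 * ‖k‖ := by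
  have hh2 : 0 < h / 2 := half_pos hh
  have h1 := hJ.norm_pow_sub_sub_le hh hfg hgk 1
  have h2 := hJ.norm_pow_sub_sub_le hh2 hfg hgk 2
  have e : J h f - (J (h / 2) ^ 2) f = ((J h ^ 1) f - f - ((1 : ℕ) * h) • g) -
      ((J (h / 2) ^ 2) f - f - ((2 : ℕ) * (h / 2)) • g) := by
    rw [pow_one]; push_cast; module
  rw [e]
  refine (norm_sub_le _ _).trans ((add_le_add h1 h2).trans (le_of_eq ?_))
  push_cast
  ring

/-- Telescoping: by commutation the one-step errors can be collected, and contractivity keeps them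
from growing. -/
theorem norm_pow_halving_le (hJ : IsContractionResolvent Γ J)
    {h : ℝ} (hh : 0 < h) {f g k : X} (hfg : Γ f g) (hgk : Γ g k)
    (m : ℕ) : ‖(J h ^ m) f - (J (h / 2) ^ (2 * m)) f‖ ≤ m * (2 * h ^ 2 * ‖k‖) := by
  have hh2 : 0 < h / 2 := half_pos hh
  induction m with
  | zero => simp
  | succ m ih =>
    have hc : Commute (J h ^ m) (J (h / 2) ^ 2) := (hJ.commute hh hh2).pow_pow m 2
    have e : (J h ^ (m + 1)) f - (J (h / 2) ^ (2 * (m + 1))) f =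
        (J h ^ m) (J h f - (J (h / 2) ^ 2) f) +
          (J (h / 2) ^ 2) ((J h ^ m) f - (J (h / 2) ^ (2 * m)) f) := by
      have e1 : (J h ^ m) ((J (h / 2) ^ 2) f) = (J (h / 2) ^ 2) ((J h ^ m) f) :=
        congrArg (fun T : X →L[ℝ] X => T f) hc
      rw [map_sub, map_sub, e1, pow_succ, mul_apply_eq_comp,
        show 2 * (m + 1) = 2 + 2 * m by ring, pow_add (J (h / 2)), mul_apply_eq_comp]
      abel
    rw [e]
    refine (norm_add_le _ _).trans ?_
    have h1 := (hJ.norm_pow_le hh m _).trans (hJ.norm_halving_le hh hfg hgk)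
    have h2 := (hJ.norm_pow_le hh2 2 _).trans ih
    rw [Nat.cast_succ]
    linarith

/-- When `f` lies only in the domain, it is replaced by `J μ f`, which lies in the domain of the
square with second image of norm at most `2 ‖g‖ / μ`. The replacement costs `μ ‖g‖` in each scheme.
Convergence for such `f` is needed because the time derivative is the evolution of `g`, which lies
only in the domain. -/
theorem norm_pow_halving_le_of_graph (hJ : IsContractionResolvent Γ J)
    {h μ : ℝ} (hh : 0 < h) (hμ : 0 < μ) {f g : X} (hfg : Γ f g)
    (m : ℕ) : ‖(J h ^ m) f - (J (h / 2) ^ (2 * m)) f‖ ≤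
      (2 * μ + 4 * (m * h ^ 2) / μ) * ‖g‖ := by
  have hh2 : 0 < h / 2 := half_pos hh
  have h1 := hJ.norm_pow_halving_le hh (hJ.graph_apply hμ hfg) (hJ.graph μ hμ g) m
  have h2 : ‖μ⁻¹ • (J μ g - g)‖ ≤ 2 * ‖g‖ / μ := by
    rw [norm_smul, norm_inv, Real.norm_of_nonneg hμ.le, inv_mul_eq_div]
    gcongr
    linarith [norm_sub_le (J μ g) g, hJ.norm_le μ hμ g]
  have h3 := hJ.norm_apply_sub_le hμ hfg
  have h4 := (hJ.norm_pow_le hh m (J μ f - f)).trans h3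
  have h5 := (hJ.norm_pow_le hh2 (2 * m) (J μ f - f)).trans h3
  have e : (J h ^ m) f - (J (h / 2) ^ (2 * m)) f =
      ((J h ^ m) (J μ f) - (J (h / 2) ^ (2 * m)) (J μ f)) - (J h ^ m) (J μ f - f) +
        (J (h / 2) ^ (2 * m)) (J μ f - f) := by
    simp only [map_sub]; abel
  rw [e]
  refine (norm_add_le _ _).trans ?_
  have h6 := norm_sub_le ((J h ^ m) (J μ f) - (J (h / 2) ^ (2 * m)) (J μ f))
    ((J h ^ m) (J μ f - f))
  have h7 : (m : ℝ) * (2 * h ^ 2 * ‖μ⁻¹ • (J μ g - g)‖) ≤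
      m * (2 * h ^ 2 * (2 * ‖g‖ / μ)) := by gcongr
  have h8 : (m : ℝ) * (2 * h ^ 2 * (2 * ‖g‖ / μ)) = 4 * (m * h ^ 2) / μ * ‖g‖ := by ring
  linarith

end IsContractionResolvent

/-- Dyadic implicit Euler approximation at time `t`. -/
def eulerStep (J : ℝ → X →L[ℝ] X) (j : ℕ) (t : ℝ) (f : X) : X :=
  (J ((1 / 2) ^ j) ^ ⌊t * 2 ^ j⌋₊) f

/-- The limit of the dyadic implicit Euler approximations. -/
def evolution (J : ℝ → X →L[ℝ] X) (f : X) (t : ℝ) : X :=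
  limUnder atTop fun j => eulerStep J j t f

theorem evolution_zero (J : ℝ → X →L[ℝ] X) (f : X) : evolution J f 0 = f := by
  have : (fun j => eulerStep J j 0 f) = fun _ => f := by
    funext j; simp [eulerStep]
  rw [evolution, this]
  exact tendsto_const_nhds.limUnder_eq

theorem tendsto_floor_mul_half_pow {t : ℝ} (ht : 0 ≤ t) :
    Tendsto (fun j : ℕ => (⌊t * 2 ^ j⌋₊ : ℝ) * (1 / 2) ^ j) atTop (𝓝 t) := by
  have h1 : Tendsto (fun j : ℕ => t - (1 / 2 : ℝ) ^ j) atTop (𝓝 t) := by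
    simpa using tendsto_const_nhds.sub
      (tendsto_pow_atTop_nhds_zero_of_lt_one (r := (1 / 2 : ℝ)) (by norm_num) (by norm_num))
  have e : ∀ j : ℕ, (2 : ℝ) ^ j * (1 / 2) ^ j = 1 := fun j => by
    rw [← mul_pow]; norm_num
  refine tendsto_of_tendsto_of_tendsto_of_le_of_le h1 tendsto_const_nhds (fun j => ?_) fun j => ?_
  · have h2 := Nat.lt_floor_add_one (t * 2 ^ j)
    have h3 : (0 : ℝ) < (1 / 2) ^ j := by positivity
    have := mul_le_mul_of_nonneg_right h2.le h3.le
    rw [mul_assoc, e, mul_one, add_mul, one_mul] at this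
    simp only
    linarith
  · have h2 := Nat.floor_le (a := t * 2 ^ j) (by positivity)
    have h3 : (0 : ℝ) < (1 / 2) ^ j := by positivity
    have := mul_le_mul_of_nonneg_right h2 h3.le
    rwa [mul_assoc, e, mul_one] at this

namespace IsContractionResolvent

variable {Γ : X → X → Prop} {J : ℝ → X →L[ℝ] X}

theorem norm_eulerStep_succ_sub_le (hJ : IsContractionResolvent Γ J)
    {f g : X} (hfg : Γ f g) {t : ℝ} (ht : 0 ≤ t) (j : ℕ) :
    dist (eulerStep J j t f) (eulerStep J (j + 1) t f) ≤
      (3 + 4 * t) * ‖g‖ * (√(1 / 2)) ^ j := by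
  set h : ℝ := (1 / 2) ^ j with hh_def
  -- `μ = √h` balances the two error terms and gives a geometric rate in `j`.
  set μ : ℝ := (√(1 / 2)) ^ j with hμ_def
  have hh : 0 < h := by positivity
  have hμ : 0 < μ := by positivity
  have hμ2 : μ ^ 2 = h := by
    rw [hμ_def, ← pow_mul, mul_comm, pow_mul, Real.sq_sqrt (by norm_num)]
  have hμ1 : μ ≤ 1 := pow_le_one₀ (Real.sqrt_nonneg _) (Real.sqrt_le_one.2 (by norm_num))
  have h2 : (1 / 2 : ℝ) ^ (j + 1) = h / 2 := by rw [pow_succ]; ring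
  set m := ⌊t * 2 ^ j⌋₊ with hm
  have hmh : (m : ℝ) * h ≤ t := by
    have := mul_le_mul_of_nonneg_right (Nat.floor_le (a := t * 2 ^ j) (by positivity)) hh.le
    rwa [mul_assoc, hh_def, ← mul_pow, show (2 : ℝ) * (1 / 2) = 1 by norm_num, one_pow,
      mul_one] at this
  -- Halving the step may add one more step because of rounding; it costs at most `(h / 2) ‖g‖`.
  have hm2 : ⌊t * 2 ^ (j + 1)⌋₊ = 2 * m ∨ ⌊t * 2 ^ (j + 1)⌋₊ = 2 * m + 1 := by
    have e : t * 2 ^ (j + 1) = 2 * (t * 2 ^ j) := by ring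
    have h0 : 0 ≤ t * 2 ^ j := by positivity
    have l1 := Nat.floor_le h0
    have l2 := Nat.lt_floor_add_one (t * 2 ^ j)
    rw [← hm] at l1 l2
    have l3 : 2 * m ≤ ⌊t * 2 ^ (j + 1)⌋₊ := by
      apply Nat.le_floor; push_cast; rw [e]; linarith
    have l4 : ⌊t * 2 ^ (j + 1)⌋₊ < 2 * m + 2 := by
      rw [Nat.floor_lt (by positivity)]; push_cast; rw [e]; linarith
    omega
  have k1 := hJ.norm_pow_halving_le_of_graph hh hμ hfg m
  have k2 : (2 * μ + 4 * (m * h ^ 2) / μ) * ‖g‖ ≤ (2 + 4 * t) * ‖g‖ * μ := by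
    have : 4 * (m * h ^ 2) / μ ≤ 4 * t * μ := by
      rw [div_le_iff₀ hμ]
      nlinarith
    nlinarith [norm_nonneg g]
  have hext : dist ((J (h / 2) ^ (2 * m)) f) (eulerStep J (j + 1) t f) ≤ ‖g‖ * μ := by
    rw [eulerStep, h2]
    rcases hm2 with e | e
    · rw [e, dist_self]; positivity
    · rw [e, dist_comm, dist_eq_norm]
      refine (hJ.norm_pow_sub_pow_le (half_pos hh) hfg (Nat.le_succ _)).trans ?_
      push_cast
      have : h / 2 ≤ μ := by nlinarith
      nlinarith [norm_nonneg g]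
  refine (dist_triangle _ ((J (h / 2) ^ (2 * m)) f) _).trans ?_
  have : dist (eulerStep J j t f) ((J (h / 2) ^ (2 * m)) f) ≤ (2 + 4 * t) * ‖g‖ * μ := by
    rw [dist_eq_norm]; exact k1.trans k2
  linarith

variable [CompleteSpace X]

theorem tendsto_eulerStep (hJ : IsContractionResolvent Γ J)
    {f g : X} (hfg : Γ f g) {t : ℝ} (ht : 0 ≤ t) :
    Tendsto (fun j => eulerStep J j t f) atTop (𝓝 (evolution J f t)) := by
  refine CauchySeq.tendsto_limUnder (cauchySeq_of_le_geometric (√(1 / 2))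
    ((3 + 4 * t) * ‖g‖) ?_ fun j => hJ.norm_eulerStep_succ_sub_le hfg ht j)
  rw [Real.sqrt_lt' one_pos]
  norm_num

theorem norm_evolution_le (hJ : IsContractionResolvent Γ J)
    {f g : X} (hfg : Γ f g) {t : ℝ} (ht : 0 ≤ t) :
    ‖evolution J f t‖ ≤ ‖f‖ :=
  le_of_tendsto (hJ.tendsto_eulerStep hfg ht).norm
    (Eventually.of_forall fun j => hJ.norm_pow_le (by positivity) _ _)

/-- The approximants lie in the graph pairwise, and the graph is closed; the hypothesis on `g` makes
its own approximants converge. -/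
theorem graph_evolution (hJ : IsContractionResolvent Γ J)
    (hΓ : IsClosed {p : X × X | Γ p.1 p.2}) {f g k : X} (hfg : Γ f g)
    (hgk : Γ g k) {t : ℝ} (ht : 0 ≤ t) : Γ (evolution J f t) (evolution J g t) :=
  hΓ.mem_of_tendsto ((hJ.tendsto_eulerStep hfg ht).prodMk_nhds (hJ.tendsto_eulerStep hgk ht))
    (Eventually.of_forall fun j => hJ.graph_pow (by positivity) hfg _)

theorem norm_evolution_sub_le (hJ : IsContractionResolvent Γ J)
    {f g : X} (hfg : Γ f g) {s t : ℝ} (hs : 0 ≤ s) (hst : s ≤ t) :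
    ‖evolution J f t - evolution J f s‖ ≤ (t - s) * ‖g‖ := by
  have ht := hs.trans hst
  refine le_of_tendsto_of_tendsto
    ((hJ.tendsto_eulerStep hfg ht).sub (hJ.tendsto_eulerStep hfg hs)).norm
    (((tendsto_floor_mul_half_pow ht).sub (tendsto_floor_mul_half_pow hs)).mul_const ‖g‖)
    (Eventually.of_forall fun j => ?_)
  refine (hJ.norm_pow_sub_pow_le (by positivity) hfg ?_).trans (le_of_eq (by ring))
  exact Nat.floor_le_floor (by gcongr)

theorem norm_evolution_sub_sub_le (hJ : IsContractionResolvent Γ J)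
    {f g k : X} (hfg : Γ f g) (hgk : Γ g k) {s t : ℝ} (hs : 0 ≤ s)
    (hst : s ≤ t) :
    ‖evolution J f t - evolution J f s - (t - s) • evolution J g s‖ ≤ (t - s) ^ 2 * ‖k‖ := by
  have ht := hs.trans hst
  have hd := (tendsto_floor_mul_half_pow ht).sub (tendsto_floor_mul_half_pow hs)
  refine le_of_tendsto_of_tendsto
    (((hJ.tendsto_eulerStep hfg ht).sub (hJ.tendsto_eulerStep hfg hs)).sub
      (hd.smul (hJ.tendsto_eulerStep hgk hs))).norm
    ((hd.pow 2).mul_const ‖k‖) (Eventually.of_forall fun j => ?_)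
  have hh : (0 : ℝ) < (1 / 2) ^ j := by positivity
  have hle : ⌊s * 2 ^ j⌋₊ ≤ ⌊t * 2 ^ j⌋₊ := Nat.floor_le_floor (by gcongr)
  obtain ⟨d, hd⟩ := Nat.exists_eq_add_of_le hle
  simp only [eulerStep, hd]
  have h1 := (hJ.norm_pow_le hh ⌊s * 2 ^ j⌋₊ _).trans (hJ.norm_pow_sub_sub_le hh hfg hgk d)
  rw [map_sub, map_sub, map_smul] at h1
  have e : ((⌊s * 2 ^ j⌋₊ + d : ℕ) : ℝ) * (1 / 2) ^ j - ⌊s * 2 ^ j⌋₊ * (1 / 2) ^ j =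
      d * (1 / 2) ^ j := by push_cast; ring
  rw [e, pow_add, mul_apply_eq_comp]
  exact h1

theorem hasDerivWithinAt_evolution (hJ : IsContractionResolvent Γ J)
    {f g k : X} (hfg : Γ f g) (hgk : Γ g k) {t : ℝ} (ht : 0 ≤ t) :
    HasDerivWithinAt (evolution J f) (evolution J g t) (Ici 0) t := by
  rw [hasDerivWithinAt_iff_isLittleO]
  refine IsBigO.trans_isLittleO (g := fun s => (s - t) ^ 2) ?_ ?_
  · refine IsBigO.of_bound (2 * ‖k‖) (eventually_mem_nhdsWithin.mono fun s (hs : 0 ≤ s) => ?_)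
    rw [Real.norm_of_nonneg (sq_nonneg (s - t))]
    have hk := norm_nonneg k
    rcases le_total t s with h | h
    · refine (hJ.norm_evolution_sub_sub_le hfg hgk ht h).trans ?_
      nlinarith [sq_nonneg (s - t)]
    · have h1 := hJ.norm_evolution_sub_sub_le hfg hgk hs h
      have h2 := hJ.norm_evolution_sub_le hgk hs h
      -- For `s ≤ t` the expansion is available at the earlier time `s`; moving its slope to `t`
      -- costs another `(t - s) ^ 2 * ‖k‖`.
      have e : evolution J f s - evolution J f t - (s - t) • evolution J g t =
          -(evolution J f t - evolution J f s - (t - s) • evolution J g s) +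
            (t - s) • (evolution J g t - evolution J g s) := by module
      rw [e]
      refine (norm_add_le _ _).trans ?_
      rw [norm_neg, norm_smul, Real.norm_of_nonneg (sub_nonneg.2 h)]
      have h3 := mul_le_mul_of_nonneg_left h2 (sub_nonneg.2 h)
      nlinarith
  · have h1 : (fun s : ℝ => (s - t) ^ 2) =o[𝓝 t] fun s => s - t := by
      have : Tendsto (fun s : ℝ => s - t) (𝓝 t) (𝓝 0) := by
        exact Continuous.tendsto' (by fun_prop) t 0 (by simp)
      exact (isLittleO_pow_id one_lt_two).comp_tendsto this
    exact h1.mono nhdsWithin_le_nhds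

theorem continuousOn_evolution (hJ : IsContractionResolvent Γ J)
    {f g : X} (hfg : Γ f g) : ContinuousOn (evolution J f) (Ici 0) := by
  refine (LipschitzOnWith.of_dist_le_mul (K := ‖g‖₊) fun s hs t ht => ?_).continuousOn
  rw [coe_nnnorm, dist_eq_norm, Real.dist_eq]
  rcases le_total s t with h | h
  · have := hJ.norm_evolution_sub_le hfg hs h
    rwa [norm_sub_rev, abs_sub_comm, abs_of_nonneg (sub_nonneg.2 h), mul_comm]
  · have := hJ.norm_evolution_sub_le hfg ht h
    rwa [abs_of_nonneg (sub_nonneg.2 h), mul_comm]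

end IsContractionResolvent

end Euler
end ThermalLayer
end

noncomputable section

namespace ThermalLayer

open Filter Topology MeasureTheory Asymptotics

/-! ### Invertibility by continuation. -/

section Continuation

variable {E : Type*} [NormedAddCommGroup E] [NormedSpace ℂ E] [CompleteSpace E]

/-- `T + P = T (1 + T⁻¹ P)` with `‖T⁻¹‖ ≤ C`, and the second factor is inverted by a Neumann series.
-/
theorem isUnit_add_of_norm_lt {T P : E →L[ℂ] E} (hT : IsUnit T) {C : ℝ}
    (hC : ∀ f, ‖f‖ ≤ C * ‖T f‖) (hP : C * ‖P‖ < 1) (hC0 : 0 ≤ C) : IsUnit (T + P) := by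
  obtain ⟨x, rfl⟩ := hT
  have hinv : ‖(↑x⁻¹ : E →L[ℂ] E)‖ ≤ C := by
    refine ContinuousLinearMap.opNorm_le_bound _ hC0 fun f => ?_
    refine (hC _).trans (le_of_eq ?_)
    rw [← mul_apply_eq_comp, x.mul_inv]
    rfl
  have h1 : IsUnit (1 - -((↑x⁻¹ : E →L[ℂ] E) * P)) := by
    refine isUnit_one_sub_of_norm_lt_one ?_
    rw [norm_neg]
    exact (norm_mul_le _ _).trans_lt
      ((mul_le_mul_of_nonneg_right hinv (norm_nonneg _)).trans_lt hP)
  have h2 := x.isUnit.mul h1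
  rwa [sub_neg_eq_add, mul_add, mul_one, ← mul_assoc, x.mul_inv, one_mul] at h2

/-- The continuity method. -/
theorem isUnit_of_continuation {T P : E →L[ℂ] E} (hT : IsUnit T) {C : ℝ} (hC0 : 0 ≤ C)
    (hC : ∀ s ∈ Icc (0 : ℝ) 1, ∀ f, ‖f‖ ≤ C * ‖(T + (s : ℂ) • P) f‖) : IsUnit (T + P) := by
  -- The a priori bound is uniform along the segment, so `N` steps of equal length, each short
  -- enough for the Neumann series, reach the end.
  obtain ⟨N, hN⟩ := exists_nat_gt (C * ‖P‖)
  have hN0 : (0 : ℝ) < N := lt_of_le_of_lt (by positivity) hN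
  have key : ∀ k : ℕ, k ≤ N → IsUnit (T + (((k : ℝ) / N : ℝ) : ℂ) • P) := by
    intro k
    induction k with
    | zero => intro _; simpa using hT
    | succ k ih =>
      intro hk
      have hk' : (k : ℝ) ≤ N := by exact_mod_cast (Nat.le_succ k).trans hk
      have h1 := isUnit_add_of_norm_lt (P := ((1 / N : ℝ) : ℂ) • P) (ih ((Nat.le_succ k).trans hk))
        (hC _ ⟨by positivity, (div_le_one hN0).2 hk'⟩) ?_ hC0
      · rw [add_assoc, ← add_smul, ← Complex.ofReal_add, ← add_div] at h1
        exact_mod_cast h1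
      · rw [norm_smul, Complex.norm_real, Real.norm_of_nonneg (by positivity)]
        rw [show C * (1 / N * ‖P‖) = C * ‖P‖ / N by ring, div_lt_one hN0]
        exact hN
  have := key N le_rfl
  rwa [div_self hN0.ne', Complex.ofReal_one, one_smul] at this

end Continuation

/-- Complex-valued continuous functions of the normal variable on `[0, L]`. -/
def Profile (L : ℝ) : Type := C(Icc (0 : ℝ) L, ℂ)

/-! ### The Dirichlet problem on `[0, L]`, the maximum principle and resolvents. -/

namespace Profile

variable {L : ℝ}

instance : NormedCommRing (Profile L) := inferInstanceAs (NormedCommRing C(Icc (0 : ℝ) L, ℂ))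

instance : NormedAlgebra ℂ (Profile L) := inferInstanceAs (NormedAlgebra ℂ C(Icc (0 : ℝ) L, ℂ))

instance : CompleteSpace (Profile L) := inferInstanceAs (CompleteSpace C(Icc (0 : ℝ) L, ℂ))

/-- The underlying bundled continuous function. -/
def toMap (f : Profile L) : C(Icc (0 : ℝ) L, ℂ) := f

/-- The value at `y`, with `y` projected to `[0, L]`. -/
def val [hL : Fact (0 ≤ L)] (f : Profile L) (y : ℝ) : ℂ :=
  f.toMap (projIcc 0 L hL.out y)

/-- The profile of a continuous function. -/
def mk (g : ℝ → ℂ) (hg : ContinuousOn g (Icc 0 L)) : Profile L :=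
  (⟨fun y => g y, hg.domRestrict⟩ : C(Icc (0 : ℝ) L, ℂ))

variable [hL : Fact (0 ≤ L)]

theorem continuous_val_prod : Continuous fun p : Profile L × ℝ => p.1.val p.2 :=
  (continuous_eval (F := C(Icc (0 : ℝ) L, ℂ))).comp
    (continuous_fst.prodMk (continuous_projIcc (h := hL.out) |>.comp continuous_snd))

theorem continuous_val (f : Profile L) : Continuous f.val :=
  continuous_val_prod.comp (Continuous.prodMk_right f)

theorem val_mk {g : ℝ → ℂ} (hg : ContinuousOn g (Icc 0 L)) {y : ℝ} (hy : y ∈ Icc 0 L) :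
    (mk g hg).val y = g y := by
  rw [val, projIcc_of_mem hL.out hy]
  rfl

theorem norm_val_le (f : Profile L) (y : ℝ) : ‖f.val y‖ ≤ ‖f‖ :=
  ContinuousMap.norm_coe_le_norm f.toMap _

theorem norm_le {f : Profile L} {C : ℝ} (hC : 0 ≤ C) (h : ∀ y ∈ Icc 0 L, ‖f.val y‖ ≤ C) :
    ‖f‖ ≤ C := by
  refine (ContinuousMap.norm_le f.toMap hC).2 fun y => ?_
  have := h y y.2
  rwa [val, projIcc_val] at this

theorem ext_val {f g : Profile L} (h : ∀ y ∈ Icc 0 L, f.val y = g.val y) : f = g := by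
  refine ContinuousMap.ext (f := f.toMap) (g := g.toMap) fun y => ?_
  have := h y y.2
  rwa [val, val, projIcc_val] at this

theorem val_add (f g : Profile L) (y : ℝ) : (f + g).val y = f.val y + g.val y := rfl
theorem val_sub (f g : Profile L) (y : ℝ) : (f - g).val y = f.val y - g.val y := rfl
theorem val_neg (f : Profile L) (y : ℝ) : (-f).val y = -f.val y := rfl
theorem val_mul (f g : Profile L) (y : ℝ) : (f * g).val y = f.val y * g.val y := rfl
theorem val_smul (c : ℂ) (f : Profile L) (y : ℝ) : (c • f).val y = c * f.val y := rfl
theorem val_algebraMap (c : ℂ) (y : ℝ) : (algebraMap ℂ (Profile L) c).val y = c := by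
  rw [Algebra.algebraMap_eq_smul_one, val_smul]
  exact mul_one c

/-- Evaluation at a point. -/
def evalCLM (y : ℝ) : Profile L →L[ℂ] ℂ :=
  LinearMap.mkContinuous
    { toFun := fun f => f.val y
      map_add' := fun f g => val_add f g y
      map_smul' := fun c f => val_smul c f y } 1 fun f => by
    rw [one_mul]; exact norm_val_le f y

theorem evalCLM_apply (y : ℝ) (f : Profile L) : evalCLM y f = f.val y := rfl

theorem continuous_primitive (f : Profile L) : Continuous fun y => ∫ z in (0 : ℝ)..y, f.val z :=
  continuous_primitive_of_continuous f.continuous_val 0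
where
  continuous_primitive_of_continuous {g : ℝ → ℂ} (hg : Continuous g) (a : ℝ) :
      Continuous fun y => ∫ z in a..y, g z :=
    intervalIntegral.continuous_primitive (fun _ _ => hg.intervalIntegrable _ _) a

/-- Integration from `0`. -/
def prim : Profile L →L[ℂ] Profile L :=
  LinearMap.mkContinuous
    { toFun := fun f => mk (fun y => ∫ z in (0 : ℝ)..y, f.val z) f.continuous_primitive.continuousOn
      map_add' := fun f g => ext_val fun y hy => by
        rw [val_add, val_mk _ hy, val_mk _ hy, val_mk _ hy]
        simp only [val_add]
        exact intervalIntegral.integral_add (f.continuous_val.intervalIntegrable _ _)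
          (g.continuous_val.intervalIntegrable _ _)
      map_smul' := fun c f => ext_val fun y hy => by
        rw [RingHom.id_apply, val_smul, val_mk _ hy, val_mk _ hy]
        simp only [val_smul]
        exact intervalIntegral.integral_const_mul _ _ } L fun f => by
    refine norm_le (mul_nonneg hL.out (norm_nonneg _)) fun y hy => ?_
    refine (congrArg norm (val_mk f.continuous_primitive.continuousOn hy)).le.trans ?_
    refine (intervalIntegral.norm_integral_le_of_norm_le_const fun z _ => norm_val_le f z).trans ?_
    rw [sub_zero, abs_of_nonneg hy.1, mul_comm]
    exact mul_le_mul_of_nonneg_right hy.2 (norm_nonneg _)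

theorem val_prim (f : Profile L) {y : ℝ} (hy : y ∈ Icc 0 L) :
    (prim f).val y = ∫ z in (0 : ℝ)..y, f.val z :=
  val_mk f.continuous_primitive.continuousOn hy

theorem hasDerivWithinAt_prim (f : Profile L) {y : ℝ} (hy : y ∈ Icc 0 L) :
    HasDerivWithinAt (prim f).val (f.val y) (Icc 0 L) y := by
  have h := intervalIntegral.integral_hasDerivAt_right
    (f.continuous_val.intervalIntegrable 0 y)
    f.continuous_val.stronglyMeasurable.stronglyMeasurableAtFilter f.continuous_val.continuousAt
  exact h.hasDerivWithinAt.congr (fun z hz => val_prim f hz) (val_prim f hy)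

theorem val_prim_zero (f : Profile L) : (prim f).val 0 = 0 := by
  rw [val_prim f ⟨le_rfl, hL.out⟩, intervalIntegral.integral_same]

/-- Multiplication by a profile. -/
def mulCLM (m : Profile L) : Profile L →L[ℂ] Profile L := ContinuousLinearMap.mul ℂ (Profile L) m

/-- The derivative of the solution of the Dirichlet problem `-u'' = f`. -/
def dirichletD : Profile L →L[ℂ] Profile L :=
  (ContinuousLinearMap.toSpanSingleton ℂ (1 : Profile L)).comp
    (((L : ℂ)⁻¹ • (evalCLM L)).comp (prim.comp prim)) - prim

/-- The solution of the Dirichlet problem `-u'' = f` on `[0, L]`. -/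
def dirichlet : Profile L →L[ℂ] Profile L := prim.comp dirichletD

theorem val_dirichletD (f : Profile L) (y : ℝ) :
    (dirichletD f).val y = (L : ℂ)⁻¹ * (prim (prim f)).val L - (prim f).val y := by
  change (((L : ℂ)⁻¹ * (prim (prim f)).val L) • (1 : Profile L) - prim f).val y = _
  rw [val_sub, val_smul]
  exact congrArg (· - (prim f).val y) (mul_one ((L : ℂ)⁻¹ * (prim (prim f)).val L))

theorem hasDerivWithinAt_dirichlet (f : Profile L) {y : ℝ} (hy : y ∈ Icc 0 L) :
    HasDerivWithinAt (dirichlet f).val ((dirichletD f).val y) (Icc 0 L) y :=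
  hasDerivWithinAt_prim _ hy

theorem hasDerivWithinAt_dirichletD (f : Profile L) {y : ℝ} (hy : y ∈ Icc 0 L) :
    HasDerivWithinAt (dirichletD f).val (-f.val y) (Icc 0 L) y := by
  have h := (hasDerivWithinAt_prim f hy).const_sub ((L : ℂ)⁻¹ * (prim (prim f)).val L)
  exact h.congr (fun z _ => val_dirichletD f z) (val_dirichletD f y)

theorem val_dirichlet_zero (f : Profile L) : (dirichlet f).val 0 = 0 := val_prim_zero _

theorem val_dirichlet_right (hL0 : 0 < L) (f : Profile L) : (dirichlet f).val L = 0 := by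
  have hL' : L ∈ Icc 0 L := ⟨hL.out, le_rfl⟩
  have hc := (prim f).continuous_val
  rw [dirichlet, ContinuousLinearMap.comp_apply, val_prim _ hL']
  simp only [val_dirichletD]
  rw [intervalIntegral.integral_sub (by simp) (hc.intervalIntegrable _ _),
    ← val_prim (prim f) hL', intervalIntegral.integral_const]
  have : (L : ℂ) ≠ 0 := by exact_mod_cast hL0.ne'
  simp [this]

/-- A twice differentiable function vanishing at the endpoints is recovered from its second
derivative. -/
theorem eq_dirichlet (hL0 : 0 < L) {u u₁ u₂ : Profile L}
    (h1 : ∀ y ∈ Icc 0 L, HasDerivWithinAt u.val (u₁.val y) (Icc 0 L) y)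
    (h2 : ∀ y ∈ Icc 0 L, HasDerivWithinAt u₁.val (u₂.val y) (Icc 0 L) y)
    (h0 : u.val 0 = 0) (hL1 : u.val L = 0) : u = dirichlet (-u₂) := by
  have z0 : (0 : ℝ) ∈ Icc 0 L := ⟨le_rfl, hL.out⟩
  have zL : L ∈ Icc 0 L := ⟨hL.out, le_rfl⟩
  set v := dirichlet (-u₂)
  set v₁ := dirichletD (-u₂)
  have hconst : ∀ {φ : ℝ → ℂ}, (∀ y ∈ Icc 0 L, HasDerivWithinAt φ 0 (Icc 0 L) y) →
      ∀ y ∈ Icc 0 L, φ y = φ 0 := by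
    intro φ hφ y hy
    have := (convex_Icc 0 L).norm_image_sub_le_of_norm_hasDerivWithin_le (C := 0) hφ
      (fun _ _ => by simp) z0 hy
    simpa [sub_eq_zero] using this
  have d1 : ∀ y ∈ Icc 0 L, u₁.val y - v₁.val y = u₁.val 0 - v₁.val 0 :=
    hconst (φ := fun y => u₁.val y - v₁.val y) fun y hy => by
      have := (h2 y hy).sub (hasDerivWithinAt_dirichletD (-u₂) hy)
      rw [val_neg, neg_neg, sub_self] at this
      exact this
  set c := u₁.val 0 - v₁.val 0 with hc
  have d0 : ∀ y ∈ Icc 0 L, u.val y - v.val y - c * y = u.val 0 - v.val 0 - c * (0 : ℝ) :=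
    hconst (φ := fun y => u.val y - v.val y - c * (y : ℝ)) fun y hy => by
      have h3 := ((h1 y hy).sub (hasDerivWithinAt_dirichlet (-u₂) hy)).sub
        ((Complex.ofRealCLM.hasDerivAt.hasDerivWithinAt (s := Icc 0 L) (x := y)).const_mul c)
      have e : u₁.val y - (dirichletD (-u₂)).val y - c * Complex.ofRealCLM 1 = 0 := by
        rw [Complex.ofRealCLM_apply, Complex.ofReal_one, mul_one, d1 y hy, sub_self]
      rw [e] at h3
      exact h3
  have e0 : u.val 0 - v.val 0 - c * (0 : ℝ) = 0 := by
    rw [h0, val_dirichlet_zero]; simp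
  have hc0 : c = 0 := by
    have := d0 L zL
    rw [e0, hL1, val_dirichlet_right hL0, sub_zero, zero_sub, neg_eq_zero] at this
    exact (mul_eq_zero.1 this).resolve_right (by exact_mod_cast hL0.ne')
  refine ext_val fun y hy => ?_
  have := d0 y hy
  rw [e0, hc0, zero_mul, sub_zero, sub_eq_zero] at this
  exact this

/-- Maximum principle for `u'' = m u - k` with `Re m ≥ ε`. -/
theorem maximum_principle (hL0 : 0 < L) {f k m : Profile L} {ε : ℝ}
    (hm : ∀ y, ε ≤ (m.val y).re) (hf : f = dirichlet (k - m * f)) : ε * ‖f‖ ≤ ‖k‖ := by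
  rcases le_or_gt ε 0 with hε | hε
  · exact (mul_nonpos_of_nonpos_of_nonneg hε (norm_nonneg _)).trans (norm_nonneg _)
  -- The equation is tested at a maximum point of `|f|`, which is interior unless `f` vanishes
  -- there.
  obtain ⟨y₀, hy₀, hmax⟩ := isCompact_Icc.exists_isMaxOn (nonempty_Icc.2 hL.out)
    f.continuous_val.norm.continuousOn
  rw [isMaxOn_iff] at hmax
  have hnorm : ‖f‖ ≤ ‖f.val y₀‖ := norm_le (norm_nonneg _) hmax
  suffices h : ε * ‖f.val y₀‖ ≤ ‖k.val y₀‖ from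
    (mul_le_mul_of_nonneg_left hnorm hε.le).trans (h.trans (norm_val_le k y₀))
  by_cases hz : f.val y₀ = 0
  · rw [hz, norm_zero, mul_zero]; exact norm_nonneg _
  have hint : y₀ ∈ Ioo 0 L := by
    refine ⟨hy₀.1.lt_of_ne fun h => hz ?_, hy₀.2.lt_of_ne fun h => hz ?_⟩
    · rw [← h, hf, val_dirichlet_zero]
    · rw [h, hf, val_dirichlet_right hL0]
  set g := k - m * f with hg
  set f₁ := dirichletD g
  have h1 : ∀ y ∈ Ioo 0 L, HasDerivAt f.val (f₁.val y) y := fun y hy => by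
    have := (hasDerivWithinAt_dirichlet g (Ioo_subset_Icc_self hy)).hasDerivAt
      (Icc_mem_nhds hy.1 hy.2)
    rwa [← hf] at this
  have h2 : ∀ y ∈ Ioo 0 L, HasDerivAt f₁.val (-g.val y) y := fun y hy =>
    (hasDerivWithinAt_dirichletD g (Ioo_subset_Icc_self hy)).hasDerivAt (Icc_mem_nhds hy.1 hy.2)
  set φ : ℝ → ℝ := fun y => ‖f.val y‖ ^ 2 with hφ
  have hφ1 : ∀ y ∈ Ioo 0 L, HasDerivAt φ (2 * inner ℝ (f.val y) (f₁.val y)) y :=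
    fun y hy => (h1 y hy).norm_sq
  have hφ2 : HasDerivAt (fun y => 2 * inner ℝ (f.val y) (f₁.val y))
      (2 * (inner ℝ (f.val y₀) (-g.val y₀) + inner ℝ (f₁.val y₀) (f₁.val y₀))) y₀ :=
    ((h1 y₀ hint).inner ℝ (h2 y₀ hint)).const_mul 2
  have hnhds : Ioo 0 L ∈ 𝓝 y₀ := Ioo_mem_nhds hint.1 hint.2
  have hderiv : deriv φ =ᶠ[𝓝 y₀] fun y => 2 * inner ℝ (f.val y) (f₁.val y) := by
    filter_upwards [hnhds] with y hy using (hφ1 y hy).deriv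
  have hdd := hφ2.congr_of_eventuallyEq hderiv
  have hlmax : IsLocalMax φ y₀ := by
    filter_upwards [hnhds] with y hy
    exact pow_le_pow_left₀ (norm_nonneg _) (hmax y (Ioo_subset_Icc_self hy)) 2
  -- Second-order condition for `|f|²` at the maximum. If its second derivative were positive, the
  -- point would also be a local minimum, and `|f|²` would be locally constant.
  have hle : inner ℝ (f.val y₀) (-g.val y₀) + inner ℝ (f₁.val y₀) (f₁.val y₀) ≤ 0 := by
    by_contra! hpos
    have hlmin : IsLocalMin φ y₀ := isLocalMin_of_deriv_deriv_pos
      (by rw [hdd.deriv]; positivity) hlmax.deriv_eq_zero (hφ1 y₀ hint).continuousAt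
    have hcst : φ =ᶠ[𝓝 y₀] fun _ => φ y₀ := by
      filter_upwards [hlmax, hlmin] with y ha hb using le_antisymm ha hb
    have h0 : deriv φ =ᶠ[𝓝 y₀] fun _ => 0 := by
      filter_upwards [hcst.eventuallyEq_nhds] with y hy
      rw [hy.deriv_eq, deriv_const]
    have := hdd.deriv
    rw [h0.deriv_eq, deriv_const] at this
    linarith
  have hin : 0 ≤ inner ℝ (f.val y₀) (g.val y₀) := by
    have : 0 ≤ inner ℝ (f₁.val y₀) (f₁.val y₀) := real_inner_self_nonneg
    rw [inner_neg_right] at hle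
    linarith
  -- Only the real part of `m` survives in the real inner product of `f` with `m f`; the imaginary
  -- transport term drops out.
  have hexp : inner ℝ (f.val y₀) (g.val y₀) =
      inner ℝ (f.val y₀) (k.val y₀) - (m.val y₀).re * ‖f.val y₀‖ ^ 2 := by
    rw [hg, val_sub, val_mul, inner_sub_right]
    congr 1
    rw [Complex.inner, mul_assoc, Complex.mul_conj, Complex.re_mul_ofReal, Complex.normSq_eq_norm_sq]
  have hcs : inner ℝ (f.val y₀) (k.val y₀) ≤ ‖f.val y₀‖ * ‖k.val y₀‖ := real_inner_le_norm _ _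
  have hpos : 0 < ‖f.val y₀‖ := norm_pos_iff.2 hz
  have := hm y₀
  by_contra! hlt
  nlinarith [mul_pos hpos hpos]

/-- The operator `1 + (-∂²)⁻¹ m`. -/
def shiftOp (m : Profile L) : Profile L →L[ℂ] Profile L := 1 + dirichlet.comp (mulCLM m)

theorem shiftOp_apply (m f : Profile L) : shiftOp m f = f + dirichlet (m * f) := rfl

/-- `f - g` solves the boundary value problem with source `-m g`, so the maximum principle controls
it by `‖m‖ ‖g‖ / ε`. -/
theorem norm_le_shiftOp (hL0 : 0 < L) {m : Profile L} {ε : ℝ} (hε : 0 < ε)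
    (hm : ∀ y, ε ≤ (m.val y).re) (f : Profile L) : ‖f‖ ≤ (‖m‖ / ε + 1) * ‖shiftOp m f‖ := by
  set g := shiftOp m f with hg
  have h1 : f - g = dirichlet (-(m * g) - m * (f - g)) := by
    have h2 : -(m * g) - m * (f - g) = -(m * f) := by ring
    rw [h2, map_neg, hg, shiftOp_apply, sub_add_cancel_left]
  have h2 := maximum_principle hL0 hm h1
  rw [norm_neg] at h2
  have h3 : ‖f - g‖ ≤ ‖m‖ / ε * ‖g‖ := by
    rw [div_mul_eq_mul_div, le_div_iff₀ hε, mul_comm]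
    exact h2.trans (norm_mul_le _ _)
  have h4 : ‖f‖ ≤ ‖f - g‖ + ‖g‖ := by simpa using norm_add_le (f - g) g
  linarith

/-- The continuation starts from a small constant `η`, where a Neumann series applies. Along the
segment from `η` to `m` the real part stays at least `η`, so the a priori bound is uniform. -/
theorem isUnit_shiftOp (hL0 : 0 < L) {m : Profile L} {ε : ℝ} (hε : 0 < ε)
    (hm : ∀ y, ε ≤ (m.val y).re) : IsUnit (shiftOp m) := by
  set S := (dirichlet : Profile L →L[ℂ] Profile L)
  obtain ⟨η, hη, hηε, hηS⟩ : ∃ η > 0, η ≤ ε ∧ η * ‖S‖ < 1 := by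
    refine ⟨min ε (1 / (‖S‖ + 1)), by positivity, min_le_left _ _, ?_⟩
    have : min ε (1 / (‖S‖ + 1)) ≤ 1 / (‖S‖ + 1) := min_le_right _ _
    refine (mul_le_mul_of_nonneg_right this (norm_nonneg _)).trans_lt ?_
    rw [one_div_mul_eq_div, div_lt_one (by positivity)]
    linarith
  set m₀ : Profile L := algebraMap ℂ (Profile L) (η : ℂ) with hm₀
  have hm₀v : ∀ y, m₀.val y = η := fun y => val_algebraMap _ y
  have hm₀n : ‖m₀‖ ≤ η := norm_le hη.le fun y _ => by
    rw [hm₀v, Complex.norm_real, Real.norm_of_nonneg hη.le]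
  have h0 : IsUnit (shiftOp m₀) := by
    have h1 : ‖-S.comp (mulCLM m₀)‖ < 1 := by
      rw [norm_neg]
      refine lt_of_le_of_lt (ContinuousLinearMap.opNorm_comp_le _ _) ?_
      have : ‖mulCLM m₀‖ ≤ η := (ContinuousLinearMap.opNorm_mul_apply_le ℂ _ m₀).trans hm₀n
      calc ‖S‖ * ‖mulCLM m₀‖ ≤ ‖S‖ * η := by gcongr
        _ < 1 := by rwa [mul_comm]
    have h2 := isUnit_one_sub_of_norm_lt_one h1
    rwa [sub_neg_eq_add] at h2
  have e : ∀ c : ℂ, shiftOp m₀ + c • S.comp (mulCLM (m - m₀)) = shiftOp (m₀ + c • (m - m₀)) := by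
    intro c
    refine ContinuousLinearMap.ext fun f => ?_
    change f + S (m₀ * f) + c • S ((m - m₀) * f) = f + S ((m₀ + c • (m - m₀)) * f)
    rw [← map_smul, add_assoc, ← map_add, add_mul, smul_mul_assoc]
  have h1 := isUnit_of_continuation (P := S.comp (mulCLM (m - m₀))) h0
    (C := (‖m₀‖ + ‖m - m₀‖) / η + 1) (by positivity) fun s hs f => ?_
  · have := e 1
    rw [one_smul, one_smul, add_sub_cancel] at this
    rwa [this] at h1
  · rw [e]
    refine (norm_le_shiftOp (m := m₀ + (s : ℂ) • (m - m₀)) hL0 hη (fun y => ?_) f).trans ?_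
    · rw [val_add, val_smul, val_sub, hm₀v]
      simp only [Complex.add_re, Complex.ofReal_re, Complex.re_ofReal_mul, Complex.sub_re]
      nlinarith [hm y, hs.1, mul_nonneg hs.1 (sub_nonneg.2 (hηε.trans (hm y)))]
    · have : ‖m₀ + (s : ℂ) • (m - m₀)‖ ≤ ‖m₀‖ + ‖m - m₀‖ := by
        refine (norm_add_le _ _).trans ?_
        gcongr
        rw [norm_smul, Complex.norm_real, Real.norm_of_nonneg hs.1]
        exact mul_le_of_le_one_left (norm_nonneg _) hs.2
      gcongr

/-- The graph of `f ↦ f'' - b f` with Dirichlet conditions. -/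
def IsGraph (b f g : Profile L) : Prop := f = -dirichlet (g + b * f)

/-- The resolvent of `f ↦ f'' - b f` with Dirichlet conditions. -/
def resolvent (b : Profile L) (h : ℝ) : Profile L →L[ℝ] Profile L :=
  ((Ring.inverse (shiftOp (algebraMap ℂ _ ((h⁻¹ : ℝ) : ℂ) + b))).comp
    (((h⁻¹ : ℝ) : ℂ) • dirichlet)).restrictScalars ℝ

/-- The graph is written with the solution operator instead of derivatives, which makes it the
coincidence set of continuous maps. -/
theorem isClosed_isGraph (b : Profile L) :
    IsClosed {p : Profile L × Profile L | IsGraph b p.1 p.2} :=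
  isClosed_eq continuous_fst (dirichlet.continuous.comp
    (continuous_snd.add (continuous_const.mul continuous_fst))).neg

theorem isUnit_shiftOp_add (hL0 : 0 < L) {b : Profile L} (hb : ∀ y, (b.val y).re = 0) {h : ℝ}
    (hh : 0 < h) : IsUnit (shiftOp (algebraMap ℂ _ ((h⁻¹ : ℝ) : ℂ) + b)) := by
  refine isUnit_shiftOp hL0 (inv_pos.2 hh) fun y => ?_
  rw [val_add, val_algebraMap, Complex.add_re, hb, Complex.ofReal_re, add_zero]

theorem shiftOp_resolvent (hL0 : 0 < L) {b : Profile L} (hb : ∀ y, (b.val y).re = 0) {h : ℝ}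
    (hh : 0 < h) (f : Profile L) :
    shiftOp (algebraMap ℂ _ ((h⁻¹ : ℝ) : ℂ) + b) (resolvent b h f) =
      ((h⁻¹ : ℝ) : ℂ) • dirichlet f :=
  congrArg (fun T : Profile L →L[ℂ] Profile L => T (((h⁻¹ : ℝ) : ℂ) • dirichlet f))
    (Ring.mul_inverse_cancel _ (isUnit_shiftOp_add hL0 hb hh))

/-- The resolvent equation has zeroth-order coefficient `h⁻¹ + b`, of real part exactly `h⁻¹` as `b`
is imaginary. The maximum principle with `ε = h⁻¹` then gives norm at most one, whatever the size of
`b`. -/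
theorem isContractionResolvent (hL0 : 0 < L) {b : Profile L} (hb : ∀ y, (b.val y).re = 0) :
    IsContractionResolvent (IsGraph b) (resolvent b) := by
  have key : ∀ h, 0 < h → ∀ f, resolvent b h f =
      dirichlet (((h⁻¹ : ℝ) : ℂ) • f - (algebraMap ℂ _ ((h⁻¹ : ℝ) : ℂ) + b) * resolvent b h f) := by
    intro h hh f
    have := shiftOp_resolvent hL0 hb hh f
    rw [shiftOp_apply] at this
    rw [map_sub, map_smul, ← this, add_sub_cancel_right]
  refine ⟨fun h hh f => ?_, fun h hh f => ?_, fun h hh f g hfg => ?_⟩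
  · have h1 := maximum_principle hL0 (ε := h⁻¹) (fun y => ?_) (key h hh f)
    · rw [norm_smul, Complex.norm_real, Real.norm_of_nonneg (inv_pos.2 hh).le] at h1
      exact le_of_mul_le_mul_left h1 (inv_pos.2 hh)
    · rw [val_add, val_algebraMap, Complex.add_re, hb, Complex.ofReal_re, add_zero]
  · unfold IsGraph
    conv_lhs => rw [key h hh f]
    rw [← map_neg]
    congr 1
    rw [← Complex.coe_smul (h⁻¹), Algebra.algebraMap_eq_smul_one, add_mul, smul_mul_assoc, one_mul,
      smul_sub]
    abel
  · have hu := isUnit_shiftOp_add hL0 hb hh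
    have h1 : Function.Injective (shiftOp (algebraMap ℂ _ ((h⁻¹ : ℝ) : ℂ) + b)) := by
      intro x y hxy
      obtain ⟨T, hT⟩ := hu
      rw [← hT] at hxy
      have := congrArg (↑T⁻¹ : Profile L →L[ℂ] Profile L) hxy
      rwa [← mul_apply_eq_comp, ← mul_apply_eq_comp, T.inv_mul] at this
    apply h1
    rw [shiftOp_resolvent hL0 hb hh, shiftOp_apply, ← map_smul]
    have e : f = dirichlet (-(g + b * f)) := by rw [map_neg]; exact hfg
    refine Eq.trans ?_ (congrArg
      (· + dirichlet ((algebraMap ℂ (Profile L) ((h⁻¹ : ℝ) : ℂ) + b) * f)) e.symm)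
    rw [← map_add]
    congr 1
    have hc : ((h⁻¹ : ℝ) : ℂ) * (h : ℂ) = 1 := by
      rw [← Complex.ofReal_mul, inv_mul_cancel₀ hh.ne', Complex.ofReal_one]
    rw [smul_sub, ← Complex.coe_smul h, smul_smul, hc, one_smul, Algebra.algebraMap_eq_smul_one,
      add_mul, smul_mul_assoc, one_mul]
    abel

/-- Inversion is continuous at units. This gives measurability of the evolution in the frequency. -/
theorem continuous_resolvent {Ξ : Type*} [TopologicalSpace Ξ] (hL0 : 0 < L) {b : Ξ → Profile L}
    (hb : Continuous b) (hre : ∀ ξ y, ((b ξ).val y).re = 0) {h : ℝ} (hh : 0 < h) :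
    Continuous fun ξ => resolvent (b ξ) h := by
  have h1 : Continuous fun ξ => shiftOp (algebraMap ℂ (Profile L) ((h⁻¹ : ℝ) : ℂ) + b ξ) := by
    refine continuous_const.add (continuous_const.clm_comp ?_)
    exact (ContinuousLinearMap.mul ℂ (Profile L)).continuous.comp (continuous_const.add hb)
  have h2 : Continuous fun ξ =>
      Ring.inverse (shiftOp (algebraMap ℂ (Profile L) ((h⁻¹ : ℝ) : ℂ) + b ξ)) := by
    refine continuous_iff_continuousAt.2 fun ξ => ?_
    obtain ⟨x, hx⟩ := isUnit_shiftOp_add hL0 (hre ξ) hh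
    have := NormedRing.inverse_continuousAt x
    rw [hx] at this
    exact ContinuousAt.comp (f := fun ξ => shiftOp (algebraMap ℂ (Profile L) ((h⁻¹ : ℝ) : ℂ) + b ξ))
      this h1.continuousAt
  exact (ContinuousLinearMap.restrictScalarsL ℂ (Profile L) (Profile L) ℝ ℝ).continuous.comp
    (h2.clm_comp continuous_const)

end Profile
end ThermalLayer
end

noncomputable section

namespace ThermalLayer

open Filter Topology MeasureTheory Asymptotics

/-! ### Superposition of Fourier modes in `x'`. -/

section Synthesis

variable {n : ℕ}

/-- The character `x ↦ e^{2πi⟨ξ, x⟩}`. -/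
def phase (ξ x : Tan n) : ℂ := Complex.exp (((2 * Real.pi * inner ℝ ξ x : ℝ) : ℂ) * Complex.I)

theorem norm_phase (ξ x : Tan n) : ‖phase ξ x‖ = 1 := Complex.norm_exp_ofReal_mul_I _

theorem continuous_phase : Continuous fun p : Tan n × Tan n => phase p.1 p.2 := by
  unfold phase
  fun_prop

theorem continuous_phase_left (x : Tan n) : Continuous fun ξ : Tan n => phase ξ x :=
  continuous_phase.comp (Continuous.prodMk_left x)

theorem continuous_phase_right (ξ : Tan n) : Continuous fun x : Tan n => phase ξ x :=
  continuous_phase.comp (Continuous.prodMk_right ξ)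

theorem hasFDerivAt_phase (ξ x : Tan n) :
    HasFDerivAt (phase ξ)
      ((innerSL ℝ ξ).smulRight ((2 * Real.pi : ℝ) * Complex.I * phase ξ x)) x := by
  have h1 : HasFDerivAt (fun x : Tan n => 2 * Real.pi * inner ℝ ξ x)
      ((2 * Real.pi) • innerSL ℝ ξ) x := (innerSL ℝ ξ).hasFDerivAt.const_mul _
  have h2 := ((Complex.ofRealCLM.hasFDerivAt.comp x h1).mul_const Complex.I).cexp
  refine h2.congr_fderiv ?_
  ext v
  simp [phase]
  ring

variable {X : Type*} [NormedAddCommGroup X] [NormedSpace ℂ X]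

/-- The superposition of the modes `f ξ t`. -/
def synth (f : Tan n → ℝ → X) (t : ℝ) (x : Tan n) : X := ∫ ξ, phase ξ x • f ξ t

/-- The tangential derivative of a superposition of modes. -/
def synthD (f : Tan n → ℝ → X) (t : ℝ) (x : Tan n) : Tan n →L[ℝ] X :=
  ∫ ξ, (innerSL ℝ ξ).smulRight (((2 * Real.pi : ℝ) * Complex.I * phase ξ x) • f ξ t)

/-- The modes `f` are continuous in time, measurable in the frequency and dominated by `β`. -/
structure IsModeFamily (f : Tan n → ℝ → X) (β : Tan n → ℝ) : Prop where
  cont : ∀ ξ, ContinuousOn (f ξ) (Ici 0)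
  meas : ∀ t, 0 ≤ t → AEStronglyMeasurable (fun ξ => f ξ t) volume
  bound : ∀ ξ t, 0 ≤ t → ‖f ξ t‖ ≤ β ξ
  integrable : Integrable β volume

namespace IsModeFamily

variable {f g : Tan n → ℝ → X} {β γ : Tan n → ℝ}

theorem integrable_smul (hf : IsModeFamily f β) {t : ℝ} (ht : 0 ≤ t) (x : Tan n) :
    Integrable (fun ξ => phase ξ x • f ξ t) volume := by
  refine hf.integrable.mono'
    ((continuous_phase_left x).aestronglyMeasurable.smul (hf.meas t ht)) (ae_of_all _ fun ξ => ?_)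
  rw [norm_smul, norm_phase, one_mul]
  exact hf.bound ξ t ht

theorem continuousOn_synth (hf : IsModeFamily f β) :
    ContinuousOn (fun p : ℝ × Tan n => synth f p.1 p.2) (Ici 0 ×ˢ univ) := by
  refine continuousOn_of_dominated (bound := β) (fun p hp => (hf.integrable_smul hp.1 p.2).1)
    (fun p hp => ae_of_all _ fun ξ => ?_) hf.integrable (ae_of_all _ fun ξ => ?_)
  · rw [norm_smul, norm_phase, one_mul]
    exact hf.bound ξ _ hp.1
  · exact ((continuous_phase_right ξ).comp continuous_snd).continuousOn.smul
      ((hf.cont ξ).comp continuousOn_fst fun p hp => hp.1)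

theorem map_synth [CompleteSpace X] {Y : Type*} [NormedAddCommGroup Y] [NormedSpace ℂ Y] [CompleteSpace Y]
    (T : X →L[ℂ] Y) (hf : IsModeFamily f β) {t : ℝ} (ht : 0 ≤ t) (x : Tan n) :
    T (synth f t x) = synth (fun ξ t => T (f ξ t)) t x := by
  rw [synth, ← T.integral_comp_comm (hf.integrable_smul ht x)]
  simp only [map_smul, synth]

theorem hasDerivWithinAt_synth [CompleteSpace X] (hf : IsModeFamily f β) (hg : IsModeFamily g γ)
    (hd : ∀ ξ t, 0 ≤ t → HasDerivWithinAt (f ξ) (g ξ t) (Ici 0) t) {t : ℝ} (ht : 0 ≤ t)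
    (x : Tan n) : HasDerivWithinAt (fun t => synth f t x) (synth g t x) (Ici 0) t := by
  refine hasDerivWithinAt_integral_of_dominated (bound := γ)
    (f := fun t ξ => phase ξ x • f ξ t) (f' := fun t ξ => phase ξ x • g ξ t) (convex_Ici 0) ht
    (fun s hs => (hf.integrable_smul hs x).1) (hf.integrable_smul ht x)
    (hg.integrable_smul ht x).1 (ae_of_all _ fun ξ s hs => ?_) hg.integrable
    (ae_of_all _ fun ξ s hs => (hd ξ s hs).const_smul (phase ξ x))
  rw [norm_smul, norm_phase, one_mul]
  exact hg.bound ξ s hs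

theorem norm_smulRight_phase (ξ x : Tan n) (u : X) :
    ‖(innerSL ℝ ξ).smulRight (((2 * Real.pi : ℝ) * Complex.I * phase ξ x) • u)‖ =
      2 * Real.pi * (‖ξ‖ * ‖u‖) := by
  rw [ContinuousLinearMap.norm_smulRight_apply, innerSL_apply_norm, norm_smul, norm_mul, norm_phase,
    norm_mul, Complex.norm_I, Complex.norm_real, Real.norm_of_nonneg (by positivity)]
  ring

theorem continuous_innerSL_smulRight :
    Continuous fun p : Tan n × X => (innerSL ℝ p.1).smulRight p.2 := by
  have h : Continuous fun q : (Tan n →L[ℝ] ℝ) × X =>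
      ContinuousLinearMap.smulRightL ℝ (Tan n) X q.1 q.2 :=
    (ContinuousLinearMap.smulRightL ℝ (Tan n) X).continuous₂
  exact h.comp (((innerSL ℝ).continuous.comp continuous_fst).prodMk continuous_snd)

theorem aestronglyMeasurable_smulRight (hf : IsModeFamily f β) {t : ℝ} (ht : 0 ≤ t) (x : Tan n) :
    AEStronglyMeasurable (fun ξ => (innerSL ℝ ξ).smulRight
      (((2 * Real.pi : ℝ) * Complex.I * phase ξ x) • f ξ t)) volume := by
  have h1 : AEStronglyMeasurable
      (fun ξ : Tan n => (ξ, ((2 * Real.pi : ℝ) * Complex.I * phase ξ x) • f ξ t)) volume :=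
    (continuous_id.aestronglyMeasurable).prodMk
      ((continuous_const.mul (continuous_phase_left x)).aestronglyMeasurable.smul (hf.meas t ht))
  have h2 := continuous_innerSL_smulRight.comp_aestronglyMeasurable h1
  simpa only [Function.comp_def] using h2

/-- A tangential derivative brings down a factor `2π ‖ξ‖`, so the first moment of the dominating
function must be finite. -/
theorem hasFDerivAt_synth [CompleteSpace X] (hf : IsModeFamily f β) (hβ : Integrable (fun ξ => ‖ξ‖ * β ξ))
    {t : ℝ} (ht : 0 ≤ t) (x : Tan n) : HasFDerivAt (synth f t) (synthD f t x) x := by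
  have h := hasFDerivWithinAt_integral_of_dominated (μ := volume)
    (f := fun x ξ => phase ξ x • f ξ t)
    (f' := fun x ξ => (innerSL ℝ ξ).smulRight
      (((2 * Real.pi : ℝ) * Complex.I * phase ξ x) • f ξ t))
    (bound := fun ξ => 2 * Real.pi * (‖ξ‖ * β ξ)) convex_univ (mem_univ x)
    (fun x _ => (hf.integrable_smul ht x).1) (hf.integrable_smul ht x)
    (hf.aestronglyMeasurable_smulRight ht x) (ae_of_all _ fun ξ x _ => ?_) (hβ.const_mul _)
    (ae_of_all _ fun ξ x _ => ?_)
  · exact h.hasFDerivAt univ_mem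
  · rw [norm_smulRight_phase]
    gcongr
    exact hf.bound ξ t ht
  · refine HasFDerivAt.hasFDerivWithinAt ?_
    refine ((hasFDerivAt_phase ξ x).smul_const (f ξ t)).congr_fderiv ?_
    ext v
    simp only [ContinuousLinearMap.smulRight_apply]
    exact smul_assoc _ _ _

theorem continuousOn_synthD (hf : IsModeFamily f β) (hβ : Integrable (fun ξ => ‖ξ‖ * β ξ)) :
    ContinuousOn (fun p : ℝ × Tan n => synthD f p.1 p.2) (Ici 0 ×ˢ univ) := by
  refine continuousOn_of_dominated (bound := fun ξ => 2 * Real.pi * (‖ξ‖ * β ξ))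
    (fun p hp => hf.aestronglyMeasurable_smulRight hp.1 p.2)
    (fun p hp => ae_of_all _ fun ξ => ?_) (hβ.const_mul _) (ae_of_all _ fun ξ => ?_)
  · rw [norm_smulRight_phase]
    gcongr
    exact hf.bound ξ _ hp.1
  · have h1 : ContinuousOn (fun p : ℝ × Tan n =>
        ((2 * Real.pi : ℝ) * Complex.I * phase ξ p.2) • f ξ p.1) (Ici 0 ×ˢ univ) :=
      (continuous_const.mul ((continuous_phase_right ξ).comp continuous_snd)).continuousOn.smul
        ((hf.cont ξ).comp continuousOn_fst fun p hp => hp.1)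
    exact ((ContinuousLinearMap.smulRightL ℝ (Tan n) X) (innerSL ℝ ξ)).continuous.comp_continuousOn
      h1

theorem synthD_apply (hf : IsModeFamily f β) (hβ : Integrable (fun ξ => ‖ξ‖ * β ξ))
    {t : ℝ} (ht : 0 ≤ t) (x v : Tan n) : synthD f t x v =
      ∫ ξ, phase ξ x • ((((2 * Real.pi * inner ℝ ξ v : ℝ) : ℂ) * Complex.I) • f ξ t) := by
  rw [synthD, ContinuousLinearMap.integral_apply]
  · refine integral_congr_ae (ae_of_all _ fun ξ => ?_)
    simp only [ContinuousLinearMap.smulRight_apply, innerSL_apply_apply]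
    rw [← Complex.coe_smul, smul_smul, smul_smul]
    congr 1
    push_cast
    ring
  · refine (hβ.const_mul (2 * Real.pi)).mono' (hf.aestronglyMeasurable_smulRight ht x)
      (ae_of_all _ fun ξ => ?_)
    rw [norm_smulRight_phase]
    gcongr
    exact hf.bound ξ t ht

end IsModeFamily

end Synthesis

/-! ### Evolution of the modes and the resulting solution. -/

section ModeSolution

variable {n : ℕ} {L : ℝ} [hL : Fact (0 ≤ L)]

/-- The multiplier `2πi⟨ξ, U(y)⟩` of the transport term. -/
def transportMul {U : ℝ → Tan n} (hU : ContinuousOn U (Icc 0 L)) (ξ : Tan n) : Profile L :=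
  Profile.mk (fun y => ((2 * Real.pi * inner ℝ ξ (U y) : ℝ) : ℂ) * Complex.I)
    (by fun_prop)

variable {U : ℝ → Tan n} (hU : ContinuousOn U (Icc 0 L))

theorem val_transportMul (ξ : Tan n) {y : ℝ} (hy : y ∈ Icc 0 L) : (transportMul hU ξ).val y =
    ((2 * Real.pi * inner ℝ ξ (U y) : ℝ) : ℂ) * Complex.I :=
  Profile.val_mk _ hy

theorem val_projIcc (f : Profile L) (y : ℝ) : f.val y = f.val (projIcc 0 L hL.out y) := by
  rw [Profile.val, Profile.val, projIcc_val]

theorem val_transportMul_re (ξ : Tan n) (y : ℝ) : ((transportMul hU ξ).val y).re = 0 := by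
  rw [val_projIcc, val_transportMul hU ξ (projIcc 0 L hL.out y).2]
  simp only [Complex.re_ofReal_mul, Complex.I_re, mul_zero]

theorem exists_norm_transportMul_sub_le :
    ∃ M, 0 ≤ M ∧ ∀ ξ η, ‖transportMul hU ξ - transportMul hU η‖ ≤ M * ‖ξ - η‖ := by
  obtain ⟨M, hM⟩ := isCompact_Icc.exists_bound_of_continuousOn hU
  have hM0 : 0 ≤ M := (norm_nonneg _).trans (hM 0 ⟨le_rfl, hL.out⟩)
  refine ⟨2 * Real.pi * M, by positivity, fun ξ η => Profile.norm_le (by positivity) fun y hy => ?_⟩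
  rw [Profile.val_sub, val_transportMul hU ξ hy, val_transportMul hU η hy, ← sub_mul,
    ← Complex.ofReal_sub, ← mul_sub, ← inner_sub_left, norm_mul, Complex.norm_I, mul_one,
    Complex.norm_real, norm_mul, Real.norm_of_nonneg (by positivity)]
  have h1 := norm_inner_le_norm (𝕜 := ℝ) (ξ - η) (U y)
  have h2 := hM y hy
  calc 2 * Real.pi * ‖inner ℝ (ξ - η) (U y)‖ ≤ 2 * Real.pi * (‖ξ - η‖ * ‖U y‖) := by gcongr
    _ ≤ 2 * Real.pi * (‖ξ - η‖ * M) := by gcongr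
    _ = _ := by ring

theorem continuous_transportMul : Continuous (transportMul hU) := by
  obtain ⟨M, hM0, hM⟩ := exists_norm_transportMul_sub_le hU
  refine (LipschitzWith.of_dist_le_mul (K := ⟨M, hM0⟩) fun ξ η => ?_).continuous
  rw [dist_eq_norm, dist_eq_norm]
  exact hM ξ η

/-- The time evolution of the modes. -/
def mode (a : Tan n → Profile L) (ξ : Tan n) (t : ℝ) : Profile L :=
  evolution (Profile.resolvent (transportMul hU ξ)) (a ξ) t

/-- Contractivity bounds every mode by its initial size. Measurability in `ξ` holds because the
Euler approximants are continuous in `ξ` and converge pointwise. -/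
theorem isModeFamily_mode (hL0 : 0 < L) {a q : Tan n → Profile L} (ha : Continuous a)
    (haq : ∀ ξ, Profile.IsGraph (transportMul hU ξ) (a ξ) (q ξ))
    (hint : Integrable fun ξ => ‖a ξ‖) : IsModeFamily (mode hU a) fun ξ => ‖a ξ‖ := by
  have hres := fun ξ => Profile.isContractionResolvent hL0 (val_transportMul_re hU ξ)
  refine ⟨fun ξ => (hres ξ).continuousOn_evolution (haq ξ), fun t ht => ?_,
    fun ξ t ht => (hres ξ).norm_evolution_le (haq ξ) ht, hint⟩
  refine (stronglyMeasurable_of_tendsto atTop (f := fun (j : ℕ) ξ =>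
    eulerStep (Profile.resolvent (transportMul hU ξ)) j t (a ξ)) (fun j => ?_)
    (tendsto_pi_nhds.2 fun ξ => (hres ξ).tendsto_eulerStep (haq ξ) ht)).aestronglyMeasurable
  refine Continuous.stronglyMeasurable ?_
  exact ((Profile.continuous_resolvent hL0 (continuous_transportMul hU)
    (val_transportMul_re hU) (by positivity)).pow _).clm_apply ha

/-- A superposition of modes is a solution. -/
theorem exists_isJetSol_of_modes (hL0 : 0 < L) {a q r : Tan n → Profile L} (ha : Continuous a)
    (hq : Continuous q) (haq : ∀ ξ, Profile.IsGraph (transportMul hU ξ) (a ξ) (q ξ))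
    (hqr : ∀ ξ, Profile.IsGraph (transportMul hU ξ) (q ξ) (r ξ))
    (hia : Integrable fun ξ => ‖a ξ‖) (hia1 : Integrable fun ξ => ‖ξ‖ * ‖a ξ‖)
    (hiq : Integrable fun ξ => ‖q ξ‖) :
    ∃ J, IsJetSol U L J ∧
      ∀ x y, (J (0, x, y)).1 = ((∫ ξ, phase ξ x • a ξ : Profile L).val y).re := by
  have hres := fun ξ => Profile.isContractionResolvent hL0 (val_transportMul_re hU ξ)
  set c := mode hU a with hc
  set z := mode hU q with hz
  -- `k` is minus the second `y`-derivative of the mode `c`, so `c` is recovered from it by the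
  -- Dirichlet operator. As this operator is bounded it passes through the superposition, and
  -- `y`-derivatives never need to be taken under the integral.
  set k : Tan n → ℝ → Profile L := fun ξ t => -(z ξ t + transportMul hU ξ * c ξ t) with hk
  have fc : IsModeFamily c _ := isModeFamily_mode hU hL0 ha haq hia
  have fz : IsModeFamily z _ := isModeFamily_mode hU hL0 hq hqr hiq
  obtain ⟨M, hM0, hM⟩ := exists_norm_transportMul_sub_le hU
  have hT0 : transportMul hU 0 = 0 := Profile.ext_val fun y hy => by
    rw [val_transportMul hU 0 hy, inner_zero_left, mul_zero, Complex.ofReal_zero, zero_mul]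
    rfl
  have hMξ : ∀ ξ, ‖transportMul hU ξ‖ ≤ M * ‖ξ‖ := fun ξ => by
    simpa [hT0] using hM ξ 0
  have fk : IsModeFamily k fun ξ => ‖q ξ‖ + M * (‖ξ‖ * ‖a ξ‖) := by
    refine ⟨fun ξ => ((fz.cont ξ).add (continuousOn_const.mul (fc.cont ξ))).neg, fun t ht => ?_,
      fun ξ t ht => ?_, hiq.add (hia1.const_mul M)⟩
    · exact ((fz.meas t ht).add
        ((continuous_transportMul hU).aestronglyMeasurable.mul (fc.meas t ht))).neg
    · rw [hk, norm_neg]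
      refine (norm_add_le _ _).trans (add_le_add (fz.bound ξ t ht) ((norm_mul_le _ _).trans ?_))
      rw [← mul_assoc]
      exact mul_le_mul (hMξ ξ) (fc.bound ξ t ht) (norm_nonneg _) (by positivity)
  have hck : ∀ ξ t, 0 ≤ t → c ξ t = Profile.dirichlet (k ξ t) := fun ξ t ht => by
    rw [hk, map_neg]
    exact (hres ξ).graph_evolution (Profile.isClosed_isGraph _) (haq ξ) (hqr ξ) ht
  have hdir : ∀ t, 0 ≤ t → ∀ x, synth c t x = Profile.dirichlet (synth k t x) := by
    intro t ht x
    rw [fk.map_synth _ ht]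
    exact integral_congr_ae (ae_of_all _ fun ξ => by simp only [hck ξ t ht])
  let ρ : ℝ → Profile L →L[ℝ] ℝ := fun y =>
    Complex.reCLM.comp ((Profile.evalCLM y).restrictScalars ℝ)
  let J : ℝ × Tan n × ℝ → JetVal n := fun p =>
    (((synth c p.1 p.2.1).val p.2.2).re, ((synth z p.1 p.2.1).val p.2.2).re,
      (ρ p.2.2).comp (synthD c p.1 p.2.1), ((Profile.dirichletD (synth k p.1 p.2.1)).val p.2.2).re,
      -((synth k p.1 p.2.1).val p.2.2).re)
  have hcval : ∀ {F : ℝ × Tan n → Profile L}, ContinuousOn F (Ici 0 ×ˢ univ) →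
      ContinuousOn (fun p : ℝ × Tan n × ℝ => ((F (p.1, p.2.1)).val p.2.2).re) (box n L) := by
    intro F hF
    refine Complex.continuous_re.comp_continuousOn
      (Profile.continuous_val_prod.comp_continuousOn (ContinuousOn.prodMk ?_ (by fun_prop)))
    exact hF.comp (by fun_prop) fun p hp => ⟨hp.1.1, mem_univ _⟩
  have hsub : Ico 0 L ⊆ Icc 0 L := Ico_subset_Icc_self
  have hderiv_re : ∀ {φ : ℝ → ℂ} {φ' : ℂ} {s : Set ℝ} {y : ℝ}, HasDerivWithinAt φ φ' s y →
      HasDerivWithinAt (fun y => (φ y).re) φ'.re s y := fun h =>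
    (Complex.reCLM.hasFDerivAt.comp_hasDerivWithinAt _ h)
  refine ⟨J, ⟨⟨?_, ?_, ?_, ?_, ?_⟩, ?_, ?_⟩, ?_⟩
  · refine (hcval fc.continuousOn_synth).prodMk ((hcval fz.continuousOn_synth).prodMk
      (ContinuousOn.prodMk ?_ (ContinuousOn.prodMk ?_ ?_)))
    · refine continuousOn_clm_apply.2 fun v => ?_
      exact hcval (F := fun p => synthD c p.1 p.2 v)
        ((fc.continuousOn_synthD hia1).clm_apply continuousOn_const)
    · exact hcval (F := fun p => Profile.dirichletD (synth k p.1 p.2))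
        (Profile.dirichletD.continuous.comp_continuousOn fk.continuousOn_synth)
    · exact (hcval fk.continuousOn_synth).neg
  · intro p hp
    have h := fc.hasDerivWithinAt_synth fz
      (fun ξ t ht => (hres ξ).hasDerivWithinAt_evolution (haq ξ) (hqr ξ) ht) hp.1.1 p.2.1
    exact ((ρ p.2.2).hasFDerivAt.comp_hasDerivWithinAt _ h).mono Ico_subset_Ici_self
  · intro p hp
    exact (ρ p.2.2).hasFDerivAt.comp _ (fc.hasFDerivAt_synth hia1 hp.1.1 p.2.1)
  · intro p hp
    have h := (Profile.hasDerivWithinAt_dirichlet (synth k p.1 p.2.1) (hsub hp.2.2)).mono hsub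
    rw [← hdir p.1 hp.1.1] at h
    exact hderiv_re h
  · intro p hp
    have h := (Profile.hasDerivWithinAt_dirichletD (synth k p.1 p.2.1) (hsub hp.2.2)).mono hsub
    exact hderiv_re h
  · intro p hp
    have hy := hsub hp.2.2
    have ht := hp.1.1
    change ((synth z p.1 p.2.1).val p.2.2).re + ((synthD c p.1 p.2.1 (U p.2.2)).val p.2.2).re =
      -((synth k p.1 p.2.1).val p.2.2).re
    rw [← Complex.add_re, ← Complex.neg_re]
    congr 1
    simp only [← Profile.evalCLM_apply]
    have ic : Integrable fun ξ => phase ξ p.2.1 •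
        ((((2 * Real.pi * inner ℝ ξ (U p.2.2) : ℝ) : ℂ) * Complex.I) • c ξ p.1) := by
      refine (hia1.const_mul (2 * Real.pi * ‖U p.2.2‖)).mono' ?_ (ae_of_all _ fun ξ => ?_)
      · have h1 : Continuous fun ξ =>
            ((2 * Real.pi * inner ℝ ξ (U p.2.2) : ℝ) : ℂ) * Complex.I := by fun_prop
        exact (continuous_phase_left _).aestronglyMeasurable.smul
          (h1.aestronglyMeasurable.smul (fc.meas _ ht))
      · rw [norm_smul, norm_phase, one_mul, norm_smul, norm_mul, Complex.norm_I, mul_one,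
          Complex.norm_real, norm_mul, Real.norm_of_nonneg (by positivity)]
        have h1 := norm_inner_le_norm (𝕜 := ℝ) ξ (U p.2.2)
        have h2 := fc.bound ξ _ ht
        calc 2 * Real.pi * ‖inner ℝ ξ (U p.2.2)‖ * ‖c ξ p.1‖
            ≤ 2 * Real.pi * (‖ξ‖ * ‖U p.2.2‖) * ‖a ξ‖ := by gcongr
          _ = _ := by ring
    rw [fc.synthD_apply hia1 ht, synth, synth,
      ← (Profile.evalCLM p.2.2).integral_comp_comm (fz.integrable_smul ht _),
      ← (Profile.evalCLM p.2.2).integral_comp_comm (fk.integrable_smul ht _),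
      ← (Profile.evalCLM p.2.2).integral_comp_comm ic, ← integral_add, ← integral_neg]
    · refine integral_congr_ae (ae_of_all _ fun ξ => ?_)
      simp only [hk, map_smul, map_neg, map_add, Profile.evalCLM_apply, Profile.val_mul,
        val_transportMul hU ξ hy, smul_eq_mul]
      ring
    · exact (Profile.evalCLM p.2.2).integrable_comp (fz.integrable_smul ht _)
    · exact (Profile.evalCLM p.2.2).integrable_comp ic
  · intro p hp h0
    change ((synth c p.1 p.2.1).val p.2.2).re = 0
    rw [h0, hdir p.1 hp.1.1, Profile.val_dirichlet_zero, Complex.zero_re]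
  · intro x y
    change ((synth c 0 x).val y).re = _
    simp only [synth, hc, mode, evolution_zero]

end ModeSolution
end ThermalLayer
end

noncomputable section

namespace ThermalLayer

open Filter Topology MeasureTheory Asymptotics
open scoped FourierTransform SchwartzMap LineDeriv

/-! ### Test functions as profile-valued Schwartz functions and their Fourier transform. -/

section Slices

variable {n : ℕ} {L : ℝ} [hL : Fact (0 ≤ L)]

open Classical in
/-- The profile of a function of `(x, y)` at fixed `x`. -/
def slice (L : ℝ) (F : Tan n → ℝ → ℝ) (x : Tan n) : Profile L :=
  if h : ContinuousOn (fun y => (F x y : ℂ)) (Icc 0 L) then Profile.mk _ h else 0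

variable {F G : Tan n → ℝ → ℝ}

theorem val_slice (hF : ContinuousOn (fun p : Tan n × ℝ => F p.1 p.2) (halfSpace n)) (x : Tan n)
    {y : ℝ} (hy : y ∈ Icc 0 L) : (slice L F x).val y = F x y := by
  have h : ContinuousOn (fun y => (F x y : ℂ)) (Icc 0 L) :=
    Complex.continuous_ofReal.comp_continuousOn
      (hF.comp (f := fun y : ℝ => (x, y)) (by fun_prop) fun y hy => ⟨mem_univ _, hy.1⟩)
  rw [slice, dif_pos h, Profile.val_mk h hy]

theorem continuous_slice (hF : ContinuousOn (fun p : Tan n × ℝ => F p.1 p.2) (halfSpace n)) :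
    Continuous (slice L F) := by
  have h : Continuous fun x => (slice L F x).toMap := by
    refine ContinuousMap.continuous_of_continuous_uncurry _ ?_
    have e : (Function.uncurry fun (x : Tan n) (y : Icc (0 : ℝ) L) => (slice L F x).toMap y) =
        fun p => (F p.1 p.2 : ℂ) := by
      funext p
      rw [← val_slice hF p.1 p.2.2, Profile.val, projIcc_val]
      rfl
    rw [e]
    exact Complex.continuous_ofReal.comp (hF.comp_continuous
      (f := fun p : Tan n × Icc (0 : ℝ) L => (p.1, (p.2 : ℝ))) (by fun_prop)
      fun p => ⟨mem_univ _, p.2.2.1⟩)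
  exact h

theorem val_real_smul (r : ℝ) (f : Profile L) (y : ℝ) : (r • f).val y = r * f.val y := rfl

theorem exists_hasFDerivAt_slice
    (hF : ContDiffOn ℝ ∞ (fun p : Tan n × ℝ => F p.1 p.2) (halfSpace n)) (x : Tan n) :
    ∃ D : Tan n →L[ℝ] Profile L, HasFDerivAt (slice L F) D x ∧
      ∀ v, D v = slice L (fun x y => fderiv ℝ (fun x' => F x' y) x v) x := by
  have hF' := contDiffOn_fderiv_slice hF
  have hFv : ∀ v, ContinuousOn (fun p : Tan n × ℝ => fderiv ℝ (fun x' => F x' p.2) p.1 v)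
      (halfSpace n) := fun v => (hF'.clm_apply contDiffOn_const).continuousOn
  let D : Tan n →L[ℝ] Profile L := LinearMap.toContinuousLinearMap
    { toFun := fun v => slice L (fun x y => fderiv ℝ (fun x' => F x' y) x v) x
      map_add' := fun v w => Profile.ext_val fun y hy => by
        rw [Profile.val_add, val_slice (hFv _) x hy, val_slice (hFv _) x hy,
          val_slice (hFv _) x hy, map_add, Complex.ofReal_add]
      map_smul' := fun c v => Profile.ext_val fun y hy => by
        rw [RingHom.id_apply, val_real_smul, val_slice (hFv _) x hy, val_slice (hFv _) x hy,
          map_smul, smul_eq_mul, Complex.ofReal_mul] }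
  have hD : ∀ v, D v = slice L (fun x y => fderiv ℝ (fun x' => F x' y) x v) x := fun v => rfl
  refine ⟨D, ?_, hD⟩
  -- Differentiability in the sup norm over `y` follows from continuity of the tangential derivative
  -- as a map into continuous functions on `[0, L]`, which compactness provides.
  let Gm : Tan n → C(Icc (0 : ℝ) L, Tan n →L[ℝ] ℝ) := fun x =>
    ⟨fun y => fderiv ℝ (fun x' => F x' y) x, hF'.continuousOn.comp_continuous
      (f := fun y : Icc (0 : ℝ) L => (x, (y : ℝ))) (by fun_prop) fun y => ⟨mem_univ _, y.2.1⟩⟩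
  have hGm : Continuous Gm := by
    refine ContinuousMap.continuous_of_continuous_uncurry _ ?_
    exact hF'.continuousOn.comp_continuous
      (f := fun p : Tan n × Icc (0 : ℝ) L => (p.1, (p.2 : ℝ))) (by fun_prop)
      fun p => ⟨mem_univ _, p.2.2.1⟩
  rw [hasFDerivAt_iff_isLittleO, isLittleO_iff]
  intro ε hε
  obtain ⟨δ, hδ, hδG⟩ := (Metric.continuousAt_iff (f := Gm) (a := x)).1 hGm.continuousAt ε hε
  filter_upwards [Metric.ball_mem_nhds x hδ] with x' hx'
  refine Profile.norm_le (by positivity) fun y hy => ?_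
  rw [Profile.val_sub, Profile.val_sub, hD, val_slice hF.continuousOn x' hy,
    val_slice hF.continuousOn x hy, val_slice (hFv _) x hy, ← Complex.ofReal_sub,
    ← Complex.ofReal_sub, Complex.norm_real]
  refine (convex_ball x δ).norm_image_sub_le_of_norm_hasFDerivWithin_le' (f := fun x => F x y)
    (f' := fun x => fderiv ℝ (fun x' => F x' y) x) (fun w _ => ?_) (fun w hw => ?_)
    (Metric.mem_ball_self hδ) hx'
  · have h1 := hasFDerivAt_slice_x (hF.differentiableOn (by simp)) (p := (w, y))
      ⟨mem_univ _, hy.1⟩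
    exact (h1.differentiableAt.hasFDerivAt).hasFDerivWithinAt
  · have h2 := (ContinuousMap.dist_apply_le_dist (f := Gm w) (g := Gm x) ⟨y, hy⟩).trans (hδG hw).le
    rwa [dist_eq_norm] at h2

theorem contDiff_slice (hF : ContDiffOn ℝ ∞ (fun p : Tan n × ℝ => F p.1 p.2) (halfSpace n)) :
    ContDiff ℝ ∞ (slice L F) := by
  rw [contDiff_infty]
  intro k
  induction k generalizing F with
  | zero => exact contDiff_zero.2 (continuous_slice hF.continuousOn)
  | succ k ih =>
    choose D hD hDv using exists_hasFDerivAt_slice (L := L) hF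
    refine contDiff_succ_iff_fderiv_apply.2 ⟨fun x => (hD x).differentiableAt,
      fun h => absurd h (WithTop.natCast_ne_top k), fun v => ?_⟩
    have e : (fun x => fderiv ℝ (slice L F) x v) =
        slice L (fun x y => fderiv ℝ (fun x' => F x' y) x v) := by
      funext x
      rw [(hD x).fderiv, hDv]
    rw [e]
    exact ih ((contDiffOn_fderiv_slice hF).clm_apply contDiffOn_const)

/-- Functions smooth up to the boundary and supported in `‖x‖ ≤ ρ`, `y ≤ ρ`. -/
structure IsTest (ρ : ℝ) (F : Tan n → ℝ → ℝ) : Prop where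
  smooth : ContDiffOn ℝ ∞ (fun p : Tan n × ℝ => F p.1 p.2) (halfSpace n)
  support_x : ∀ x y, 0 ≤ y → ρ < ‖x‖ → F x y = 0
  support_y : ∀ x y, 0 ≤ y → ρ < y → F x y = 0

namespace IsTest

variable {ρ : ℝ}

theorem sub (hF : IsTest ρ F) (hG : IsTest ρ G) : IsTest ρ fun x y => F x y - G x y where
  smooth := hF.smooth.sub hG.smooth
  support_x x y hy hx := by rw [hF.support_x x y hy hx, hG.support_x x y hy hx, sub_zero]
  support_y x y hy hx := by rw [hF.support_y x y hy hx, hG.support_y x y hy hx, sub_zero]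

theorem dHalf (hF : IsTest ρ F) : IsTest ρ fun x y => ThermalLayer.dHalf (F x) y where
  smooth := contDiffOn_derivWithin_slice hF.smooth
  support_x x y hy hx := by
    have e : ∀ z ∈ Ici (0 : ℝ), F x z = (fun _ => (0 : ℝ)) z := fun z hz => hF.support_x x z hz hx
    rw [ThermalLayer.dHalf, derivWithin_congr e (e y hy), derivWithin_fun_const]
    rfl
  support_y x y hy hx := by
    have e : F x =ᶠ[𝓝[Ici 0] y] fun _ => (0 : ℝ) := by
      filter_upwards [self_mem_nhdsWithin, mem_nhdsWithin_of_mem_nhds (Ioi_mem_nhds hx)]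
        with z hz hz' using hF.support_y x z hz hz'
    rw [ThermalLayer.dHalf, e.derivWithin_eq (hF.support_y x y hy hx), derivWithin_fun_const]
    rfl

theorem transport (hF : IsTest ρ F) {U : ℝ → Tan n} (hU : ContDiffOn ℝ ∞ U (Ici 0)) :
    IsTest ρ fun x y => fderiv ℝ (fun x' => F x' y) x (U y) where
  smooth := (contDiffOn_fderiv_slice hF.smooth).clm_apply
    (hU.comp contDiffOn_snd fun p hp => hp.2)
  support_x x y hy hx := by
    have e : (fun x' => F x' y) =ᶠ[𝓝 x] fun _ => (0 : ℝ) := by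
      filter_upwards [continuous_norm.continuousAt.eventually (Ioi_mem_nhds hx)] with z hz
      exact hF.support_x z y hy hz
    rw [e.fderiv_eq, fderiv_const_apply]
    rfl
  support_y x y hy hx := by
    have e : (fun x' => F x' y) = fun _ => (0 : ℝ) := funext fun z => hF.support_y z y hy hx
    rw [e, fderiv_const_apply]
    rfl

theorem hasCompactSupport_slice (hF : IsTest ρ F) : HasCompactSupport (slice L F) := by
  refine HasCompactSupport.intro (isCompact_closedBall 0 ρ) fun x hx => ?_
  rw [mem_closedBall_zero_iff, not_le] at hx
  refine Profile.ext_val fun y hy => ?_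
  rw [val_slice hF.smooth.continuousOn x hy, hF.support_x x y hy.1 hx]
  exact Complex.ofReal_zero

/-- A test function as a Schwartz function with values in profiles. -/
def schwartz (hF : IsTest ρ F) : 𝓢(Tan n, Profile L) :=
  hF.hasCompactSupport_slice.toSchwartzMap (contDiff_slice hF.smooth)

theorem integrable_slice (hF : IsTest ρ F) : Integrable (slice L F) volume :=
  (hF.schwartz (L := L)).integrable

/-- The scalar sections of a test function as Schwartz functions. -/
def sectionSchwartz (hF : IsTest ρ F) (y : ℝ) : 𝓢(Tan n, ℂ) :=
  (hF.hasCompactSupport_slice.comp_left (g := fun f : Profile L => f.val y) rfl).toSchwartzMap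
    (((Profile.evalCLM (L := L) y).restrictScalars ℝ).contDiff.comp (contDiff_slice hF.smooth))

end IsTest

theorem integrable_fourier_kernel {X : Type*} [NormedAddCommGroup X] [NormedSpace ℂ X]
    {f : Tan n → X} (hf : Integrable f) (ξ : Tan n) : Integrable fun x : Tan n =>
      Complex.exp (((-2 * Real.pi * inner ℝ x ξ : ℝ) : ℂ) * Complex.I) • f x := by
  have h1 : Continuous fun x : Tan n =>
      Complex.exp (((-2 * Real.pi * inner ℝ x ξ : ℝ) : ℂ) * Complex.I) := by fun_prop
  refine hf.norm.mono' (h1.aestronglyMeasurable.smul hf.1) (ae_of_all _ fun x => ?_)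
  rw [norm_smul, Complex.norm_exp_ofReal_mul_I, one_mul]

theorem map_fourier {X Y : Type*} [NormedAddCommGroup X] [NormedSpace ℂ X] [CompleteSpace X]
    [NormedAddCommGroup Y] [NormedSpace ℂ Y] [CompleteSpace Y] (T : X →L[ℂ] Y)
    {f : Tan n → X} (hf : Integrable f) (ξ : Tan n) : T (𝓕 f ξ) = 𝓕 (fun x => T (f x)) ξ := by
  rw [Real.fourier_eq', Real.fourier_eq', ← T.integral_comp_comm (integrable_fourier_kernel hf ξ)]
  simp only [map_smul]

theorem fourier_add_of_integrable {X : Type*} [NormedAddCommGroup X] [NormedSpace ℂ X]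
    {f g : Tan n → X} (hf : Integrable f) (hg : Integrable g) (ξ : Tan n) :
    𝓕 (fun x => f x + g x) ξ = 𝓕 f ξ + 𝓕 g ξ := by
  rw [Real.fourier_eq', Real.fourier_eq', Real.fourier_eq',
    ← integral_add (integrable_fourier_kernel hf ξ) (integrable_fourier_kernel hg ξ)]
  simp only [smul_add]

variable {ρ : ℝ}

/-- After evaluation at `y` the direction `U y` is constant, and the claim is the rule for the
Fourier transform of a directional derivative of a scalar Schwartz function. -/
theorem fourier_transport (hF : IsTest ρ F) {U : ℝ → Tan n} (hU : ContDiffOn ℝ ∞ U (Ici 0))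
    (ξ : Tan n) :
    𝓕 (slice L fun x y => fderiv ℝ (fun x' => F x' y) x (U y)) ξ =
      transportMul (hU.continuousOn.mono Icc_subset_Ici_self) ξ * 𝓕 (slice L F) ξ := by
  refine Profile.ext_val fun y hy => ?_
  rw [Profile.val_mul, val_transportMul _ ξ hy, ← Profile.evalCLM_apply, ← Profile.evalCLM_apply,
    map_fourier _ (hF.transport hU).integrable_slice, map_fourier _ hF.integrable_slice]
  have h1 := congrArg (fun g : 𝓢(Tan n, ℂ) => g ξ)
    (SchwartzMap.fourier_lineDerivOp_eq (hF.sectionSchwartz (L := L) y) (U y))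
  have hg : (fun η : Tan n => inner ℝ η (U y)).HasTemperateGrowth := by fun_prop
  have e1 : ((∂_{U y} (hF.sectionSchwartz (L := L) y) : 𝓢(Tan n, ℂ)) : Tan n → ℂ) = fun x =>
      Profile.evalCLM y (slice L (fun x y => fderiv ℝ (fun x' => F x' y) x (U y)) x) := by
    funext x
    rw [SchwartzMap.lineDerivOp_apply_eq_fderiv]
    obtain ⟨D, hD, hDv⟩ := exists_hasFDerivAt_slice (L := L) hF.smooth x
    have h2 : HasFDerivAt (hF.sectionSchwartz (L := L) y)
        (((Profile.evalCLM (L := L) y).restrictScalars ℝ).comp D) x :=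
      ((Profile.evalCLM (L := L) y).restrictScalars ℝ).hasFDerivAt.comp x hD
    rw [h2.fderiv]
    change (D (U y)).val y = (slice L _ x).val y
    rw [hDv, val_slice ((contDiffOn_fderiv_slice hF.smooth).clm_apply contDiffOn_const).continuousOn
      x hy, val_slice (hF.transport hU).smooth.continuousOn x hy]
  simp only [SchwartzMap.fourier_coe, e1] at h1
  rw [h1]
  simp only [smul_apply, SchwartzMap.smulLeftCLM_apply_apply hg, SchwartzMap.fourier_coe]
  change (2 * Real.pi * Complex.I : ℂ) • (inner ℝ ξ (U y) : ℝ) •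
    𝓕 (fun x => Profile.evalCLM y (slice L F x)) ξ = _
  rw [← Complex.coe_smul, smul_smul, smul_eq_mul]
  congr 1
  push_cast
  ring

/-- The operator `∂_y² - U · ∇_h`. -/
def heatTransport (U : ℝ → Tan n) (F : Tan n → ℝ → ℝ) : Tan n → ℝ → ℝ := fun x y =>
  dHalf (dHalf (F x)) y - fderiv ℝ (fun x' => F x' y) x (U y)

theorem IsTest.heatTransport (hF : IsTest ρ F) {U : ℝ → Tan n} (hU : ContDiffOn ℝ ∞ U (Ici 0)) :
    IsTest ρ (heatTransport U F) :=
  hF.dHalf.dHalf.sub (hF.transport hU)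

theorem hasDerivWithinAt_slice_val (hF : IsTest ρ F) (x : Tan n) {y : ℝ} (hy : y ∈ Icc 0 L) :
    HasDerivWithinAt (slice L F x).val ((slice L (fun x y => dHalf (F x) y) x).val y) (Icc 0 L)
      y := by
  have h1 := (hasDerivWithinAt_slice_y (hF.smooth.differentiableOn (by simp)) (p := (x, y))
    ⟨mem_univ _, hy.1⟩).differentiableWithinAt.hasDerivWithinAt
  rw [val_slice hF.dHalf.smooth.continuousOn x hy]
  have h2 := (Complex.ofRealCLM.hasFDerivAt.comp_hasDerivWithinAt y h1).mono
    (Icc_subset_Ici_self : Icc 0 L ⊆ Ici 0)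
  exact h2.congr (fun z hz => val_slice hF.smooth.continuousOn x hz)
    (val_slice hF.smooth.continuousOn x hy)

/-- Each slice vanishes at `0` by assumption and at `L` because its support lies in `y ≤ ρ < L`; it
is therefore recovered from its second derivative by the Dirichlet operator, which commutes with the
Fourier transform. -/
theorem isGraph_fourier (hL0 : 0 < L) (hρ : ρ < L) (hF : IsTest ρ F) {U : ℝ → Tan n}
    (hU : ContDiffOn ℝ ∞ U (Ici 0)) (h0 : ∀ x, F x 0 = 0) (ξ : Tan n) :
    Profile.IsGraph (transportMul (hU.continuousOn.mono (Icc_subset_Ici_self : Icc 0 L ⊆ Ici 0)) ξ)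
      (𝓕 (slice L F) ξ) (𝓕 (slice L (heatTransport U F)) ξ) := by
  have h1 : ∀ x, slice L F x =
      -Profile.dirichlet (slice L (fun x y => dHalf (dHalf (F x)) y) x) := by
    intro x
    rw [← map_neg]
    refine Profile.eq_dirichlet hL0 (fun y hy => hasDerivWithinAt_slice_val hF x hy)
      (fun y hy => hasDerivWithinAt_slice_val hF.dHalf x hy) ?_ ?_
    · rw [val_slice hF.smooth.continuousOn x ⟨le_rfl, hL0.le⟩, h0, Complex.ofReal_zero]
    · rw [val_slice hF.smooth.continuousOn x ⟨hL0.le, le_rfl⟩, hF.support_y x L hL0.le hρ,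
        Complex.ofReal_zero]
  have h2 : ∀ x, slice L (fun x y => dHalf (dHalf (F x)) y) x = slice L (heatTransport U F) x +
      slice L (fun x y => fderiv ℝ (fun x' => F x' y) x (U y)) x := by
    intro x
    refine Profile.ext_val fun y hy => ?_
    rw [Profile.val_add, val_slice hF.dHalf.dHalf.smooth.continuousOn x hy,
      val_slice (hF.heatTransport hU).smooth.continuousOn x hy,
      val_slice (hF.transport hU).smooth.continuousOn x hy, ← Complex.ofReal_add, heatTransport,
      sub_add_cancel]
  have h3 : 𝓕 (slice L (fun x y => dHalf (dHalf (F x)) y)) ξ =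
      𝓕 (slice L (heatTransport U F)) ξ +
        𝓕 (slice L (fun x y => fderiv ℝ (fun x' => F x' y) x (U y))) ξ := by
    rw [funext h2, fourier_add_of_integrable (hF.heatTransport hU).integrable_slice
      (hF.transport hU).integrable_slice]
  unfold Profile.IsGraph
  rw [← fourier_transport hF hU, ← h3, funext h1]
  exact (map_fourier (-Profile.dirichlet) hF.dHalf.dHalf.integrable_slice ξ).symm

/-- Test functions satisfying the compatibility conditions evolve for all times. -/
theorem exists_isJetSol_of_isTest (hL0 : 0 < L) (hρ : ρ < L) (hF : IsTest ρ F) {U : ℝ → Tan n}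
    (hU : ContDiffOn ℝ ∞ U (Ici 0)) (h0 : ∀ x, F x 0 = 0) (h1 : ∀ x, heatTransport U F x 0 = 0) :
    ∃ J, IsJetSol U L J ∧ HasInitial L J F := by
  have hq := hF.heatTransport hU
  have hcoe : ∀ {G : Tan n → ℝ → ℝ} (hG : IsTest ρ G),
      ((𝓕 (hG.schwartz (L := L)) : 𝓢(Tan n, Profile L)) : Tan n → Profile L) = 𝓕 (slice L G) := fun hG => rfl
  have hcont : ∀ {G : Tan n → ℝ → ℝ} (hG : IsTest ρ G), Continuous (𝓕 (slice L G)) := fun hG => by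
    rw [← hcoe hG]; exact SchwartzMap.continuous _
  have hpow : ∀ {G : Tan n → ℝ → ℝ} (hG : IsTest ρ G) (k : ℕ),
      Integrable fun ξ => ‖ξ‖ ^ k * ‖𝓕 (slice L G) ξ‖ := fun hG k => by
    rw [← hcoe hG]; exact SchwartzMap.integrable_pow_mul volume _ k
  -- The graph relation is used for `F` and for its image under `heatTransport`: the two boundary
  -- conditions place the data in the domain of the square of the operator. A third condition is not
  -- needed.
  obtain ⟨J, hJ, hJ0⟩ := exists_isJetSol_of_modes
    (hU.continuousOn.mono (Icc_subset_Ici_self : Icc 0 L ⊆ Ici 0)) hL0 (hcont hF) (hcont hq)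
    (isGraph_fourier hL0 hρ hF hU h0) (isGraph_fourier hL0 hρ hq hU h1)
    (by simpa using hpow hF 0) (by simpa using hpow hF 1) (by simpa using hpow hq 0)
  refine ⟨J, hJ, fun x y hp => ?_⟩
  have e : ∫ ξ, phase ξ x • 𝓕 (slice L F) ξ = slice L F x := by
    have h2 := congrFun ((continuous_slice hF.smooth.continuousOn).fourierInv_fourier_eq
      hF.integrable_slice (by rw [← hcoe hF]; exact SchwartzMap.integrable _)) x
    rw [Real.fourierInv_eq'] at h2
    exact h2
  rw [hJ0, e, val_slice hF.smooth.continuousOn x (Ico_subset_Icc_self hp.2.2), Complex.ofReal_re]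

end Slices
end ThermalLayer
end

noncomputable section

namespace ThermalLayer

open Filter Topology MeasureTheory Asymptotics

/-! ### Localization of the data and global existence of the temperature. -/

section LocalSolution

variable {n : ℕ}

theorem dHalf_eventuallyEq_const_mul {f g : ℝ → ℝ} {c R : ℝ}
    (h : ∀ y ∈ Ico 0 R, f y = c * g y) : ∀ y ∈ Ico 0 R, dHalf f y = c * dHalf g y := by
  intro y hy
  have e : f =ᶠ[𝓝[Ici 0] y] fun z => c * g z := by
    filter_upwards [Ico_mem_nhdsWithin_Ici' hy] with z hz using h z hz
  rw [dHalf, e.derivWithin_eq (h y hy), derivWithin_const_mul_field]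
  rfl

/-- Compatible smooth data have a solution on every box. -/
theorem exists_local_jetSol {U : ℝ → Tan n} {θ₀ : Tan n → ℝ → ℝ} (hU : ContDiffOn ℝ ∞ U (Ici 0))
    (hθ₀ : ContDiffOn ℝ ∞ (fun p : Tan n × ℝ => θ₀ p.1 p.2) (halfSpace n))
    (hcomp : Compatible U θ₀) {R : ℝ} (hR : 0 < R) :
    ∃ J, IsJetSol U R J ∧ HasInitial R J θ₀ := by
  let χ : ContDiffBump (0 : Tan n) := ⟨R, R + 1, hR, by linarith⟩
  let ψ : ContDiffBump (0 : ℝ) := ⟨R, R + 1, hR, by linarith⟩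
  -- The cutoff in `y` equals one near `y = 0` and the cutoff in `x'` does not involve `y`, so
  -- multiplication preserves the compatibility conditions.
  set F : Tan n → ℝ → ℝ := fun x y => χ x * ψ y * θ₀ x y with hFdef
  have hψ : ∀ y ∈ Ico 0 R, ψ y = 1 := fun y hy => ψ.one_of_mem_closedBall <| by
    rw [mem_closedBall_zero_iff, Real.norm_of_nonneg hy.1]; exact hy.2.le
  have hχ : ∀ x ∈ Metric.ball (0 : Tan n) R, χ x = 1 := fun x hx =>
    χ.one_of_mem_closedBall (Metric.ball_subset_closedBall hx)
  have hF : IsTest (R + 1) F := by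
    refine ⟨?_, fun x y _ hx => ?_, fun x y hy0 hy => ?_⟩
    · exact ((χ.contDiff.comp contDiff_fst).contDiffOn.mul
        (ψ.contDiff.comp contDiff_snd).contDiffOn).mul hθ₀
    · simp only [hFdef]
      rw [χ.zero_of_le_dist (by rw [dist_zero_right]; exact hx.le), zero_mul, zero_mul]
    · simp only [hFdef]
      rw [ψ.zero_of_le_dist (by rw [dist_zero_right, Real.norm_of_nonneg hy0]; exact hy.le),
        mul_zero, zero_mul]
  have h0 : ∀ x, F x 0 = 0 := fun x => by simp only [hFdef, hcomp.1 x, mul_zero]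
  have h1 : ∀ x, heatTransport U F x 0 = 0 := by
    intro x
    have e1 : (fun x' => F x' 0) = fun _ => (0 : ℝ) := funext h0
    have e2 : (fun x' => θ₀ x' 0) = fun _ => (0 : ℝ) := funext hcomp.1
    have h2 := hcomp.2 x
    rw [dirDeriv, e2, fderiv_const_apply, zero_apply, sub_zero] at h2
    have h3 : ∀ y ∈ Ico 0 R, F x y = χ x * θ₀ x y := fun y hy => by
      simp only [hFdef, hψ y hy, mul_one]
    rw [heatTransport, e1, fderiv_const_apply, zero_apply, sub_zero,
      dHalf_eventuallyEq_const_mul (dHalf_eventuallyEq_const_mul h3) 0 ⟨le_rfl, hR⟩, h2, mul_zero]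
  -- The support lies in `y ≤ R + 1`, so at `L = R + 2` the data satisfy the artificial Dirichlet
  -- condition to every order.
  have : Fact (0 ≤ R + 2) := ⟨by linarith⟩
  obtain ⟨J, hJ, hJ0⟩ := exists_isJetSol_of_isTest (L := R + 2) (by linarith) (by linarith) hF hU
    h0 h1
  refine ⟨J, hJ.mono (by linarith), fun x y hp => ?_⟩
  rw [hJ0 x y (box_mono (by linarith) hp)]
  simp only [hFdef, hχ x hp.2.1, hψ y hp.2.2, one_mul]

/-- The temperature problem with compatible smooth data has a global classical solution. -/
theorem exists_isTemperatureSolution {U : ℝ → Tan n} {θ₀ : Tan n → ℝ → ℝ}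
    (hU : ContDiffOn ℝ ∞ U (Ici 0))
    (hθ₀ : ContDiffOn ℝ ∞ (fun p : Tan n × ℝ => θ₀ p.1 p.2) (halfSpace n))
    (hcomp : Compatible U θ₀) : ∃ θ, IsTemperatureSolution U θ₀ θ := by
  obtain ⟨J, hJ, hJ0⟩ := exists_global_jetSol
    (fun R hR => exists_local_jetSol hU hθ₀ hcomp hR)
    (fun r R ε hr hrR hε D hD h0 => exists_global_approx hU.continuousOn hr hrR hε hD h0)
  refine ⟨_, isTemperatureSolution_of_isJetSol hJ fun x y hy => ?_⟩
  obtain ⟨R, hR⟩ := exists_mem_box (n := n) (p := (0, x, y)) ⟨mem_Ici.2 le_rfl, trivial, hy⟩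
  exact hJ0 R x y hR

end LocalSolution
end ThermalLayer
end

theorem mainTheorem5 (n : ℕ)
    (U : ℝ → ThermalLayer.Tan n)
    (u₀ : ThermalLayer.Tan n → ℝ → ThermalLayer.Tan n)
    (θ₀ : ThermalLayer.Tan n → ℝ → ℝ)
    (hU : ContDiffOn ℝ ∞ U (Ici 0))
    (hu₀ : ContDiffOn ℝ ∞ (fun p : ThermalLayer.Tan n × ℝ => u₀ p.1 p.2)
      (ThermalLayer.halfSpace n))
    (hθ₀ : ContDiffOn ℝ ∞ (fun p : ThermalLayer.Tan n × ℝ => θ₀ p.1 p.2)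
      (ThermalLayer.halfSpace n))
    (hcomp : ThermalLayer.Compatible U θ₀) :
    (∃ θ : ℝ → ThermalLayer.Tan n → ℝ → ℝ, ThermalLayer.IsTemperatureSolution U θ₀ θ) ∧
    ∀ θ : ℝ → ThermalLayer.Tan n → ℝ → ℝ, ThermalLayer.IsTemperatureSolution U θ₀ θ →
      ∃ (uh : ℝ → ThermalLayer.Tan n → ℝ → ThermalLayer.Tan n)
        (ud : ℝ → ThermalLayer.Tan n → ℝ → ℝ),
        ThermalLayer.IsLinearizedSolution U u₀ θ₀ uh ud θ ∧
        (∀ t x y, 0 ≤ t → 0 ≤ y →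
          uh t x y =
            u₀ (x - t • U y) y
            + (t * ∫ z in (0 : ℝ)..y,
                ThermalLayer.divH (fun x' => u₀ x' z) (x - t • U z)) • ThermalLayer.dHalf U y
            + (∫ z in (0 : ℝ)..y, θ₀ (x - t • U z) z) • ThermalLayer.dHalf U y
            - (∫ z in (0 : ℝ)..y, θ t x z) • ThermalLayer.dHalf U y) ∧
        (∀ t x y, 0 ≤ t → 0 ≤ y →
          ud t x y =
            ThermalLayer.dy θ t x y - ThermalLayer.dy θ t x 0
            - (∫ z in (0 : ℝ)..y, ThermalLayer.divH (fun x' => u₀ x' z) (x - t • U z))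
            - t * (∫ z in (0 : ℝ)..y,
                ThermalLayer.dirDeriv (U y - U z)
                  (fun ξ => ThermalLayer.divH (fun x' => u₀ x' z) ξ) (x - t • U z))
            - (∫ z in (0 : ℝ)..y,
                ThermalLayer.dirDeriv (U y - U z) (fun ξ => θ₀ ξ z) (x - t • U z))
            + (∫ z in (0 : ℝ)..y,
                ThermalLayer.dirDeriv (U y - U z) (fun x' => θ t x' z) x)) := by
  exact ⟨ThermalLayer.exists_isTemperatureSolution hU hθ₀ hcomp, fun θ hθ =>
    ⟨ThermalLayer.uhFormula U u₀ θ₀ θ, ThermalLayer.udFormula U u₀ θ₀ θ,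
      ThermalLayer.isLinearizedSolution_of_temperature hU hu₀ hθ₀ hθ,
      fun _ _ _ _ _ => rfl, fun _ _ _ _ _ => rfl⟩⟩
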